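/- Let $\alpha\in\mathbb R$, $\alpha<1$, $\alpha\neq\frac14$, and let $m\in\mathbb C$ with $m^2=\alpha$. In $L^2(\mathbb R_+)$, let $L_\alpha^{\max}$ be the operator $L_\alpha f=-f''+(\alpha-\frac14)x^{-2}f$ (distributional sense on $]0,\infty[$) with domain $\{f\in L^2(\mathbb R_+)\mid L_\alpha f\in L^2(\mathbb R_+)\}$, and let $\mathcal F_{\mathrm D}$, $\mathcal F_{\mathrm N}$ be the sine and cosine transformations $\mathcal F_{\mathrm D}f(p)=\sqrt{2/\pi}\int_0^\infty\sin(px)f(x)\,dx$, $\mathcal F_{\mathrm N}f(p)=\sqrt{2/\pi}\int_0^\infty\cos(px)f(x)\,dx$, extended to $L^2(\mathbb R_+)$; they are unitary involutions. Put $$k_{\mathrm D}(p,q)=\theta(p-q)q+\theta(q-p)p=\min(p,q),\qquad k_{\mathrm N}(p,q)=\theta(p-q)p+\theta(q-p)q=\max(p,q).$$ Let $\tilde L^{\min}_{\alpha,\mathrm D}$ be the closure of $\psi\mapsto p^2\psi(p)+(\alpha-\frac14)\int_0^\infty k_{\mathrm D}(p,q)\psi(q)\,dq$ on the space of $\psi\in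 L^2(\mathbb R_+)$ with $\int_0^\infty|\psi|^2p^n\,dp<\infty$ for all $n\in\mathbb N$ and $\int_0^\infty\psi(p)p\,dp=0$, and let $\tilde L^{\min}_{\alpha,\mathrm N}$ be the closure of $\psi\mapsto p^2\psi(p)-(\alpha-\frac14)\int_0^\infty k_{\mathrm N}(p,q)\psi(q)\,dq$ on the space defined in the same way with $\int_0^\infty\psi(p)\,dp=0$ instead. If $\alpha\ne0$, choose $\psi_{\pm m,\mathrm D},\psi_{\pm m,\mathrm N}\in L^2(\mathbb R_+)$ such that, for some $\Lambda_0>0$, all these functions satisfy $\psi_{\pm m,\mathrm{D/N}}(p)=p^{-\frac32\mp m}$ for $p>\Lambda_0$, and $$\int_0^{\Lambda_0}\psi_{\pm m,\mathrm D}(q)\,q\,dq=\frac{\Lambda_0^{\frac12\mp m}}{\frac12\mp m},\qquad \int_0^{\Lambda_0}\psi_{\pm m,\mathrm N}(q)\,dq=\frac{\Lambda_0^{-\frac12\mp m}}{-\frac12\mp m}.$$ If $\alpha=0$, let $\psi_{0,\mathrm D},\psi_{0,\mathrm N}$ satisfy these conditions with $m=0$, and let $\psi_{\log,\mathrm D},\psi_{\log,\mathrm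 N}\in L^2(\mathbb R_+)$ be equal to $p^{-\frac32}\log p$ for $p>\Lambda_0$, with $$\int_0^{\Lambda_0}\psi_{\log,\mathrm D}(q)\,q\,dq=-4\Lambda_0^{\frac12}+2\Lambda_0^{\frac12}\log\Lambda_0,\qquad \int_0^{\Lambda_0}\psi_{\log,\mathrm N}(q)\,dq=-4\Lambda_0^{-\frac12}-2\Lambda_0^{-\frac12}\log\Lambda_0.$$ (The number $\Lambda_0$ may depend on the function. Such functions exist.) For $\mathrm X\in\{\mathrm D,\mathrm N\}$ write $(\psi_+,\psi_-)=(\psi_{m,\mathrm X},\psi_{-m,\mathrm X})$ if $\alpha\neq0$ and $(\psi_+,\psi_-)=(\psi_{\log,\mathrm X},\psi_{0,\mathrm X})$ if $\alpha=0$, and set $$\mathcal D(\tilde L^{\max}_{\alpha,\mathrm X})=\mathcal D(\tilde L^{\min}_{\alpha,\mathrm X})+\mathbb C\psi_++\mathbb C\psi_-.$$ For $\psi$ in this domain let $\tilde c_\pm$ be the coefficients with $\psi-\tilde c_+\psi_+-\tilde c_-\psi_-\in\mathcal D(\tilde L^{\min}_{\alpha,\mathrm X})$, and set $$\tilde L^{\max}_{\alpha,\mathrm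 D}\psi(p)=p^2\psi(p)+\Big(\alpha-\tfrac14\Big)\lim_{\Lambda\to\infty}\Big(\int_0^\Lambda k_{\mathrm D}(p,q)\psi(q)\,dq+C_{\mathrm D}(\Lambda,p)\Big),$$ $$\tilde L^{\max}_{\alpha,\mathrm N}\psi(p)=p^2\psi(p)-\Big(\alpha-\tfrac14\Big)\lim_{\Lambda\to\infty}\Big(\int_0^\Lambda k_{\mathrm N}(p,q)\psi(q)\,dq+C_{\mathrm N}(\Lambda)\Big),$$ where for $\alpha\neq0$ $$C_{\mathrm D}=\frac{\tilde c_+\,p\,\Lambda^{-\frac12-m}}{\frac12+m}+\frac{\tilde c_-\,p\,\Lambda^{-\frac12+m}}{\frac12-m},\qquad C_{\mathrm N}=-\frac{\tilde c_+\Lambda^{\frac12-m}}{\frac12-m}-\frac{\tilde c_-\Lambda^{\frac12+m}}{\frac12+m},$$ and for $\alpha=0$ $$C_{\mathrm D}=\tilde c_+\,p\,\big(4\Lambda^{-\frac12}+2\Lambda^{-\frac12}\log\Lambda\big)+2\tilde c_-\,p\,\Lambda^{-\frac12},\qquad C_{\mathrm N}=\tilde c_+\big(4\Lambda^{\frac12}-2\Lambda^{\frac12}\log\Lambda\big)-2\tilde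 c_-\Lambda^{\frac12}.$$ Then $\tilde L^{\max}_{\alpha,\mathrm D}$ and $\tilde L^{\max}_{\alpha,\mathrm N}$ are well defined (the coefficients $\tilde c_\pm$ are unique, the limits exist for all $p>0$, the results are in $L^2(\mathbb R_+)$, and the operators do not depend on the choice of $\psi_\pm$) and closed, and $$\tilde L^{\max}_{\alpha,\mathrm D}=\mathcal F_{\mathrm D}L_\alpha^{\max}\mathcal F_{\mathrm D},\qquad \tilde L^{\max}_{\alpha,\mathrm N}=\mathcal F_{\mathrm N}L_\alpha^{\max}\mathcal F_{\mathrm N}.$$ -/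

import Mathlib

open MeasureTheory Set Filter Topology FourierTransform
open scoped ContDiff ENNReal

/-- Lebesgue measure on the half-line `]0,∞[`. -/
noncomputable abbrev halfLine : Measure ℝ := volume.restrict (Ioi (0 : ℝ))

/-- The Hilbert space `L²(ℝ₊)`. -/
abbrev L2Half : Type := Lp ℂ 2 halfLine

/-! ### Sine and cosine transformation -/

/-- Extension of a function on the half-line to the line, with `f (-x) = s * f x`:
the odd extension for `s = -1`, the even extension for `s = 1`. -/
noncomputable def parityExtend (s : ℂ) (f : ℝ → ℂ) : ℝ → ℂ :=
  fun x => (Ioi (0 : ℝ)).indicator f x + s * (Ioi (0 : ℝ)).indicator f (-x)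

theorem memLp_parityExtend (s : ℂ) (f : L2Half) : MemLp (parityExtend s f) 2 volume := by
  have h : MemLp ((Ioi (0 : ℝ)).indicator (f : ℝ → ℂ)) 2 volume :=
    (memLp_indicator_iff_restrict measurableSet_Ioi).2 (Lp.memLp f)
  exact h.add ((h.comp_measurePreserving (Measure.measurePreserving_neg volume)).const_mul s)

theorem parityExtend_congr (s : ℂ) {f g : ℝ → ℂ} (h : f =ᵐ[halfLine] g) :
    parityExtend s f =ᵐ[volume] parityExtend s g := by
  have h1 : (Ioi (0 : ℝ)).indicator f =ᵐ[volume] (Ioi (0 : ℝ)).indicator g :=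
    (ae_eq_restrict_iff_indicator_ae_eq measurableSet_Ioi).1 h
  have h2 := (Measure.measurePreserving_neg
    (volume : Measure ℝ)).quasiMeasurePreserving.ae_eq_comp h1
  filter_upwards [h1, h2] with x hx hx'
  simp only [Function.comp] at hx'
  simp only [parityExtend, hx, hx']

/-- `f ↦ parityExtend s f` as a linear map from `L²(ℝ₊)` to `L²(ℝ)`. -/
noncomputable def parityExtendL2 (s : ℂ) : L2Half →ₗ[ℂ] Lp ℂ 2 (volume : Measure ℝ) where
  toFun f := (memLp_parityExtend s f).toLp _
  map_add' f g := by
    rw [← MemLp.toLp_add]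
    refine MemLp.toLp_congr _ _ ((parityExtend_congr s (Lp.coeFn_add f g)).trans ?_)
    refine Eventually.of_forall fun x => ?_
    simp only [parityExtend, Pi.add_apply, indicator_add']
    ring
  map_smul' c f := by
    rw [RingHom.id_apply, ← MemLp.toLp_const_smul]
    refine MemLp.toLp_congr _ _ ((parityExtend_congr s (Lp.coeFn_smul c f)).trans ?_)
    refine Eventually.of_forall fun x => ?_
    simp only [parityExtend, Pi.smul_apply, smul_eq_mul, indicator_apply]
    split_ifs <;> ring

theorem map_div_two_pi : Measure.map (fun p : ℝ => p / (2 * Real.pi)) volume =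
    ENNReal.ofReal (2 * Real.pi) • (volume : Measure ℝ) := by
  have h := Real.map_volume_mul_right (a := (2 * Real.pi)⁻¹) (by positivity)
  rw [inv_inv, abs_of_pos (by positivity)] at h
  simpa only [div_eq_mul_inv] using h

theorem quasiMeasurePreserving_div_two_pi : Measure.QuasiMeasurePreserving
    (fun p : ℝ => p / (2 * Real.pi)) volume volume := by
  refine ⟨by fun_prop, ?_⟩
  rw [map_div_two_pi]
  exact Measure.smul_absolutelyContinuous

theorem memLp_comp_div_two_pi (g : Lp ℂ 2 (volume : Measure ℝ)) :
    MemLp (fun p : ℝ => g (p / (2 * Real.pi))) 2 halfLine := by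
  have h : MemLp g 2 (Measure.map (fun p : ℝ => p / (2 * Real.pi)) volume) := by
    rw [map_div_two_pi]
    exact (Lp.memLp g).smul_measure ENNReal.ofReal_ne_top
  exact (h.comp_of_map (by fun_prop)).restrict _

/-- The restriction to the half-line of the unitary Fourier transform
`(2π)^(-1/2) ∫ exp(-i x p) g(x) dx` of `g ∈ L²(ℝ)`, as a linear map. Mathlib's transform `𝓕 g`
has the phase `exp(-2π i x p)`, hence the rescaling. -/
noncomputable def fourierHalfLine : Lp ℂ 2 (volume : Measure ℝ) →ₗ[ℂ] L2Half where
  toFun g := (((Real.sqrt (2 * Real.pi))⁻¹ : ℝ) : ℂ) • (memLp_comp_div_two_pi (𝓕 g)).toLp _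
  map_add' f g := by
    rw [← smul_add, ← MemLp.toLp_add]
    congr 1
    refine MemLp.toLp_congr _ _ (ae_restrict_of_ae ?_)
    have e : 𝓕 (f + g) = (𝓕 f + 𝓕 g : Lp ℂ 2 (volume : Measure ℝ)) :=
      FourierTransform.fourier_add f g
    rw [e]
    have h := Lp.coeFn_add (𝓕 f : Lp ℂ 2 (volume : Measure ℝ)) (𝓕 g)
    exact quasiMeasurePreserving_div_two_pi.ae h
  map_smul' c f := by
    have e : 𝓕 (c • f) = (c • 𝓕 f : Lp ℂ 2 (volume : Measure ℝ)) :=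
      FourierTransform.fourier_smul c f
    have h := Lp.coeFn_smul c (𝓕 f : Lp ℂ 2 (volume : Measure ℝ))
    have key : (memLp_comp_div_two_pi (𝓕 (c • f))).toLp _ =
        c • (memLp_comp_div_two_pi (𝓕 f)).toLp _ := by
      rw [← MemLp.toLp_const_smul, e]
      exact MemLp.toLp_congr _ _ (ae_restrict_of_ae (quasiMeasurePreserving_div_two_pi.ae h))
    rw [RingHom.id_apply, key, smul_comm]

/-- The sine transformation `(F_D f)(p) = √(2/π) ∫₀^∞ sin(p x) f(x) dx` on `L²(ℝ₊)`:
`i` times the restricted Fourier transform of the odd extension. -/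
noncomputable def sineTransform : L2Half →ₗ[ℂ] L2Half :=
  Complex.I • (fourierHalfLine ∘ₗ parityExtendL2 (-1))

/-- The cosine transformation `(F_N f)(p) = √(2/π) ∫₀^∞ cos(p x) f(x) dx` on `L²(ℝ₊)`:
the restricted Fourier transform of the even extension. -/
noncomputable def cosineTransform : L2Half →ₗ[ℂ] L2Half :=
  fourierHalfLine ∘ₗ parityExtendL2 1

/-- `U` is a unitary involution. -/
def IsUnitaryInvolution (U : L2Half →ₗ[ℂ] L2Half) : Prop :=
  (∀ f, ‖U f‖ = ‖f‖) ∧ ∀ f, U (U f) = f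

/-- The operator product `U A U`, with domain `{f | U f ∈ D(A)}`. -/
noncomputable def conjugateBy (U : L2Half →ₗ[ℂ] L2Half) (A : L2Half →ₗ.[ℂ] L2Half) : L2Half →ₗ.[ℂ] L2Half where
  domain := A.domain.comap U
  toFun := U ∘ₗ A.toFun ∘ₗ U.restrict (fun _ hf => hf)

/-! ### The maximal Bessel operator in the position representation -/

/-- `φ ∈ C_c^∞(]0,∞[)`. -/
def IsTestFunction (φ : ℝ → ℂ) : Prop :=
  ContDiff ℝ ∞ φ ∧ HasCompactSupport φ ∧ tsupport φ ⊆ Ioi 0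

/-- The Bessel expression `L_α φ = -φ'' + (α - 1/4) x⁻² φ` on test functions. -/
noncomputable def besselExpr (α : ℝ) (φ : ℝ → ℂ) (x : ℝ) : ℂ :=
  -deriv (deriv φ) x + (((α - 1 / 4) / x ^ 2 : ℝ) : ℂ) * φ x

theorem coeFn_zero_half : ∀ᵐ x ∂halfLine, (0 : L2Half) x = 0 := by
  filter_upwards [Lp.coeFn_zero ℂ 2 halfLine] with x hx
  rw [hx, Pi.zero_apply]

theorem integrable_mul_test (f : L2Half) {φ : ℝ → ℂ} (h : Continuous φ)
    (hc : HasCompactSupport φ) : Integrable (fun x => f x * φ x) halfLine :=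
  (Lp.memLp f).integrable_mul (q := 2) ((h.memLp_of_hasCompactSupport hc).restrict _)

theorem integrable_mul_besselExpr (α : ℝ) (f : L2Half) {φ : ℝ → ℂ} (hφ : IsTestFunction φ) :
    Integrable (fun x => f x * besselExpr α φ x) halfLine := by
  obtain ⟨h1, h2, h3⟩ := hφ
  have hd : ContDiff ℝ ∞ (deriv φ) := by
    have := h1.iterate_deriv 1
    simpa using this
  have hdd : Continuous (deriv (deriv φ)) := hd.continuous_deriv (by simp)
  have hp : Continuous (fun x : ℝ => (((α - 1 / 4) / x ^ 2 : ℝ) : ℂ) * φ x) := by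
    refine ContinuousOn.continuous_of_tsupport_subset (s := Ioi 0) ?_ isOpen_Ioi
      ((tsupport_mul_subset_right).trans h3)
    refine ContinuousOn.mul ?_ h1.continuous.continuousOn
    refine Complex.continuous_ofReal.comp_continuousOn ?_
    refine ContinuousOn.div (by fun_prop) (by fun_prop) ?_
    intro x hx
    exact pow_ne_zero 2 (ne_of_gt hx)
  exact integrable_mul_test f (hdd.neg.add hp) ((h2.deriv.deriv.neg).add h2.mul_left)

/-- The graph of `L_α^max`: the pairs `(f, g)` in `L²(ℝ₊)` with `L_α f = g` in the sense of
distributions on `]0,∞[`. -/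
def besselMaxGraph (α : ℝ) : Submodule ℂ (L2Half × L2Half) where
  carrier := {u | ∀ φ : ℝ → ℂ, IsTestFunction φ →
    ∫ x, u.1 x * besselExpr α φ x ∂halfLine = ∫ x, u.2 x * φ x ∂halfLine}
  zero_mem' := by
    intro φ _
    rw [integral_eq_zero_of_ae, integral_eq_zero_of_ae]
    all_goals
      filter_upwards [coeFn_zero_half] with x hx
      simp only [Prod.fst_zero, Prod.snd_zero, hx, zero_mul, Pi.zero_apply]
  add_mem' := by
    intro u v hu hv φ hφ
    have e1 : ∫ x, (u + v).1 x * besselExpr α φ x ∂halfLine =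
        ∫ x, (u.1 x * besselExpr α φ x + v.1 x * besselExpr α φ x) ∂halfLine := by
      refine integral_congr_ae ?_
      filter_upwards [Lp.coeFn_add u.1 v.1] with x hx
      rw [Prod.fst_add, hx, Pi.add_apply, add_mul]
    have e2 : ∫ x, (u + v).2 x * φ x ∂halfLine =
        ∫ x, (u.2 x * φ x + v.2 x * φ x) ∂halfLine := by
      refine integral_congr_ae ?_
      filter_upwards [Lp.coeFn_add u.2 v.2] with x hx
      rw [Prod.snd_add, hx, Pi.add_apply, add_mul]
    rw [e1, e2, integral_add (integrable_mul_besselExpr α _ hφ) (integrable_mul_besselExpr α _ hφ),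
      integral_add (integrable_mul_test _ hφ.1.continuous hφ.2.1)
        (integrable_mul_test _ hφ.1.continuous hφ.2.1), hu φ hφ, hv φ hφ]
  smul_mem' := by
    intro c u hu φ hφ
    have e1 : ∫ x, (c • u).1 x * besselExpr α φ x ∂halfLine =
        ∫ x, c * (u.1 x * besselExpr α φ x) ∂halfLine := by
      refine integral_congr_ae ?_
      filter_upwards [Lp.coeFn_smul c u.1] with x hx
      rw [Prod.smul_fst, hx, Pi.smul_apply, smul_eq_mul, mul_assoc]
    have e2 : ∫ x, (c • u).2 x * φ x ∂halfLine = ∫ x, c * (u.2 x * φ x) ∂halfLine := by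
      refine integral_congr_ae ?_
      filter_upwards [Lp.coeFn_smul c u.2] with x hx
      rw [Prod.smul_snd, hx, Pi.smul_apply, smul_eq_mul, mul_assoc]
    rw [e1, e2, integral_const_mul, integral_const_mul, hu φ hφ]

/-- The maximal Bessel operator `L_α^max`, with domain `{f ∈ L²(ℝ₊) | L_α f ∈ L²(ℝ₊)}`. -/
noncomputable def besselMax (α : ℝ) : L2Half →ₗ.[ℂ] L2Half := (besselMaxGraph α).toLinearPMap

theorem besselMax_graph (α : ℝ) : (besselMax α).graph = besselMaxGraph α := by
  refine Submodule.toLinearPMap_graph_eq _ ?_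
  rintro ⟨f, g⟩ hu hf
  simp only at hf
  subst hf
  have hloc : LocallyIntegrableOn (g : ℝ → ℂ) (Ioi 0) halfLine :=
    ((Lp.memLp g).locallyIntegrable (by norm_num)).locallyIntegrableOn _
  have key := isOpen_Ioi.ae_eq_zero_of_integral_contDiff_smul_eq_zero hloc (fun φ h1 h2 h3 => ?_)
  · rw [Lp.eq_zero_iff_ae_eq_zero]
    filter_upwards [key, ae_restrict_mem measurableSet_Ioi] with x hx hx'
    exact hx hx'
  · have ht : IsTestFunction (fun x => (φ x : ℂ)) := by
      refine ⟨Complex.ofRealCLM.contDiff.comp h1, h2.comp_left Complex.ofReal_zero, ?_⟩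
      exact (tsupport_comp_subset Complex.ofReal_zero φ).trans h3
    have h := hu _ ht
    have h0 : ∫ x, (0 : L2Half) x * besselExpr α (fun x => (φ x : ℂ)) x ∂halfLine = 0 := by
      refine integral_eq_zero_of_ae ?_
      filter_upwards [coeFn_zero_half] with x hx
      simp only [hx, zero_mul, Pi.zero_apply]
    simp only at h
    rw [h0] at h
    rw [h]
    refine integral_congr_ae (Eventually.of_forall fun x => ?_)
    simp [mul_comm]

/-! ### The minimal operators in the momentum representation -/

/-- Rapidly decaying elements of `L²(ℝ₊)`: `∫₀^∞ |ψ(p)|² pⁿ dp < ∞` for all `n`. -/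
def IsRapidlyDecaying (ψ : L2Half) : Prop :=
  ∀ n : ℕ, Integrable (fun p => ‖ψ p‖ ^ 2 * p ^ n) halfLine

theorem IsRapidlyDecaying.integrable {ψ : L2Half} (h : IsRapidlyDecaying ψ) (j : ℕ) :
    Integrable (fun p => ψ p * (p : ℂ) ^ j) halfLine := by
  have hb : Integrable (fun p : ℝ => (1 + p ^ 2)⁻¹ +
      (‖ψ p‖ ^ 2 * p ^ (2 * j) + ‖ψ p‖ ^ 2 * p ^ (2 * j + 2))) halfLine :=
    (integrable_inv_one_add_sq.restrict).add ((h _).add (h _))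
  refine hb.mono' ?_ (Eventually.of_forall fun p => ?_)
  · exact (Lp.aestronglyMeasurable ψ).mul (by fun_prop)
  · have hp : (0 : ℝ) < 1 + p ^ 2 := by positivity
    rw [norm_mul, norm_pow, Complex.norm_real, Real.norm_eq_abs]
    set a := ‖ψ p‖ * |p| ^ j with ha
    have e : ‖ψ p‖ ^ 2 * p ^ (2 * j) + ‖ψ p‖ ^ 2 * p ^ (2 * j + 2) = (1 + p ^ 2) * a ^ 2 := by
      have : p ^ (2 * j) = (|p| ^ j) ^ 2 := by
        rw [← pow_mul, mul_comm j 2, pow_mul, pow_mul, sq_abs]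
      rw [ha, pow_add, this]
      ring
    rw [e]
    have h3 : (1 + p ^ 2)⁻¹ + (1 + p ^ 2) * a ^ 2 - 2 * a =
        (1 + p ^ 2)⁻¹ * ((1 + p ^ 2) * a - 1) ^ 2 := by
      field_simp
      ring
    have h4 : 0 ≤ (1 + p ^ 2)⁻¹ * ((1 + p ^ 2) * a - 1) ^ 2 := by positivity
    have h5 : 0 ≤ a := by positivity
    linarith

/-- The space `L_j^{2,∞}(ℝ₊)` of rapidly decaying `ψ` with `∫₀^∞ ψ(p) p^j dp = 0`. -/
def momentSpace (j : ℕ) : Submodule ℂ L2Half where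
  carrier := {ψ | IsRapidlyDecaying ψ ∧ ∫ p, ψ p * (p : ℂ) ^ j ∂halfLine = 0}
  zero_mem' := by
    refine ⟨fun n => ?_, ?_⟩
    · refine (integrable_zero ℝ ℝ halfLine).congr ?_
      filter_upwards [coeFn_zero_half] with x hx
      rw [hx, norm_zero, zero_pow two_ne_zero, zero_mul]
      rfl
    · refine integral_eq_zero_of_ae ?_
      filter_upwards [coeFn_zero_half] with x hx
      simp only [hx, zero_mul, Pi.zero_apply]
  add_mem' := by
    rintro ψ χ ⟨h1, h2⟩ ⟨h3, h4⟩
    refine ⟨fun n => ?_, ?_⟩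
    · refine (((h1 n).add (h3 n)).const_mul 2).mono' ?_ ?_
      · exact ((Lp.aestronglyMeasurable (ψ + χ)).norm.pow 2).mul (by fun_prop)
      · filter_upwards [Lp.coeFn_add ψ χ, ae_restrict_mem measurableSet_Ioi] with p hp hp0
        have hp1 : (0 : ℝ) ≤ p ^ n := pow_nonneg (le_of_lt hp0) n
        rw [hp, Pi.add_apply, Real.norm_eq_abs, abs_of_nonneg (by positivity), Pi.add_apply,
          ← add_mul, ← mul_assoc]
        refine mul_le_mul_of_nonneg_right ?_ hp1
        have := norm_add_le (ψ p) (χ p)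
        nlinarith [sq_nonneg (‖ψ p‖ - ‖χ p‖), norm_nonneg (ψ p + χ p), norm_nonneg (ψ p),
          norm_nonneg (χ p)]
    · have e : ∫ p, (ψ + χ) p * (p : ℂ) ^ j ∂halfLine =
          ∫ p, (ψ p * (p : ℂ) ^ j + χ p * (p : ℂ) ^ j) ∂halfLine := by
        refine integral_congr_ae ?_
        filter_upwards [Lp.coeFn_add ψ χ] with p hp
        rw [hp, Pi.add_apply, add_mul]
      rw [e, integral_add (h1.integrable j) (h3.integrable j), h2, h4, add_zero]
  smul_mem' := by
    rintro c ψ ⟨h1, h2⟩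
    refine ⟨fun n => ?_, ?_⟩
    · refine ((h1 n).const_mul (‖c‖ ^ 2)).congr ?_
      filter_upwards [Lp.coeFn_smul c ψ] with p hp
      rw [hp, Pi.smul_apply, norm_smul]
      ring
    · have e : ∫ p, (c • ψ) p * (p : ℂ) ^ j ∂halfLine =
          ∫ p, c * (ψ p * (p : ℂ) ^ j) ∂halfLine := by
        refine integral_congr_ae ?_
        filter_upwards [Lp.coeFn_smul c ψ] with p hp
        rw [hp, Pi.smul_apply, smul_eq_mul, mul_assoc]
      rw [e, integral_const_mul, h2, mul_zero]

/-- The Dirichlet kernel `θ(p-q) q + θ(q-p) p`. -/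
def kernelD (p q : ℝ) : ℝ := min p q

/-- The Neumann kernel `-(θ(p-q) p + θ(q-p) q)`, sign included. -/
def kernelN (p q : ℝ) : ℝ := -max p q

theorem IsRapidlyDecaying.integrable_kernel {ψ : L2Half} (h : IsRapidlyDecaying ψ)
    {k : ℝ → ℝ → ℝ} (hk : k = kernelD ∨ k = kernelN) (p : ℝ) :
    Integrable (fun q => (k p q : ℂ) * ψ q) halfLine := by
  have hb : Integrable (fun q : ℝ => |p| * ‖ψ q * (q : ℂ) ^ 0‖ + ‖ψ q * (q : ℂ) ^ 1‖) halfLine :=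
    ((h.integrable 0).norm.const_mul _).add (h.integrable 1).norm
  refine hb.mono' ?_ (Eventually.of_forall fun q => ?_)
  · refine AEStronglyMeasurable.mul ?_ (Lp.aestronglyMeasurable ψ)
    refine (Complex.measurable_ofReal.comp ?_).aestronglyMeasurable
    rcases hk with rfl | rfl
    · exact (measurable_const.min measurable_id)
    · exact (measurable_const.max measurable_id).neg
  · have hkq : |k p q| ≤ |p| + |q| := by
      rcases hk with rfl | rfl
      · exact (abs_min_le_max_abs_abs).trans (max_le_add_of_nonneg (abs_nonneg _) (abs_nonneg _))
      · rw [kernelN, abs_neg]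
        exact (abs_max_le_max_abs_abs).trans (max_le_add_of_nonneg (abs_nonneg _) (abs_nonneg _))
    rw [norm_mul, norm_mul, norm_mul, norm_pow, norm_pow, Complex.norm_real, Complex.norm_real,
      Real.norm_eq_abs, Real.norm_eq_abs]
    nlinarith [norm_nonneg (ψ q)]

/-- The graph of the operator `ψ ↦ p² ψ(p) + (α - 1/4) ∫₀^∞ k(p,q) ψ(q) dq` on `L_j^{2,∞}(ℝ₊)`. -/
def coreGraph (α : ℝ) (j : ℕ) (k : ℝ → ℝ → ℝ) (hk : k = kernelD ∨ k = kernelN) :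
    Submodule ℂ (L2Half × L2Half) where
  carrier := {u | u.1 ∈ momentSpace j ∧ ∀ᵐ p ∂halfLine, u.2 p =
    (p : ℂ) ^ 2 * u.1 p + ((α : ℂ) - 1 / 4) * ∫ q, (k p q : ℂ) * u.1 q ∂halfLine}
  zero_mem' := by
    refine ⟨Submodule.zero_mem _, ?_⟩
    have e : ∀ p : ℝ, ∫ q, (k p q : ℂ) * (0 : L2Half) q ∂halfLine = 0 := by
      intro p
      refine integral_eq_zero_of_ae ?_
      filter_upwards [coeFn_zero_half] with x hx
      simp only [hx, mul_zero, Pi.zero_apply]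
    filter_upwards [coeFn_zero_half] with p hp
    rw [Prod.fst_zero, Prod.snd_zero, e, hp]
    ring
  add_mem' := by
    rintro u v ⟨hu1, hu2⟩ ⟨hv1, hv2⟩
    refine ⟨Submodule.add_mem _ hu1 hv1, ?_⟩
    have e : ∀ p : ℝ, ∫ q, (k p q : ℂ) * (u.1 + v.1) q ∂halfLine =
        ∫ q, (k p q : ℂ) * u.1 q ∂halfLine + ∫ q, (k p q : ℂ) * v.1 q ∂halfLine := by
      intro p
      rw [← integral_add (hu1.1.integrable_kernel hk p) (hv1.1.integrable_kernel hk p)]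
      refine integral_congr_ae ?_
      filter_upwards [Lp.coeFn_add u.1 v.1] with x hx
      rw [hx, Pi.add_apply, mul_add]
    filter_upwards [hu2, hv2, Lp.coeFn_add u.1 v.1, Lp.coeFn_add u.2 v.2] with p h1 h2 h3 h4
    rw [Prod.fst_add, Prod.snd_add, e, h3, h4, Pi.add_apply, Pi.add_apply, h1, h2]
    ring
  smul_mem' := by
    rintro c u ⟨hu1, hu2⟩
    refine ⟨Submodule.smul_mem _ c hu1, ?_⟩
    have e : ∀ p : ℝ, ∫ q, (k p q : ℂ) * (c • u.1) q ∂halfLine =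
        c * ∫ q, (k p q : ℂ) * u.1 q ∂halfLine := by
      intro p
      rw [← integral_const_mul]
      refine integral_congr_ae ?_
      filter_upwards [Lp.coeFn_smul c u.1] with x hx
      rw [hx, Pi.smul_apply, smul_eq_mul]
      ring
    filter_upwards [hu2, Lp.coeFn_smul c u.1, Lp.coeFn_smul c u.2] with p h1 h3 h4
    rw [Prod.smul_fst, Prod.smul_snd, e, h3, h4, Pi.smul_apply, Pi.smul_apply, h1, smul_eq_mul,
      smul_eq_mul]
    ring

/-- The minimal momentum operator in the Dirichlet case: the closure of
`ψ ↦ p² ψ(p) + (α - 1/4) ∫₀^∞ (θ(p-q) q + θ(q-p) p) ψ(q) dq` on `L_1^{2,∞}(ℝ₊)`. -/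
noncomputable def momentumMinD (α : ℝ) : L2Half →ₗ.[ℂ] L2Half :=
  (coreGraph α 1 kernelD (Or.inl rfl)).toLinearPMap.closure

/-- The minimal momentum operator in the Neumann case: the closure of
`ψ ↦ p² ψ(p) - (α - 1/4) ∫₀^∞ (θ(p-q) p + θ(q-p) q) ψ(q) dq` on `L_0^{2,∞}(ℝ₊)`. -/
noncomputable def momentumMinN (α : ℝ) : L2Half →ₗ.[ℂ] L2Half :=
  (coreGraph α 0 kernelN (Or.inr rfl)).toLinearPMap.closure

/-! ### The maximal operators in the momentum representation -/

/-- The conditions on `ψ_{m,D}`: for some `Λ₀ > 0`, `ψ(p) = p^(-3/2-m)` for `p > Λ₀` and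
`∫₀^Λ₀ ψ(q) q dq = Λ₀^(1/2-m) / (1/2-m)`. -/
def IsPowerTailD (m : ℂ) (ψ : L2Half) : Prop :=
  ∃ Λ₀ : ℝ, 0 < Λ₀ ∧ (∀ᵐ p ∂halfLine, Λ₀ < p → ψ p = (p : ℂ) ^ (-3 / 2 - m)) ∧
    ∫ q in (0 : ℝ)..Λ₀, ψ q * q = (Λ₀ : ℂ) ^ (1 / 2 - m) / (1 / 2 - m)

/-- The conditions on `ψ_{log,D}`. -/
def IsLogTailD (ψ : L2Half) : Prop :=
  ∃ Λ₀ : ℝ, 0 < Λ₀ ∧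
    (∀ᵐ p ∂halfLine, Λ₀ < p → ψ p = ((p ^ (-3 / 2 : ℝ) * Real.log p : ℝ) : ℂ)) ∧
    ∫ q in (0 : ℝ)..Λ₀, ψ q * q =
      ((-4 * Λ₀ ^ (1 / 2 : ℝ) + 2 * Λ₀ ^ (1 / 2 : ℝ) * Real.log Λ₀ : ℝ) : ℂ)

/-- The conditions on `ψ_{m,N}`: for some `Λ₀ > 0`, `ψ(p) = p^(-3/2-m)` for `p > Λ₀` and
`∫₀^Λ₀ ψ(q) dq = Λ₀^(-1/2-m) / (-1/2-m)`. -/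
def IsPowerTailN (m : ℂ) (ψ : L2Half) : Prop :=
  ∃ Λ₀ : ℝ, 0 < Λ₀ ∧ (∀ᵐ p ∂halfLine, Λ₀ < p → ψ p = (p : ℂ) ^ (-3 / 2 - m)) ∧
    ∫ q in (0 : ℝ)..Λ₀, ψ q = (Λ₀ : ℂ) ^ (-1 / 2 - m) / (-1 / 2 - m)

/-- The conditions on `ψ_{log,N}`. -/
def IsLogTailN (ψ : L2Half) : Prop :=
  ∃ Λ₀ : ℝ, 0 < Λ₀ ∧
    (∀ᵐ p ∂halfLine, Λ₀ < p → ψ p = ((p ^ (-3 / 2 : ℝ) * Real.log p : ℝ) : ℂ)) ∧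
    ∫ q in (0 : ℝ)..Λ₀, ψ q =
      ((-4 * Λ₀ ^ (-1 / 2 : ℝ) - 2 * Λ₀ ^ (-1 / 2 : ℝ) * Real.log Λ₀ : ℝ) : ℂ)

/-- `(ψ₁, ψ₂)` is an admissible choice of `(ψ_{m,D}, ψ_{-m,D})`, or of `(ψ_{log,D}, ψ_{0,D})` if
`m = 0`. -/
def IsTailPairD (m : ℂ) (ψ₁ ψ₂ : L2Half) : Prop :=
  (m ≠ 0 ∧ IsPowerTailD m ψ₁ ∧ IsPowerTailD (-m) ψ₂) ∨
    (m = 0 ∧ IsLogTailD ψ₁ ∧ IsPowerTailD 0 ψ₂)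

/-- `(ψ₁, ψ₂)` is an admissible choice of `(ψ_{m,N}, ψ_{-m,N})`, or of `(ψ_{log,N}, ψ_{0,N})` if
`m = 0`. -/
def IsTailPairN (m : ℂ) (ψ₁ ψ₂ : L2Half) : Prop :=
  (m ≠ 0 ∧ IsPowerTailN m ψ₁ ∧ IsPowerTailN (-m) ψ₂) ∨
    (m = 0 ∧ IsLogTailN ψ₁ ∧ IsPowerTailN 0 ψ₂)

open Classical in
/-- The counterterm of the Dirichlet case with cutoff `Λ`, at the point `p`. -/
noncomputable def countertermD (m c₁ c₂ : ℂ) (Λ p : ℝ) : ℂ :=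
  if m = 0 then
    c₁ * p * ((4 * Λ ^ (-1 / 2 : ℝ) + 2 * Λ ^ (-1 / 2 : ℝ) * Real.log Λ : ℝ) : ℂ) +
      2 * c₂ * p * ((Λ ^ (-1 / 2 : ℝ) : ℝ) : ℂ)
  else
    c₁ * p * (Λ : ℂ) ^ (-1 / 2 - m) / (1 / 2 + m) + c₂ * p * (Λ : ℂ) ^ (-1 / 2 + m) / (1 / 2 - m)

open Classical in
/-- The counterterm of the Neumann case with cutoff `Λ`, as an addition to
`∫₀^Λ (θ(p-q) p + θ(q-p) q) ψ(q) dq`. -/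
noncomputable def countertermN (m c₁ c₂ : ℂ) (Λ : ℝ) : ℂ :=
  if m = 0 then
    c₁ * ((4 * Λ ^ (1 / 2 : ℝ) - 2 * Λ ^ (1 / 2 : ℝ) * Real.log Λ : ℝ) : ℂ) -
      2 * c₂ * ((Λ ^ (1 / 2 : ℝ) : ℝ) : ℂ)
  else
    -(c₁ * (Λ : ℂ) ^ (1 / 2 - m) / (1 / 2 - m)) - c₂ * (Λ : ℂ) ^ (1 / 2 + m) / (1 / 2 + m)

/-- `T` is an operator with the defining properties of the maximal momentum operator built from
the minimal operator `A`, the vectors `ψ₁, ψ₂`, the kernel `k` and the counterterm `ct`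
(an addition to the integral with kernel `k`):
its domain is `D(A) + ℂ ψ₁ + ℂ ψ₂`; every `ψ` in it has unique asymptotic coefficients `c₁, c₂`,
those with `ψ - c₁ ψ₁ - c₂ ψ₂ ∈ D(A)`; and with these, the limit
`ℓ(p) = lim_{Λ → ∞} (∫₀^Λ k(p,q) ψ(q) dq + ct c₁ c₂ Λ p)` exists for all `p > 0`, and
`(T ψ)(p) = p² ψ(p) + (α - 1/4) ℓ(p)`. -/
structure IsMomentumMax (α : ℝ) (A : L2Half →ₗ.[ℂ] L2Half) (k : ℝ → ℝ → ℝ)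
    (ct : ℂ → ℂ → ℝ → ℝ → ℂ) (ψ₁ ψ₂ : L2Half) (T : L2Half →ₗ.[ℂ] L2Half) : Prop where
  domain_eq : T.domain = A.domain ⊔ Submodule.span ℂ {ψ₁, ψ₂}
  coeff_unique : ∀ ψ ∈ T.domain, ∃! c : ℂ × ℂ, ψ - c.1 • ψ₁ - c.2 • ψ₂ ∈ A.domain
  action : ∀ (ψ : T.domain) (c₁ c₂ : ℂ), (ψ : L2Half) - c₁ • ψ₁ - c₂ • ψ₂ ∈ A.domain →
    ∃ ℓ : ℝ → ℂ,
      (∀ p : ℝ, 0 < p → Tendsto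
        (fun Λ : ℝ => (∫ q in (0 : ℝ)..Λ, (k p q : ℂ) * (ψ : L2Half) q) + ct c₁ c₂ Λ p)
        atTop (𝓝 (ℓ p))) ∧
      ∀ᵐ p ∂halfLine, T ψ p = (p : ℂ) ^ 2 * (ψ : L2Half) p + ((α : ℂ) - 1 / 4) * ℓ p

/-- `T` is the maximal momentum operator in the Dirichlet case, built from `ψ₁, ψ₂`. -/
def IsMomentumMaxD (α : ℝ) (m : ℂ) (ψ₁ ψ₂ : L2Half) (T : L2Half →ₗ.[ℂ] L2Half) : Prop :=
  IsMomentumMax α (momentumMinD α) kernelD (countertermD m) ψ₁ ψ₂ T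

/-- `T` is the maximal momentum operator in the Neumann case, built from `ψ₁, ψ₂`. The kernel
`kernelN` contains the minus sign of the formula, so the counterterm is negated too. -/
def IsMomentumMaxN (α : ℝ) (m : ℂ) (ψ₁ ψ₂ : L2Half) (T : L2Half →ₗ.[ℂ] L2Half) : Prop :=
  IsMomentumMax α (momentumMinN α) kernelN (fun c₁ c₂ Λ _ => -countertermN m c₁ c₂ Λ) ψ₁ ψ₂ T

/-! ### Generalities on `L²` -/

/-! The sine and cosine cases are one proof. Both kernels have the form `k(p,q) = β(q) p^j -
(p-q)₊`, with `j = 1` for sine and `j = 0` for cosine, and the differences are confined to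
`IsParityKernel`, `IsTrigKernel` and `IsTrigTransform`. Under the transformation, `-d²/dx²` becomes
multiplication by `p²` and division by `x²` becomes the integral operator with kernel `k`, that is,
minus a second antiderivative.

The maximal Bessel operator is the transpose, for the bilinear pairing `∫ f g`, of the operator on
the core: transforms of core elements are smooth and vanish at the origin to an order that lets them
serve as test functions, and transforms of test functions lie in the core. Transposing the kernel on
functions of vanishing `j`-th moment leaves `-∫₀^p (p-q) φ(q) dq`, and these functions are
annihilated only by multiples of `p^j`. Hence `mem_besselMaxGraph_iff`: the graph in momentum space
consists of the pairs with `γ = p² φ - (α-1/4) ∫₀^p (p-q) φ(q) dq + c p^j`.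

The rest is an ordinary differential equation. A suitable second primitive `Φ` of `φ` solves the
Euler equation `q² Φ'' + (1/4-m²) Φ = γ` with `γ ∈ L²`. Factoring the operator and using a Hardy
inequality gives `Φ = c₁ q^(1/2-m) + c₂ q^(1/2+m) + ρ` with `‖ρ‖ ≤ C ‖γ‖` (`exists_euler_bound`; a
logarithm appears if `m = 0`). The condition `α < 1` gives `|Re m| < 1`, which makes Hardy available
for both exponents and keeps every nonzero homogeneous solution out of `L²` at infinity.

On the core this is an a priori bound: the minimal domain consists of the `ψ` with `p² ψ ∈ L²` and
vanishing moment (`mem_domain_closure_coreGraph`). On the maximal graph, `p² φ = γ + (α-1/4) Φ`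
shows that `φ` behaves at infinity like a combination of the two tails. The prescribed integrals of
`ψ_±` are what puts them in the maximal domain (`IsTail.exists_mem_graph`). After subtracting them,
`p²` times the rest is in `L²`, and membership in the domain forces its moment to vanish
(`exists_coeff`). The counterterms are minus the divergent parts of `∫₀^Λ β ψ_±`, so the regularized
integral of a tail is constant for large `Λ`. -/

theorem sq_norm_eq_integral {X : Type*} [MeasurableSpace X] {μ : Measure X} (f : Lp ℂ 2 μ) :
    ‖f‖ ^ 2 = ∫ x, ‖f x‖ ^ 2 ∂μ := by
  have h : (inner ℂ f f : ℂ) = ((∫ x, ‖f x‖ ^ 2 ∂μ : ℝ) : ℂ) := by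
    rw [L2.inner_def, ← integral_complex_ofReal]
    refine integral_congr_ae (Eventually.of_forall fun x => ?_)
    simp [inner_self_eq_norm_sq_to_K]
  rw [inner_self_eq_norm_sq_to_K] at h
  exact Complex.ofReal_injective (by simpa using h)

/-- Simple functions in `L²` have support of finite measure. On this dense class the transformations
are honest integrals. -/
theorem dense_integrable {X : Type*} [MeasurableSpace X] {μ : Measure X} :
    Dense {f : Lp ℂ 2 μ | Integrable f μ} := by
  have h := (Lp.simpleFunc.denseRange (E := ℂ) (μ := μ) (p := 2) (by norm_num))
  refine h.mono ?_
  rintro _ ⟨f, rfl⟩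
  have h1 : Integrable (Lp.simpleFunc.toSimpleFunc f) μ :=
    (SimpleFunc.memLp_iff_integrable (p := 2) (by norm_num) (by norm_num)).1
      (Lp.simpleFunc.memLp f)
  exact h1.congr (Lp.simpleFunc.toSimpleFunc_eq_toFun f)

theorem integrable_mul_L2 {X : Type*} [MeasurableSpace X] {μ : Measure X} (f g : Lp ℂ 2 μ) :
    Integrable (fun x => f x * g x) μ :=
  (Lp.memLp f).integrable_mul (q := 2) (Lp.memLp g)

/-- Complex conjugation on `L²`. -/
noncomputable def conjL2 {X : Type*} [MeasurableSpace X] {μ : Measure X} (f : Lp ℂ 2 μ) :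
    Lp ℂ 2 μ :=
  (Lp.memLp f).star.toLp _

theorem coeFn_conjL2 {X : Type*} [MeasurableSpace X] {μ : Measure X} (f : Lp ℂ 2 μ) :
    ∀ᵐ x ∂μ, conjL2 f x = (starRingEnd ℂ) (f x) := by
  filter_upwards [(Lp.memLp f).star.coeFn_toLp] with x hx
  rw [conjL2, hx]
  rfl

/-- The duality below uses the bilinear pairing; this identity gives its continuity from that of the
inner product. -/
theorem integral_mul_eq_inner {X : Type*} [MeasurableSpace X] {μ : Measure X} (f g : Lp ℂ 2 μ) :
    ∫ x, f x * g x ∂μ = inner ℂ (conjL2 f) g := by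
  rw [L2.inner_def]
  refine integral_congr_ae ?_
  filter_upwards [coeFn_conjL2 f] with x hx
  rw [hx]
  simp [mul_comm]

theorem inner_eq_integral_conj {X : Type*} [MeasurableSpace X] {μ : Measure X} (f g : Lp ℂ 2 μ) :
    inner ℂ f g = ∫ x, conjL2 f x * g x ∂μ := by
  rw [L2.inner_def]
  refine integral_congr_ae ?_
  filter_upwards [coeFn_conjL2 f] with x hx
  rw [hx]
  simp [mul_comm]

theorem continuous_integral_mul_right {X : Type*} [MeasurableSpace X] {μ : Measure X}
    (f : Lp ℂ 2 μ) : Continuous (fun g : Lp ℂ 2 μ => ∫ x, f x * g x ∂μ) := by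
  simp_rw [integral_mul_eq_inner]
  fun_prop

theorem continuous_integral_mul_left {X : Type*} [MeasurableSpace X] {μ : Measure X}
    (g : Lp ℂ 2 μ) : Continuous (fun f : Lp ℂ 2 μ => ∫ x, f x * g x ∂μ) := by
  simpa only [mul_comm] using continuous_integral_mul_right g

/-! ### The Fourier transform of integrable elements of `L²` -/

/-- The `L²` transform and the Fourier integral define the same tempered distribution, because the
transform can be moved onto the test function in either case. -/
theorem coeFn_fourier_of_integrable (f : Lp ℂ 2 (volume : Measure ℝ)) (hf : Integrable f) :
    (𝓕 f : Lp ℂ 2 (volume : Measure ℝ)) =ᵐ[volume] 𝓕 (f : ℝ → ℂ) := by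
  refine ae_eq_of_integral_contDiff_smul_eq
    ((Lp.memLp _).locallyIntegrable (by norm_num)) ?_ ?_
  · have : Continuous (𝓕 (f : ℝ → ℂ)) :=
      VectorFourier.fourierIntegral_continuous Real.continuous_fourierChar
        (innerSL ℝ).continuous₂ hf
    exact this.locallyIntegrable
  · intro g hg hgc
    have hg' : ContDiff ℝ ∞ (fun x => (g x : ℂ)) := Complex.ofRealCLM.contDiff.comp hg
    have hgc' : HasCompactSupport (fun x => (g x : ℂ)) := hgc.comp_left Complex.ofReal_zero
    set G : SchwartzMap ℝ ℂ := hgc'.toSchwartzMap hg' with hG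
    have hGg : ∀ x, G x = (g x : ℂ) := fun x => rfl
    have h := congrArg (fun T => T G) (Lp.fourier_toTemperedDistribution_eq f)
    simp only [Lp.toTemperedDistribution_apply, TemperedDistribution.fourier_apply] at h
    have h2 : ∫ x, (𝓕 (G : ℝ → ℂ)) x • f x = ∫ x, G x • (𝓕 (f : ℝ → ℂ)) x :=
      VectorFourier.integral_fourierIntegral_smul_eq_flip (L := innerₗ ℝ)
        Real.continuous_fourierChar (by exact (innerSL ℝ).continuous₂) G.integrable hf |>.trans
        (by simp [Real.fourier_eq, VectorFourier.fourierIntegral])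
    rw [SchwartzMap.fourier_coe, h2] at h
    have e : ∀ F : ℝ → ℂ, ∫ x, g x • F x = ∫ x, G x • F x := fun F =>
      integral_congr_ae (Eventually.of_forall fun x => by simp [hGg])
    rw [e, e, h]

/-! ### The sine and cosine transformations -/

theorem coeFn_fourierHalfLine (g : Lp ℂ 2 (volume : Measure ℝ)) :
    ∀ᵐ p ∂halfLine, fourierHalfLine g p = (((Real.sqrt (2 * Real.pi))⁻¹ : ℝ) : ℂ) *
      (𝓕 g : Lp ℂ 2 (volume : Measure ℝ)) (p / (2 * Real.pi)) := by
  have h : fourierHalfLine g =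
    (((Real.sqrt (2 * Real.pi))⁻¹ : ℝ) : ℂ) • (memLp_comp_div_two_pi (𝓕 g)).toLp _ := rfl
  rw [h]
  filter_upwards [Lp.coeFn_smul (((Real.sqrt (2 * Real.pi))⁻¹ : ℝ) : ℂ)
    ((memLp_comp_div_two_pi (𝓕 g)).toLp _), (memLp_comp_div_two_pi (𝓕 g)).coeFn_toLp] with p h1 h2
  rw [h1, Pi.smul_apply, h2, smul_eq_mul]

theorem coeFn_parityExtendL2 (s : ℂ) (f : L2Half) :
    parityExtendL2 s f =ᵐ[volume] parityExtend s f :=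
  (memLp_parityExtend s f).coeFn_toLp

theorem integrable_parityExtend (s : ℂ) {f : ℝ → ℂ} (hf : Integrable f halfLine) :
    Integrable (parityExtend s f) := by
  have h : Integrable ((Ioi (0 : ℝ)).indicator f) :=
    (integrable_indicator_iff measurableSet_Ioi).2 hf
  exact h.add (h.comp_neg.const_mul s)

theorem fourier_parityExtend (s : ℂ) {f : ℝ → ℂ} (hf : Integrable f halfLine) (y : ℝ) :
    𝓕 (parityExtend s f) y = ∫ x, (Complex.exp (-(2 * Real.pi * x * y * Complex.I)) +
      s * Complex.exp (2 * Real.pi * x * y * Complex.I)) * f x ∂halfLine := by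
  have h : Integrable ((Ioi (0 : ℝ)).indicator f) :=
    (integrable_indicator_iff measurableSet_Ioi).2 hf
  have hb : ∀ c : ℝ, ∀ g : ℝ → ℂ, Integrable g →
      Integrable (fun x : ℝ => Complex.exp (2 * Real.pi * x * y * c * Complex.I) * g x) := by
    intro c g hg
    refine hg.bdd_mul (c := 1) (Continuous.aestronglyMeasurable (by fun_prop)) ?_
    refine Eventually.of_forall fun x => ?_
    rw [show (2 * Real.pi * x * y * c * Complex.I : ℂ) = ((2 * Real.pi * x * y * c : ℝ) : ℂ) *
      Complex.I by push_cast; ring, Complex.norm_exp_ofReal_mul_I]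
  have e1 : 𝓕 (parityExtend s f) y =
      ∫ x : ℝ, (Complex.exp (2 * Real.pi * x * y * (-1 : ℝ) * Complex.I) * (Ioi (0 : ℝ)).indicator f x +
        s * (Complex.exp (2 * Real.pi * x * y * (-1 : ℝ) * Complex.I) *
          (Ioi (0 : ℝ)).indicator f (-x))) := by
    rw [Real.fourier_eq']
    refine integral_congr_ae (Eventually.of_forall fun x => ?_)
    simp only [parityExtend, smul_eq_mul]
    have : ((-2 * Real.pi * inner ℝ x y : ℝ) : ℂ) * Complex.I =
        2 * Real.pi * x * y * (-1 : ℝ) * Complex.I := by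
      simp [mul_comm]; ring_nf
    rw [this]
    ring
  rw [e1, integral_add (hb _ _ h) ((hb _ _ h.comp_neg).const_mul s), integral_const_mul]
  have e2 : ∫ x : ℝ, (Complex.exp (2 * Real.pi * x * y * (-1 : ℝ) * Complex.I) *
          (Ioi (0 : ℝ)).indicator f (-x)) =
      ∫ x : ℝ, Complex.exp (2 * Real.pi * x * y * (1 : ℝ) * Complex.I) *
        (Ioi (0 : ℝ)).indicator f x := by
    rw [← integral_neg_eq_self]
    refine integral_congr_ae (Eventually.of_forall fun x => ?_)
    simp
  have e3 : ∀ g : ℝ → ℂ, ∫ x, g x * (Ioi (0 : ℝ)).indicator f x = ∫ x, g x * f x ∂halfLine := by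
    intro g
    rw [← integral_indicator measurableSet_Ioi]
    refine integral_congr_ae (Eventually.of_forall fun x => ?_)
    by_cases hx : x ∈ Ioi (0 : ℝ) <;> simp [hx]
  rw [e2, e3, e3, ← integral_const_mul, ← integral_add]
  · refine integral_congr_ae (Eventually.of_forall fun x => ?_)
    simp only [Complex.ofReal_neg, Complex.ofReal_one]
    ring_nf
  · refine ((hb (-1) _ h).restrict (s := Ioi 0)).congr ?_
    filter_upwards [ae_restrict_mem measurableSet_Ioi] with x hx
    simp [hx]
  · refine Integrable.const_mul ?_ s
    refine ((hb 1 _ h).restrict (s := Ioi 0)).congr ?_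
    filter_upwards [ae_restrict_mem measurableSet_Ioi] with x hx
    simp [hx]

/-- The transformation `f ↦ ζ (2π)^(-1/2) ∫ exp(-i x p) f(x) dx` on extensions of parity `s`. -/
noncomputable def parityTransform (ζ s : ℂ) : L2Half →ₗ[ℂ] L2Half :=
  ζ • (fourierHalfLine ∘ₗ parityExtendL2 s)

theorem coeFn_parityTransform (ζ s : ℂ) (f : L2Half) (hf : Integrable f halfLine) :
    ∀ᵐ p ∂halfLine, parityTransform ζ s f p = ζ * ((((Real.sqrt (2 * Real.pi))⁻¹ : ℝ) : ℂ) *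
      𝓕 (parityExtend s f) (p / (2 * Real.pi))) := by
  have h1 : Integrable (parityExtendL2 s f) :=
    (integrable_parityExtend s hf).congr (coeFn_parityExtendL2 s f).symm
  have h2 := ae_restrict_of_ae (s := Ioi 0)
    (quasiMeasurePreserving_div_two_pi.ae (coeFn_fourier_of_integrable _ h1))
  filter_upwards [Lp.coeFn_smul ζ (fourierHalfLine (parityExtendL2 s f)),
    coeFn_fourierHalfLine (parityExtendL2 s f), h2] with p h3 h4 h5
  rw [parityTransform, LinearMap.smul_apply, LinearMap.comp_apply, h3, Pi.smul_apply, h4, h5,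
    smul_eq_mul, Real.fourier_congr_ae (coeFn_parityExtendL2 s f)]

theorem sq_norm_parityExtendL2 {s : ℂ} (hs : s = 1 ∨ s = -1) (f : L2Half) :
    ‖parityExtendL2 s f‖ ^ 2 = 2 * ‖f‖ ^ 2 := by
  have hext : ∀ x, x ≠ 0 → ‖parityExtend s f x‖ ^ 2 = ‖f |x|‖ ^ 2 := by
    intro x hx
    rcases lt_or_gt_of_ne hx with h | h
    · have h1 : x ∉ Ioi (0 : ℝ) := by simp [h.le]
      have h2 : -x ∈ Ioi (0 : ℝ) := by simp [h]
      rw [parityExtend, indicator_of_notMem h1, indicator_of_mem h2, abs_of_neg h]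
      rcases hs with rfl | rfl <;> simp
    · have h1 : x ∈ Ioi (0 : ℝ) := by simp [h]
      have h2 : -x ∉ Ioi (0 : ℝ) := by simp [h.le]
      rw [parityExtend, indicator_of_notMem h2, indicator_of_mem h1, abs_of_pos h]
      simp
  rw [sq_norm_eq_integral, sq_norm_eq_integral, ← integral_comp_abs (f := fun y => ‖f y‖ ^ 2)]
  refine integral_congr_ae ?_
  filter_upwards [Measure.ae_ne volume (0 : ℝ), coeFn_parityExtendL2 s f] with x hx h
  rw [h, hext x hx]

theorem sq_norm_fourierHalfLine (g : Lp ℂ 2 (volume : Measure ℝ)) :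
    ‖fourierHalfLine g‖ ^ 2 =
      ∫ y, ‖(𝓕 g : Lp ℂ 2 (volume : Measure ℝ)) y‖ ^ 2 ∂halfLine := by
  have hpi := Real.pi_pos
  rw [sq_norm_eq_integral]
  have e1 : ∫ p, ‖fourierHalfLine g p‖ ^ 2 ∂halfLine = (2 * Real.pi)⁻¹ *
      ∫ p in Ioi (0 : ℝ), ‖(𝓕 g : Lp ℂ 2 (volume : Measure ℝ)) (p * (2 * Real.pi)⁻¹)‖ ^ 2 := by
    rw [← integral_const_mul]
    refine integral_congr_ae ?_
    filter_upwards [coeFn_fourierHalfLine g] with p hp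
    rw [hp, norm_mul, Complex.norm_real, Real.norm_eq_abs, mul_pow, sq_abs,
      inv_pow, Real.sq_sqrt (by positivity), div_eq_mul_inv]
  rw [e1, integral_comp_mul_right_Ioi
    (fun y => ‖(𝓕 g : Lp ℂ 2 (volume : Measure ℝ)) y‖ ^ 2) 0 (by positivity),
    zero_mul, inv_inv, smul_eq_mul, inv_mul_cancel_left₀ (by positivity)]

theorem norm_fourierHalfLine_le (g : Lp ℂ 2 (volume : Measure ℝ)) :
    ‖fourierHalfLine g‖ ≤ ‖g‖ := by
  rw [← sq_le_sq₀ (norm_nonneg _) (norm_nonneg _), sq_norm_fourierHalfLine,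
    ← Lp.norm_fourier_eq g, sq_norm_eq_integral]
  exact setIntegral_le_integral ((Lp.memLp _).integrable_norm_pow (by norm_num))
    (Eventually.of_forall fun x => by positivity)

/-- The Fourier transform of an extension of parity `s` again has parity `s`, so the half-line
carries half of its squared norm. This offsets the factor 2 of `sq_norm_parityExtendL2`. -/
theorem norm_parityTransform_of_integrable {ζ s : ℂ} (hζ : ‖ζ‖ = 1) (hs : s = 1 ∨ s = -1)
    (f : L2Half) (hf : Integrable f halfLine) : ‖parityTransform ζ s f‖ = ‖f‖ := by
  rw [← sq_eq_sq₀ (norm_nonneg _) (norm_nonneg _), parityTransform, LinearMap.smul_apply,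
    LinearMap.comp_apply, norm_smul, hζ, one_mul, sq_norm_fourierHalfLine]
  set g := 𝓕 (parityExtend s f) with hg
  have hpar : ∀ y, ‖g |y|‖ = ‖g y‖ := by
    intro y
    rcases abs_choice y with h | h
    · rw [h]
    · have : g (-y) = s * g y := by
        rw [hg, fourier_parityExtend s hf, fourier_parityExtend s hf, ← integral_const_mul]
        refine integral_congr_ae (Eventually.of_forall fun x => ?_)
        have : s * s = 1 := by rcases hs with rfl | rfl <;> norm_num
        simp only [Complex.ofReal_neg]
        simp only [mul_neg, neg_mul, neg_neg]
        linear_combination (-Complex.exp (2 * Real.pi * x * y * Complex.I) * f x) * this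
      rw [h, this, norm_mul]
      rcases hs with rfl | rfl <;> simp
  have h1 : Integrable (parityExtendL2 s f) :=
    (integrable_parityExtend s hf).congr (coeFn_parityExtendL2 s f).symm
  have h3 : (𝓕 (parityExtendL2 s f) : Lp ℂ 2 (volume : Measure ℝ)) =ᵐ[volume] g := by
    filter_upwards [coeFn_fourier_of_integrable _ h1] with x hx
    rw [hx, Real.fourier_congr_ae (coeFn_parityExtendL2 s f)]
  have h4 := Lp.norm_fourier_eq (parityExtendL2 s f)
  rw [← sq_eq_sq₀ (norm_nonneg _) (norm_nonneg _), sq_norm_parityExtendL2 hs,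
    sq_norm_eq_integral] at h4
  rw [integral_congr_ae (h3.mono fun x hx => by rw [hx])] at h4
  rw [integral_congr_ae ((ae_restrict_of_ae h3).mono fun x hx => by rw [hx])]
  have e2 : ∫ y, ‖g y‖ ^ 2 = 2 * ∫ y in Ioi (0 : ℝ), ‖g y‖ ^ 2 := by
    rw [← integral_comp_abs (f := fun y => ‖g y‖ ^ 2)]
    simp only [hpar]
  linarith

theorem continuous_parityTransform {ζ s : ℂ} (hζ : ‖ζ‖ = 1) (hs : s = 1 ∨ s = -1) :
    Continuous (parityTransform ζ s) := by
  -- Any constant above `√2` would do; the exact isometry follows later by density.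
  refine AddMonoidHomClass.continuous_of_bound _ 2 fun f => ?_
  rw [parityTransform, LinearMap.smul_apply, LinearMap.comp_apply, norm_smul, hζ, one_mul]
  refine (norm_fourierHalfLine_le _).trans ?_
  rw [← sq_le_sq₀ (norm_nonneg _) (by positivity), sq_norm_parityExtendL2 hs]
  nlinarith [sq_nonneg ‖f‖]

/-- `U` is a unitary involution of `L²(ℝ₊)` that is symmetric for the bilinear pairing, given on
integrable elements by `√(2/π) ∫₀^∞ t(p x) f(x) dx`. -/
structure IsTrigTransform (t : ℝ → ℝ) (U : L2Half →ₗ[ℂ] L2Half) : Prop where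
  norm_map : ∀ f, ‖U f‖ = ‖f‖
  involutive : ∀ f, U (U f) = f
  symm : ∀ f g, ∫ x, U f x * g x ∂halfLine = ∫ x, f x * U g x ∂halfLine
  coeFn_eq : ∀ f : L2Half, Integrable f halfLine → ∀ᵐ p ∂halfLine,
    U f p = ((Real.sqrt (2 / Real.pi) : ℝ) : ℂ) * ∫ x, (t (p * x) : ℂ) * f x ∂halfLine

/-- The kernel `t(px)` is real, bounded and symmetric. Boundedness and symmetry give symmetry of `U`
by Fubini on integrable functions, and reality makes `U` commute with conjugation. A real symmetric
isometry is an involution: `⟨f, UUh⟩ = ⟨Uf, Uh⟩ = ⟨f, h⟩`. No inversion formula is needed. -/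
theorem isTrigTransform_of_dense {t : ℝ → ℝ} (htc : Continuous t) (ht : ∀ x, |t x| ≤ 1)
    {U : L2Half →ₗ[ℂ] L2Half} (hU : Continuous U)
    (hnorm : ∀ f : L2Half, Integrable f halfLine → ‖U f‖ = ‖f‖)
    (hcoe : ∀ f : L2Half, Integrable f halfLine → ∀ᵐ p ∂halfLine,
      U f p = ((Real.sqrt (2 / Real.pi) : ℝ) : ℂ) * ∫ x, (t (p * x) : ℂ) * f x ∂halfLine) :
    IsTrigTransform t U := by
  have hn : ∀ f, ‖U f‖ = ‖f‖ := fun f =>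
    (dense_integrable.induction (P := fun f => ‖U f‖ = ‖f‖) hnorm
      (isClosed_eq hU.norm continuous_norm)) f
  have hs : ∀ f g, ∫ x, U f x * g x ∂halfLine = ∫ x, f x * U g x ∂halfLine := by
    intro f g
    refine dense_integrable.induction
      (P := fun f => ∫ x, U f x * g x ∂halfLine = ∫ x, f x * U g x ∂halfLine) ?_
      (isClosed_eq ((continuous_integral_mul_left g).comp hU)
        (continuous_integral_mul_left (U g))) f
    intro f hf
    refine dense_integrable.induction
      (P := fun g => ∫ x, U f x * g x ∂halfLine = ∫ x, f x * U g x ∂halfLine) ?_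
      (isClosed_eq (continuous_integral_mul_right _)
        ((continuous_integral_mul_right f).comp hU)) g
    intro g hg
    set c := ((Real.sqrt (2 / Real.pi) : ℝ) : ℂ)
    have e1 : ∫ x, U f x * g x ∂halfLine =
        ∫ x, ∫ y, c * ((t (x * y) : ℂ) * (g x * f y)) ∂halfLine ∂halfLine := by
      refine integral_congr_ae ?_
      filter_upwards [hcoe f hf] with x hx
      rw [hx, integral_const_mul, mul_assoc, ← integral_mul_const]
      congr 2 with y
      ring
    have e2 : ∫ x, f x * U g x ∂halfLine =
        ∫ x, ∫ y, c * ((t (y * x) : ℂ) * (g y * f x)) ∂halfLine ∂halfLine := by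
      refine integral_congr_ae ?_
      filter_upwards [hcoe g hg] with x hx
      rw [hx, integral_const_mul, mul_left_comm, ← integral_const_mul]
      congr 2 with y
      rw [mul_comm x y]
      ring
    rw [e1, e2]
    refine integral_integral_swap (Integrable.const_mul ?_ c)
    refine (hg.mul_prod hf).bdd_mul (c := 1) ?_ (Eventually.of_forall fun z => ?_)
    · exact (Complex.continuous_ofReal.comp (htc.comp
        (continuous_fst.mul continuous_snd))).aestronglyMeasurable
    · rw [Complex.norm_real, Real.norm_eq_abs]
      exact ht _
  refine ⟨hn, fun h => ?_, hs, hcoe⟩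
  have hinner : ∀ f g, inner ℂ (U f) (U g) = inner ℂ f g :=
    (LinearMap.norm_map_iff_inner_map_map U).1 hn
  refine ext_inner_left ℂ fun f => ?_
  refine dense_integrable.induction
    (P := fun f => inner ℂ f (U (U h)) = inner ℂ f h) ?_
    (isClosed_eq (by fun_prop) (by fun_prop)) f
  intro f hf
  have hcf : Integrable (conjL2 f) halfLine := by
    refine (hf.norm).mono (Lp.aestronglyMeasurable _) ?_
    filter_upwards [coeFn_conjL2 f] with x hx
    rw [hx, RCLike.norm_conj, norm_norm]
  have hconj : U (conjL2 f) = conjL2 (U f) := by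
    refine Lp.ext ?_
    filter_upwards [hcoe _ hcf, hcoe f hf, coeFn_conjL2 (U f)] with p h1 h2 h3
    rw [h1, h3, h2, map_mul, Complex.conj_ofReal, ← integral_conj]
    congr 1
    refine integral_congr_ae ?_
    filter_upwards [coeFn_conjL2 f] with x hx
    rw [hx, map_mul, Complex.conj_ofReal]
  rw [inner_eq_integral_conj, ← hs, hconj, ← inner_eq_integral_conj, hinner]

theorem isTrigTransform_parityTransform {t : ℝ → ℝ} (htc : Continuous t) (ht : ∀ x, |t x| ≤ 1)
    {ζ s : ℂ} (hζ : ‖ζ‖ = 1) (hs : s = 1 ∨ s = -1)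
    (hts : ∀ y : ℝ, ζ * (Complex.exp (-(y * Complex.I)) + s * Complex.exp (y * Complex.I)) =
      2 * (t y : ℂ)) :
    IsTrigTransform t (parityTransform ζ s) := by
  have hpi := Real.pi_pos
  refine isTrigTransform_of_dense htc ht (continuous_parityTransform hζ hs)
    (norm_parityTransform_of_integrable hζ hs) fun f hf => ?_
  filter_upwards [coeFn_parityTransform ζ s f hf] with p hp
  have hc : ((Real.sqrt (2 / Real.pi) : ℝ) : ℂ) = (((Real.sqrt (2 * Real.pi))⁻¹ : ℝ) : ℂ) * 2 := by
    rw [← Complex.ofReal_ofNat, ← Complex.ofReal_mul]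
    congr 1
    rw [Real.sqrt_eq_iff_mul_self_eq (by positivity) (by positivity)]
    have := Real.mul_self_sqrt (show 0 ≤ 2 * Real.pi by positivity)
    field_simp
    nlinarith
  rw [hp, hc, fourier_parityExtend s hf, mul_left_comm, ← integral_const_mul ζ,
    mul_assoc, ← integral_const_mul (2 : ℂ)]
  congr 1
  refine integral_congr_ae (Eventually.of_forall fun x => ?_)
  have e : (2 * Real.pi * x * ((p / (2 * Real.pi) : ℝ) : ℂ) * Complex.I) =
      ((p * x : ℝ) : ℂ) * Complex.I := by
    push_cast
    field_simp
  simp only [e]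
  rw [← mul_assoc, hts ((p * x : ℝ)), mul_assoc]

theorem isTrigTransform_sine : IsTrigTransform Real.sin sineTransform := by
  refine isTrigTransform_parityTransform (ζ := Complex.I) (s := -1) Real.continuous_sin
    Real.abs_sin_le_one (by simp) (Or.inr rfl) fun y => ?_
  rw [Complex.ofReal_sin, Complex.sin]
  simp only [neg_mul]
  ring

theorem isTrigTransform_cosine : IsTrigTransform Real.cos cosineTransform := by
  have h : cosineTransform = parityTransform 1 1 := by
    rw [parityTransform, one_smul]
    rfl
  rw [h]
  refine isTrigTransform_parityTransform Real.continuous_cos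
    Real.abs_cos_le_one (by simp) (Or.inl rfl) fun y => ?_
  rw [Complex.ofReal_cos, Complex.cos, neg_mul]
  ring

/-! ### A Hardy inequality -/

theorem lintegral_Ioi_rpow_tail {ε q : ℝ} (hε : 0 < ε) (hq : 0 < q) :
    ∫⁻ s in Ioi q, ENNReal.ofReal (s ^ (-1 - ε)) = ENNReal.ofReal (q ^ (-ε) / ε) := by
  have h := integral_Ioi_rpow_of_lt (a := -1 - ε) (by linarith) hq
  rw [← ofReal_integral_eq_lintegral_ofReal, h]
  · congr 1
    rw [show -1 - ε + 1 = -ε by ring, neg_div_neg_eq]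
  · exact integrableOn_Ioi_rpow_of_lt (by linarith) hq
  · filter_upwards [ae_restrict_mem measurableSet_Ioi] with s hs
    exact Real.rpow_nonneg (hq.le.trans (le_of_lt hs)) _

theorem lintegral_Ioo_rpow {ε s : ℝ} (hε : 0 < ε) (hs : 0 < s) :
    ∫⁻ q in Ioo 0 s, ENNReal.ofReal (q ^ (ε - 1)) = ENNReal.ofReal (s ^ ε / ε) := by
  have h := integral_rpow (a := 0) (b := s) (r := ε - 1) (Or.inl (by linarith))
  rw [intervalIntegral.integral_of_le hs.le] at h
  have hi := (intervalIntegral.intervalIntegrable_rpow' (a := 0) (b := s) (r := ε - 1)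
    (by linarith)).1
  rw [setLIntegral_congr Ioo_ae_eq_Ioc, ← ofReal_integral_eq_lintegral_ofReal hi, h]
  · rw [show ε - 1 + 1 = ε by ring, Real.zero_rpow hε.ne', sub_zero]
  · filter_upwards [ae_restrict_mem measurableSet_Ioc] with s hs
    exact Real.rpow_nonneg (le_of_lt hs.1) _

theorem sq_lintegral_mul_le {μ : Measure ℝ} {f g : ℝ → ℝ≥0∞} (hf : Measurable f)
    (hg : Measurable g) :
    (∫⁻ s, f s * g s ∂μ) ^ 2 ≤ (∫⁻ s, f s ^ 2 ∂μ) * ∫⁻ s, g s ^ 2 ∂μ := by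
  have h := ENNReal.lintegral_mul_le_Lp_mul_Lq μ Real.HolderConjugate.two_two
    hf.aemeasurable hg.aemeasurable
  have h2 := pow_le_pow_left' h 2
  rw [mul_pow, ← ENNReal.rpow_natCast, ← ENNReal.rpow_natCast, ← ENNReal.rpow_natCast,
    ← ENNReal.rpow_mul, ← ENNReal.rpow_mul] at h2
  simpa using h2

/-- With `ε = r + 1/2`, split `s^(-r-1) = s^((-1-ε)/2) · s^(-ε/2)`, apply Cauchy–Schwarz to the
inner integral, and exchange the order of integration. Each of the two remaining power integrals
contributes a factor `1/ε`. -/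
theorem lintegral_hardy {r : ℝ} (hr : -1 / 2 < r) {F : ℝ → ℝ≥0∞} (hF : Measurable F) :
    ∫⁻ q, (ENNReal.ofReal (q ^ r) * ∫⁻ s in Ioi q, ENNReal.ofReal (s ^ (-r - 1)) * F s) ^ 2
      ∂halfLine ≤ ENNReal.ofReal ((r + 1 / 2)⁻¹ ^ 2) * ∫⁻ s, F s ^ 2 ∂halfLine := by
  set ε := r + 1 / 2 with hε'
  have hε : 0 < ε := by linarith
  have step : ∀ q ∈ Ioi (0 : ℝ),
      (ENNReal.ofReal (q ^ r) * ∫⁻ s in Ioi q, ENNReal.ofReal (s ^ (-r - 1)) * F s) ^ 2 ≤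
      ∫⁻ s in Ioi 0, (Ioi q).indicator (fun s => ENNReal.ofReal ε⁻¹ *
        (ENNReal.ofReal (q ^ (ε - 1)) * (ENNReal.ofReal (s ^ (-ε)) * F s ^ 2))) s := by
    intro q hq
    have hq0 : 0 < q := hq
    have e1 : ∫⁻ s in Ioi q, ENNReal.ofReal (s ^ (-r - 1)) * F s =
        ∫⁻ s in Ioi q, ENNReal.ofReal (s ^ ((-1 - ε) / 2)) *
          (ENNReal.ofReal (s ^ (-ε / 2)) * F s) := by
      refine setLIntegral_congr_fun measurableSet_Ioi fun s hs => ?_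
      have hs0 : 0 < s := hq0.trans hs
      rw [← mul_assoc, ← ENNReal.ofReal_mul (by positivity), ← Real.rpow_add hs0]
      congr 3
      rw [hε']; ring
    have e2 : ∫⁻ s in Ioi q, ENNReal.ofReal (s ^ ((-1 - ε) / 2)) ^ 2 =
        ENNReal.ofReal (q ^ (-ε) / ε) := by
      rw [← lintegral_Ioi_rpow_tail hε hq0]
      refine setLIntegral_congr_fun measurableSet_Ioi fun s hs => ?_
      have hs0 : 0 < s := hq0.trans hs
      rw [← ENNReal.ofReal_pow (by positivity), ← Real.rpow_natCast, ← Real.rpow_mul hs0.le]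
      congr 2
      push_cast; ring
    have e3 : ∫⁻ s in Ioi q, (ENNReal.ofReal (s ^ (-ε / 2)) * F s) ^ 2 =
        ∫⁻ s in Ioi q, ENNReal.ofReal (s ^ (-ε)) * F s ^ 2 := by
      refine setLIntegral_congr_fun measurableSet_Ioi fun s hs => ?_
      have hs0 : 0 < s := hq0.trans hs
      rw [mul_pow, ← ENNReal.ofReal_pow (by positivity), ← Real.rpow_natCast,
        ← Real.rpow_mul hs0.le]
      congr 3
      push_cast; ring
    have hm : Measurable fun s : ℝ => ENNReal.ofReal (s ^ (-ε / 2)) * F s := by fun_prop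
    have h := sq_lintegral_mul_le (μ := volume.restrict (Ioi q))
      (f := fun s => ENNReal.ofReal (s ^ ((-1 - ε) / 2))) (by fun_prop) hm
    rw [e2, e3] at h
    rw [mul_pow, e1]
    refine (mul_le_mul_right h _).trans ?_
    rw [lintegral_indicator measurableSet_Ioi, Measure.restrict_restrict measurableSet_Ioi,
      inter_eq_left.2 (Ioi_subset_Ioi hq0.le), lintegral_const_mul _ (by fun_prop),
      lintegral_const_mul _ (by fun_prop), ← mul_assoc, ← mul_assoc]
    refine le_of_eq ?_
    congr 1
    rw [← ENNReal.ofReal_pow (by positivity), ← ENNReal.ofReal_mul (by positivity),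
      ← ENNReal.ofReal_mul (by positivity), ← Real.rpow_natCast, ← Real.rpow_mul hq0.le,
      div_eq_inv_mul, mul_left_comm, ← Real.rpow_add hq0]
    congr 3
    rw [hε']; push_cast; ring
  refine (setLIntegral_mono' measurableSet_Ioi step).trans ?_
  rw [lintegral_lintegral_swap]
  · rw [← lintegral_const_mul _ (by fun_prop)]
    refine setLIntegral_mono' measurableSet_Ioi fun s hs => ?_
    have hs0 : 0 < s := hs
    have e : ∀ q : ℝ, (Ioi q).indicator (fun s => ENNReal.ofReal ε⁻¹ *
        (ENNReal.ofReal (q ^ (ε - 1)) * (ENNReal.ofReal (s ^ (-ε)) * F s ^ 2))) s =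
        (Iio s).indicator (fun q => (ENNReal.ofReal ε⁻¹ * (ENNReal.ofReal (s ^ (-ε)) * F s ^ 2)) *
        ENNReal.ofReal (q ^ (ε - 1))) q := by
      intro q
      by_cases hqs : q < s
      · rw [indicator_of_mem (by exact hqs), indicator_of_mem (by exact hqs)]
        ring
      · rw [indicator_of_notMem (by exact hqs), indicator_of_notMem (by exact hqs)]
    simp_rw [e]
    rw [lintegral_indicator measurableSet_Iio, Measure.restrict_restrict measurableSet_Iio,
      inter_comm, Ioi_inter_Iio, lintegral_const_mul _ (by fun_prop), lintegral_Ioo_rpow hε hs0]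
    refine le_of_eq ?_
    calc _ = (ENNReal.ofReal ε⁻¹ * ENNReal.ofReal (s ^ (-ε)) * ENNReal.ofReal (s ^ ε / ε)) *
          F s ^ 2 := by ring
      _ = _ := by
        rw [← ENNReal.ofReal_mul (by positivity), ← ENNReal.ofReal_mul (by positivity)]
        congr 2
        rw [Real.rpow_neg hs0.le]
        field_simp
  · have : (Function.uncurry fun q s : ℝ => (Ioi q).indicator (fun s => ENNReal.ofReal ε⁻¹ *
        (ENNReal.ofReal (q ^ (ε - 1)) * (ENNReal.ofReal (s ^ (-ε)) * F s ^ 2))) s) =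
        {z : ℝ × ℝ | z.1 < z.2}.indicator (fun z => ENNReal.ofReal ε⁻¹ *
        (ENNReal.ofReal (z.1 ^ (ε - 1)) * (ENNReal.ofReal (z.2 ^ (-ε)) * F z.2 ^ 2))) := by
      ext ⟨q, s⟩
      simp [Function.uncurry, indicator_apply]
    rw [this]
    refine (Measurable.indicator ?_ (measurableSet_lt measurable_fst measurable_snd)).aemeasurable
    fun_prop

theorem eLpNorm_two_sq {X : Type*} [MeasurableSpace X] {μ : Measure X} (f : X → ℂ) :
    eLpNorm f 2 μ ^ 2 = ∫⁻ x, ‖f x‖ₑ ^ 2 ∂μ := by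
  rw [eLpNorm_eq_lintegral_rpow_enorm_toReal (by norm_num) (by norm_num),
    ← ENNReal.rpow_natCast, ← ENNReal.rpow_mul]
  simp

theorem eLpNorm_le_of_le_hardy {r : ℝ} (hr : -1 / 2 < r) (γ : L2Half) {w : ℝ → ℂ}
    (hw : ∀ᵐ q ∂halfLine, ‖w q‖ₑ ≤
      ENNReal.ofReal (q ^ r) * ∫⁻ s in Ioi q, ENNReal.ofReal (s ^ (-r - 1)) * ‖γ s‖ₑ) :
    eLpNorm w 2 halfLine ≤ ENNReal.ofReal (r + 1 / 2)⁻¹ * eLpNorm γ 2 halfLine := by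
  have h0 : 0 ≤ (r + 1 / 2)⁻¹ := inv_nonneg.2 (by linarith)
  have h := lintegral_hardy hr (F := fun s => ‖γ s‖ₑ) (Lp.stronglyMeasurable γ).measurable.enorm
  rw [← eLpNorm_two_sq, ENNReal.ofReal_pow h0, ← mul_pow] at h
  have h2 : eLpNorm w 2 halfLine ^ 2 ≤ _ :=
    ((eLpNorm_two_sq w).le.trans (lintegral_mono_ae (hw.mono fun q hq => by gcongr))).trans h
  exact (ENNReal.pow_le_pow_left_iff (n := 2) (by norm_num)).1 h2

theorem integrableOn_rpow_mul_norm {r : ℝ} (hr : -1 / 2 < r) (γ : L2Half) {q : ℝ} (hq : 0 < q) :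
    IntegrableOn (fun s => s ^ (-r - 1) * ‖γ s‖) (Ioi q) := by
  have h1 : MemLp (fun s : ℝ => s ^ (-r - 1)) 2 (volume.restrict (Ioi q)) := by
    rw [memLp_two_iff_integrable_sq (by fun_prop)]
    refine (integrableOn_Ioi_rpow_of_lt (a := -2 * r - 2) (by linarith) hq).congr_fun ?_
      measurableSet_Ioi
    intro s hs
    have hs0 : 0 < s := hq.trans hs
    simp only
    rw [← Real.rpow_natCast, ← Real.rpow_mul hs0.le]
    congr 1
    push_cast; ring
  have h2 : MemLp (fun s => ‖γ s‖) 2 (volume.restrict (Ioi q)) :=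
    ((Lp.memLp γ).mono_measure (Measure.restrict_mono (Ioi_subset_Ioi hq.le) le_rfl)).norm
  exact h1.integrable_mul h2

theorem integrableOn_cpow_mul {a : ℂ} (ha : -1 / 2 < a.re) (γ : L2Half) {q : ℝ} (hq : 0 < q) :
    IntegrableOn (fun s : ℝ => (s : ℂ) ^ (-a - 1) * γ s) (Ioi q) := by
  refine (integrableOn_rpow_mul_norm ha γ hq).mono' ?_ ?_
  · refine (Measurable.aestronglyMeasurable ?_).mul (Lp.stronglyMeasurable γ).aestronglyMeasurable
    fun_prop
  · filter_upwards [ae_restrict_mem measurableSet_Ioi] with s hs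
    rw [norm_mul, Complex.norm_cpow_eq_rpow_re_of_pos (hq.trans hs)]
    simp

/-- The function `q ↦ q^a ∫_q^∞ s^(-a-1) γ(s) ds`. -/
noncomputable def hardyTail (a : ℂ) (γ : ℝ → ℂ) (q : ℝ) : ℂ :=
  (q : ℂ) ^ a * ∫ s in Ioi q, (s : ℂ) ^ (-a - 1) * γ s

theorem enorm_hardyTail_le {a : ℂ} (γ : L2Half) {q : ℝ} (hq : 0 < q) :
    ‖hardyTail a γ q‖ₑ ≤ ENNReal.ofReal (q ^ a.re) *
      ∫⁻ s in Ioi q, ENNReal.ofReal (s ^ (-a.re - 1)) * ‖γ s‖ₑ := by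
  rw [hardyTail, enorm_mul, ← ofReal_norm ((q : ℂ) ^ a),
    Complex.norm_cpow_eq_rpow_re_of_pos hq]
  gcongr
  refine (enorm_integral_le_lintegral_enorm _).trans (le_of_eq ?_)
  refine setLIntegral_congr_fun measurableSet_Ioi fun s hs => ?_
  rw [enorm_mul, ← ofReal_norm ((s : ℂ) ^ _),
    Complex.norm_cpow_eq_rpow_re_of_pos (hq.trans hs)]
  simp

theorem continuousOn_integral_Ioi {f : ℝ → ℂ} (hf : ∀ q, 0 < q → IntegrableOn f (Ioi q)) :
    ContinuousOn (fun q => ∫ s in Ioi q, f s) (Ioi 0) := by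
  intro q hq
  have hq' : 0 < q := hq
  have hq0 : 0 < q / 2 := half_pos hq'
  have e : ∀ᶠ x in 𝓝 q, ∫ s in Ioi x, f s =
      (∫ s in Ioi (q / 2), f s) - ∫ s in (q / 2)..x, f s := by
    filter_upwards [lt_mem_nhds (half_lt_self hq')] with x hx
    rw [eq_sub_iff_add_eq, add_comm]
    rw [intervalIntegral.integral_interval_add_Ioi (hf _ hq0) (hf _ (hq0.trans hx))]
  refine (ContinuousAt.congr ?_ (e.mono fun _ h => h.symm)).continuousWithinAt
  refine continuousAt_const.sub ?_
  have hii : IntervalIntegrable f volume (q / 2) (q + 1) :=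
    (intervalIntegrable_iff_integrableOn_Ioc_of_le (by linarith [half_lt_self hq', hq'])).2
      ((hf _ hq0).mono_set Ioc_subset_Ioi_self)
  have hc := intervalIntegral.continuousOn_primitive_interval' hii left_mem_uIcc
  refine hc.continuousAt ?_
  rw [uIcc_of_le (by linarith [half_lt_self hq', hq'])]
  exact Icc_mem_nhds (half_lt_self hq') (by linarith)

theorem continuousOn_hardyTail {a : ℂ} (ha : -1 / 2 < a.re) (γ : L2Half) :
    ContinuousOn (hardyTail a γ) (Ioi 0) := by
  refine ContinuousOn.mul ?_ (continuousOn_integral_Ioi fun q hq => integrableOn_cpow_mul ha γ hq)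
  intro q hq
  exact (Complex.continuousAt_ofReal_cpow_const q a (Or.inr (ne_of_gt hq))).continuousWithinAt

theorem memLp_hardyTail {a : ℂ} (ha : -1 / 2 < a.re) (γ : L2Half) :
    MemLp (hardyTail a γ) 2 halfLine := by
  refine ⟨(continuousOn_hardyTail ha γ).aestronglyMeasurable measurableSet_Ioi, ?_⟩
  refine (eLpNorm_le_of_le_hardy ha γ ?_).trans_lt
    (ENNReal.mul_lt_top ENNReal.ofReal_lt_top (Lp.memLp γ).2)
  filter_upwards [ae_restrict_mem measurableSet_Ioi] with q hq
  exact enorm_hardyTail_le γ hq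

/-- `hardyTail a γ` as an element of `L²(ℝ₊)`. -/
noncomputable def hardyL2 {a : ℂ} (ha : -1 / 2 < a.re) (γ : L2Half) : L2Half :=
  (memLp_hardyTail ha γ).toLp _

theorem coeFn_hardyL2 {a : ℂ} (ha : -1 / 2 < a.re) (γ : L2Half) :
    hardyL2 ha γ =ᵐ[halfLine] hardyTail a γ :=
  (memLp_hardyTail ha γ).coeFn_toLp

theorem norm_hardyL2_le {a : ℂ} (ha : -1 / 2 < a.re) (γ : L2Half) :
    ‖hardyL2 ha γ‖ ≤ (a.re + 1 / 2)⁻¹ * ‖γ‖ := by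
  rw [hardyL2, Lp.norm_toLp, Lp.norm_def, ← ENNReal.toReal_ofReal
    (show 0 ≤ (a.re + 1 / 2)⁻¹ from inv_nonneg.2 (by linarith)), ← ENNReal.toReal_mul]
  refine ENNReal.toReal_mono (ENNReal.mul_ne_top ENNReal.ofReal_ne_top (Lp.memLp γ).2.ne) ?_
  refine eLpNorm_le_of_le_hardy ha γ ?_
  filter_upwards [ae_restrict_mem measurableSet_Ioi] with q hq
  exact enorm_hardyTail_le γ hq

/-! ### The Euler differential equation -/

/-- Integration by parts when `φ` is merely integrable, so that `Φ` is a primitive only in the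
integrated sense. -/
theorem integral_mul_eq_of_primitive {p q : ℝ} (hpq : p ≤ q) {g g' φ Φ : ℝ → ℂ}
    (hg : ∀ s ∈ Icc p q, HasDerivAt g (g' s) s) (hg' : ContinuousOn g' (Icc p q))
    (hφ : IntegrableOn φ (Ioc p q)) (hΦ : ∀ s ∈ Icc p q, Φ q - Φ s = ∫ t in s..q, φ t) :
    ∫ s in p..q, g s * φ s = g q * Φ q - g p * Φ p - ∫ s in p..q, g' s * Φ s := by
  have hg'i : IntegrableOn g' (Ioc p q) :=
    (hg'.integrableOn_Icc).mono_set Ioc_subset_Icc_self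
  have hg'ii : IntervalIntegrable g' volume p q :=
    (intervalIntegrable_iff_integrableOn_Ioc_of_le hpq).2 hg'i
  have hφii : IntervalIntegrable φ volume p q :=
    (intervalIntegrable_iff_integrableOn_Ioc_of_le hpq).2 hφ
  have hgc : ContinuousOn g (Icc p q) := fun s hs => (hg s hs).continuousAt.continuousWithinAt
  have hg1 : ∀ s ∈ Icc p q, g s = g p + ∫ t in p..s, g' t := by
    intro s hs
    rw [intervalIntegral.integral_eq_sub_of_hasDerivAt]
    · ring
    · intro t ht
      rw [uIcc_of_le hs.1] at ht
      exact hg t ⟨ht.1, ht.2.trans hs.2⟩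
    · exact hg'ii.mono_set (by
        rw [uIcc_of_le hs.1, uIcc_of_le hpq]; exact Icc_subset_Icc_right hs.2)
  have hΦc : ContinuousOn Φ (Icc p q) := by
    have h1 : ∀ s ∈ Icc p q, Φ s = Φ p + ∫ t in p..s, φ t := by
      intro s hs
      have h2 := hΦ s hs
      have h3 := hΦ p ⟨le_rfl, hpq⟩
      rw [← intervalIntegral.integral_add_adjacent_intervals (b := s)] at h3
      · linear_combination h3 - h2
      · exact hφii.mono_set (by
          rw [uIcc_of_le hs.1, uIcc_of_le hpq]; exact Icc_subset_Icc_right hs.2)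
      · exact hφii.mono_set (by
          rw [uIcc_of_le hs.2, uIcc_of_le hpq]; exact Icc_subset_Icc_left hs.1)
    refine ContinuousOn.congr (continuousOn_const.add ?_) h1
    have := intervalIntegral.continuousOn_primitive_interval' hφii left_mem_uIcc
    rwa [uIcc_of_le hpq] at this
  -- Fubini on the triangle `t ≤ s` in the square over `]p,q]`.
  have key : ∫ s in p..q, (∫ t in p..s, g' t) * φ s =
      ∫ t in p..q, g' t * (∫ s in t..q, φ s) := by
    set K : ℝ → ℝ → ℂ := fun s t => {z : ℝ × ℝ | z.2 ≤ z.1}.indicator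
      (fun z => φ z.1 * g' z.2) (s, t) with hK
    have hKi : Integrable (Function.uncurry K)
        ((volume.restrict (Ioc p q)).prod (volume.restrict (Ioc p q))) := by
      refine ((hφ.mul_prod hg'i).indicator
        (measurableSet_le measurable_snd measurable_fst)).congr (Eventually.of_forall fun z => ?_)
      rfl
    have hsw := integral_integral_swap hKi
    rw [intervalIntegral.integral_of_le hpq, intervalIntegral.integral_of_le hpq]
    have e1 : ∫ s in Ioc p q, (∫ t in p..s, g' t) * φ s =
        ∫ s in Ioc p q, ∫ t in Ioc p q, K s t := by
      refine setIntegral_congr_fun measurableSet_Ioc fun s hs => ?_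
      have : ∀ t, K s t = (Iic s).indicator (fun t => φ s * g' t) t := by
        intro t
        simp [hK, indicator_apply]
      simp_rw [this]
      rw [integral_indicator measurableSet_Iic, Measure.restrict_restrict measurableSet_Iic,
        inter_comm, Ioc_inter_Iic, min_eq_right hs.2, integral_const_mul,
        intervalIntegral.integral_of_le hs.1.le, mul_comm]
    have e2 : ∫ t in Ioc p q, g' t * (∫ s in t..q, φ s) =
        ∫ t in Ioc p q, ∫ s in Ioc p q, K s t := by
      refine setIntegral_congr_fun measurableSet_Ioc fun t ht => ?_
      have : ∀ s, K s t = (Ici t).indicator (fun s => φ s * g' t) s := by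
        intro s
        simp [hK, indicator_apply]
      simp_rw [this]
      rw [integral_indicator measurableSet_Ici, Measure.restrict_restrict measurableSet_Ici,
        integral_mul_const, intervalIntegral.integral_of_le ht.2, mul_comm]
      congr 1
      rw [← integral_Icc_eq_integral_Ioc]
      congr 2
      ext s
      simp only [mem_Icc, mem_inter_iff, mem_Ici, mem_Ioc]
      constructor
      · rintro ⟨h1, h2⟩; exact ⟨h1, ht.1.trans_le h1, h2⟩
      · rintro ⟨h1, _, h2⟩; exact ⟨h1, h2⟩
    rw [e1, e2, hsw]
  have hGc : ContinuousOn (fun s => ∫ t in p..s, g' t) (uIcc p q) :=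
    intervalIntegral.continuousOn_primitive_interval' hg'ii left_mem_uIcc
  have e3 : ∫ s in p..q, g s * φ s =
      g p * (∫ s in p..q, φ s) + ∫ s in p..q, (∫ t in p..s, g' t) * φ s := by
    rw [← intervalIntegral.integral_const_mul, ← intervalIntegral.integral_add]
    · refine intervalIntegral.integral_congr fun s hs => ?_
      rw [uIcc_of_le hpq] at hs
      rw [hg1 s hs]
      ring
    · exact hφii.const_mul _
    · exact hφii.continuousOn_mul hGc
  have e4 : ∫ t in p..q, g' t * (∫ s in t..q, φ s) =
      (∫ t in p..q, g' t) * Φ q - ∫ s in p..q, g' s * Φ s := by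
    rw [← intervalIntegral.integral_mul_const, ← intervalIntegral.integral_sub]
    · refine intervalIntegral.integral_congr fun s hs => ?_
      rw [uIcc_of_le hpq] at hs
      rw [← hΦ s hs]
      ring
    · exact hg'ii.mul_const _
    · exact hg'ii.mul_continuousOn (by rwa [uIcc_of_le hpq])
  rw [e3, key, e4, ← hΦ p ⟨le_rfl, hpq⟩]
  have := hg1 q ⟨hpq, le_rfl⟩
  rw [this]
  ring

theorem integrableOn_Ioc_of_L2 (φ : L2Half) {p q : ℝ} (hp : 0 ≤ p) :
    IntegrableOn φ (Ioc p q) := by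
  have h : MemLp φ 2 (volume.restrict (Ioc p q)) :=
    (Lp.memLp φ).mono_measure (Measure.restrict_mono (fun x hx => hp.trans_lt hx.1) le_rfl)
  have : IsFiniteMeasure (volume.restrict (Ioc p q)) := ⟨by simp⟩
  exact h.integrable (by norm_num)

theorem intervalIntegrable_of_L2 (φ : L2Half) {p q : ℝ} (hp : 0 ≤ p) (hq : 0 ≤ q) :
    IntervalIntegrable φ volume p q :=
  ⟨integrableOn_Ioc_of_L2 φ hp, integrableOn_Ioc_of_L2 φ hq⟩

theorem hasDerivAt_ofReal_cpow {a : ℂ} {s : ℝ} (hs : 0 < s) :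
    HasDerivAt (fun s : ℝ => (s : ℂ) ^ a) (a * (s : ℂ) ^ (a - 1)) s := by
  have h := HasDerivAt.comp_ofReal (hasDerivAt_id (s : ℂ) |>.cpow_const (c := a)
    (Complex.ofReal_mem_slitPlane.2 hs))
  simpa using h

theorem continuousOn_ofReal_cpow (a : ℂ) : ContinuousOn (fun s : ℝ => (s : ℂ) ^ a) (Ioi 0) :=
  fun _ hs => (hasDerivAt_ofReal_cpow hs).continuousAt.continuousWithinAt

/-- `Φ' = Φ₁` and `Φ₁' = φ` on `]0,∞[`, the latter in the integrated sense. -/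
structure IsSecondPrimitive (φ Φ Φ₁ : ℝ → ℂ) : Prop where
  hasDerivAt : ∀ q, 0 < q → HasDerivAt Φ (Φ₁ q) q
  sub_eq : ∀ p q, 0 < p → 0 < q → Φ₁ q - Φ₁ p = ∫ s in p..q, φ s

theorem IsSecondPrimitive.continuousOn {φ : L2Half} {Φ Φ₁ : ℝ → ℂ}
    (h : IsSecondPrimitive φ Φ Φ₁) : ContinuousOn Φ₁ (Ioi 0) := by
  intro q hq
  have hq' : 0 < q := hq
  have e : ∀ᶠ x in 𝓝 q, Φ₁ x = Φ₁ q + ∫ s in q..x, φ s := by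
    filter_upwards [lt_mem_nhds hq'] with x hx
    rw [← h.sub_eq q x hq' hx]
    ring
  refine (ContinuousAt.congr ?_ (e.mono fun _ h => h.symm)).continuousWithinAt
  refine continuousAt_const.add ?_
  have hc := intervalIntegral.continuousOn_primitive_interval' (a := q)
    (intervalIntegrable_of_L2 φ (p := q / 2) (q := q + 1) (by linarith) (by linarith))
    (by rw [uIcc_of_le (by linarith)]; constructor <;> linarith)
  refine hc.continuousAt ?_
  rw [uIcc_of_le (by linarith)]
  exact Icc_mem_nhds (half_lt_self hq') (by linarith)

/-- For `a + b = 1` the Euler operator factors as `q² D² + ab = (qD - a)(qD - b)`. Hence `w = qΦ' -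
bΦ` satisfies `(q^(-a) w)' = q^(-a-1) γ`, which is stated here in integrated form. -/
theorem euler_first_integral {a b : ℂ} (hab : a + b = 1) {φ γ : L2Half}
    {Φ Φ₁ : ℝ → ℂ} (h : IsSecondPrimitive φ Φ Φ₁)
    (hode : ∀ᵐ q : ℝ ∂halfLine, (q : ℂ) ^ 2 * φ q + a * b * Φ q = γ q) {p q : ℝ} (hp : 0 < p)
    (hpq : p ≤ q) :
    (q : ℂ) ^ (-a) * (q * Φ₁ q - b * Φ q) - (p : ℂ) ^ (-a) * (p * Φ₁ p - b * Φ p) =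
      ∫ s in p..q, (s : ℂ) ^ (-a - 1) * γ s := by
  have hb : b = 1 - a := by linear_combination hab
  have hsub : Icc p q ⊆ Ioi 0 := fun s hs => hp.trans_le hs.1
  have hu : uIcc p q = Icc p q := uIcc_of_le hpq
  have hΦc : ContinuousOn Φ (Ioi 0) := fun s hs =>
    (h.hasDerivAt s hs).continuousAt.continuousWithinAt
  have hΦ₁c := h.continuousOn
  have h1 := integral_mul_eq_of_primitive hpq (g := fun s : ℝ => (s : ℂ) ^ (1 - a))
    (g' := fun s : ℝ => (1 - a) * (s : ℂ) ^ (-a)) (φ := φ) (Φ := Φ₁)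
    (fun s hs => by
      have := hasDerivAt_ofReal_cpow (a := 1 - a) (hsub hs)
      simpa using this)
    ((continuousOn_const.mul (continuousOn_ofReal_cpow (-a))).mono hsub)
    (integrableOn_Ioc_of_L2 φ hp.le) (fun s hs => h.sub_eq s q (hsub hs) (hp.trans_le hpq))
  have hd2 : ∀ s ∈ uIcc p q, HasDerivAt (fun s : ℝ => (s : ℂ) ^ (-a) * Φ s)
      (-a * (s : ℂ) ^ (-a - 1) * Φ s + (s : ℂ) ^ (-a) * Φ₁ s) s := by
    intro s hs
    rw [hu] at hs
    exact (hasDerivAt_ofReal_cpow (hsub hs)).mul (h.hasDerivAt s (hsub hs))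
  have hc1 : ContinuousOn (fun s : ℝ => -a * (s : ℂ) ^ (-a - 1) * Φ s) (uIcc p q) := by
    rw [hu]
    exact ((continuousOn_const.mul (continuousOn_ofReal_cpow _)).mul hΦc).mono hsub
  have hc2 : ContinuousOn (fun s : ℝ => (s : ℂ) ^ (-a) * Φ₁ s) (uIcc p q) := by
    rw [hu]
    exact ((continuousOn_ofReal_cpow _).mul hΦ₁c).mono hsub
  have h2 := intervalIntegral.integral_eq_sub_of_hasDerivAt hd2
    (hc1.add hc2).intervalIntegrable
  have hc3 : ContinuousOn (fun s : ℝ => (s : ℂ) ^ (1 - a)) (uIcc p q) := by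
    rw [hu]
    exact (continuousOn_ofReal_cpow _).mono hsub
  have hi3 : IntervalIntegrable (fun s : ℝ => (s : ℂ) ^ (1 - a) * φ s) volume p q :=
    (intervalIntegrable_of_L2 φ hp.le (hp.le.trans hpq)).continuousOn_mul hc3
  rw [intervalIntegral.integral_add hc1.intervalIntegrable hc2.intervalIntegrable] at h2
  have h4 : ∫ s in p..q, (s : ℂ) ^ (-a - 1) * γ s =
      ∫ s in p..q, ((s : ℂ) ^ (1 - a) * φ s + -b * (-a * (s : ℂ) ^ (-a - 1) * Φ s)) := by
    refine intervalIntegral.integral_congr_ae ?_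
    rw [ae_restrict_iff' measurableSet_Ioi] at hode
    filter_upwards [hode] with s hs hs'
    rw [uIoc_of_le hpq] at hs'
    have hs0 : 0 < s := hp.trans hs'.1
    have hs1 : (s : ℂ) ≠ 0 := by exact_mod_cast hs0.ne'
    rw [← hs hs0, show (1 - a : ℂ) = (-a - 1) + 2 by ring, Complex.cpow_add _ _ hs1]
    norm_cast
    push_cast
    ring
  rw [h4, intervalIntegral.integral_add hi3 (hc1.intervalIntegrable.const_mul _),
    intervalIntegral.integral_const_mul, h1]
  have h5 : ∫ s in p..q, (1 - a) * (s : ℂ) ^ (-a) * Φ₁ s =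
      (1 - a) * ∫ s in p..q, (s : ℂ) ^ (-a) * Φ₁ s := by
    rw [← intervalIntegral.integral_const_mul]
    congr 1 with s
    ring
  have h6 : ∀ s : ℝ, 0 < s → (s : ℂ) ^ (1 - a) = (s : ℂ) ^ (-a) * s := by
    intro s hs
    have hs1 : (s : ℂ) ≠ 0 := by exact_mod_cast hs.ne'
    rw [show (1 - a : ℂ) = -a + 1 by ring, Complex.cpow_add _ _ hs1, Complex.cpow_one]
  rw [h5, h6 q (hp.trans_le hpq), h6 p hp]
  simp only [hb]
  linear_combination (1 - a) * h2

/-- For `Re a > -1/2` the function `s^(-a-1) γ(s)` is integrable at infinity, so the integration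
constant can be fixed there. The particular solution is then a Hardy tail, which is in `L²`. -/
theorem euler_first_integral_tail {a b : ℂ} (hab : a + b = 1) (ha : -1 / 2 < a.re) {φ γ : L2Half}
    {Φ Φ₁ : ℝ → ℂ} (h : IsSecondPrimitive φ Φ Φ₁)
    (hode : ∀ᵐ q : ℝ ∂halfLine, (q : ℂ) ^ 2 * φ q + a * b * Φ q = γ q) :
    ∃ K : ℂ, ∀ q : ℝ, 0 < q → q * Φ₁ q - b * Φ q = K * (q : ℂ) ^ a - hardyTail a γ q := by
  set u : ℝ → ℂ := fun q => (q : ℂ) ^ (-a) * (q * Φ₁ q - b * Φ q) with hu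
  set I : ℝ → ℂ := fun q => ∫ s in Ioi q, (s : ℂ) ^ (-a - 1) * γ s with hI
  have hdiff : ∀ p q : ℝ, 0 < p → p ≤ q → u q + I q = u p + I p := by
    intro p q hp hpq
    have h1 := euler_first_integral hab h hode hp hpq
    have h2 := intervalIntegral.integral_interval_add_Ioi (integrableOn_cpow_mul ha γ hp)
      (integrableOn_cpow_mul ha γ (hp.trans_le hpq))
    simp only [hu, hI]
    linear_combination h1 + h2
  -- The sum `u + I` is constant on the half-line; `1` is an arbitrary reference point.
  refine ⟨u 1 + I 1, fun q hq => ?_⟩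
  have h3 : u q + I q = u 1 + I 1 := by
    rcases le_total q 1 with h4 | h4
    · exact (hdiff q 1 hq h4).symm
    · exact hdiff 1 q one_pos h4
  rw [← h3]
  have hq1 : (q : ℂ) ≠ 0 := by exact_mod_cast hq.ne'
  have h5 : (q : ℂ) ^ (-a) * (q : ℂ) ^ a = 1 := by
    rw [← Complex.cpow_add _ _ hq1, neg_add_cancel, Complex.cpow_zero]
  simp only [hu, hI, hardyTail]
  linear_combination (-(q * Φ₁ q - b * Φ q)) * h5

/-- The first solution of `q² e'' = (m² - 1/4) e`. -/
noncomputable def eulerFst (m : ℂ) (q : ℝ) : ℂ :=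
  open Classical in
  if m = 0 then (q : ℂ) ^ (1 / 2 : ℂ) * Real.log q else (q : ℂ) ^ (1 / 2 - m)

/-- The second solution of `q² e'' = (m² - 1/4) e`. -/
noncomputable def eulerSnd (m : ℂ) (q : ℝ) : ℂ := (q : ℂ) ^ (1 / 2 + m)

/-- The roots `1/2 ± m` can be taken in either order as `(a, b)`. In the difference of the two first
integrals `qΦ'` cancels and `2mΦ` remains. The Hardy constants are the inverses of `1 ± Re m`, both
at most `(1 - |Re m|)⁻¹`. -/
theorem euler_of_ne_zero {m : ℂ} (hm : |m.re| < 1) (h0 : m ≠ 0) {φ γ : L2Half} {Φ Φ₁ : ℝ → ℂ}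
    (h : IsSecondPrimitive φ Φ Φ₁)
    (hode : ∀ᵐ q : ℝ ∂halfLine, (q : ℂ) ^ 2 * φ q + (1 / 4 - m ^ 2) * Φ q = γ q) :
    ∃ c₁ c₂ : ℂ, ∃ ρ : L2Half, ‖ρ‖ ≤ ‖m‖⁻¹ * (1 - |m.re|)⁻¹ * ‖γ‖ ∧
      ∀ᵐ q ∂halfLine, Φ q = c₁ * eulerFst m q + c₂ * eulerSnd m q + ρ q := by
  have hm' := abs_lt.1 hm
  have ha : -1 / 2 < (1 / 2 + m).re := by
    simp only [Complex.add_re, Complex.div_ofNat_re, Complex.one_re]; linarith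
  have hb : -1 / 2 < (1 / 2 - m).re := by
    simp only [Complex.sub_re, Complex.div_ofNat_re, Complex.one_re]; linarith
  obtain ⟨K, hK⟩ := euler_first_integral_tail (a := 1 / 2 + m) (b := 1 / 2 - m) (by ring) ha h
    (hode.mono fun q hq => by rw [← hq]; ring)
  obtain ⟨K', hK'⟩ := euler_first_integral_tail (a := 1 / 2 - m) (b := 1 / 2 + m) (by ring) hb h
    (hode.mono fun q hq => by rw [← hq]; ring)
  refine ⟨-K' / (2 * m), K / (2 * m), (2 * m)⁻¹ • (hardyL2 hb γ - hardyL2 ha γ), ?_, ?_⟩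
  · have h1 : ‖hardyL2 hb γ - hardyL2 ha γ‖ ≤ 2 * ((1 - |m.re|)⁻¹ * ‖γ‖) := by
      refine (norm_sub_le _ _).trans ?_
      have hpos : 0 < 1 - |m.re| := by linarith
      have h2 : ((1 / 2 - m).re + 1 / 2)⁻¹ ≤ (1 - |m.re|)⁻¹ := by
        refine inv_anti₀ hpos ?_
        simp only [Complex.sub_re, Complex.div_ofNat_re, Complex.one_re]
        linarith [le_abs_self m.re]
      have h3 : ((1 / 2 + m).re + 1 / 2)⁻¹ ≤ (1 - |m.re|)⁻¹ := by
        refine inv_anti₀ hpos ?_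
        simp only [Complex.add_re, Complex.div_ofNat_re, Complex.one_re]
        linarith [neg_abs_le m.re]
      have h4 := norm_hardyL2_le hb γ
      have h5 := norm_hardyL2_le ha γ
      nlinarith [mul_le_mul_of_nonneg_right h2 (norm_nonneg γ),
        mul_le_mul_of_nonneg_right h3 (norm_nonneg γ)]
    rw [norm_smul, norm_inv, norm_mul, Complex.norm_ofNat]
    have : 0 ≤ (2 * ‖m‖)⁻¹ := by positivity
    calc _ ≤ (2 * ‖m‖)⁻¹ * (2 * ((1 - |m.re|)⁻¹ * ‖γ‖)) := mul_le_mul_of_nonneg_left h1 this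
      _ = _ := by
        have : ‖m‖ ≠ 0 := norm_ne_zero_iff.2 h0
        field_simp
  · filter_upwards [Lp.coeFn_smul (2 * m)⁻¹ (hardyL2 hb γ - hardyL2 ha γ),
      Lp.coeFn_sub (hardyL2 hb γ) (hardyL2 ha γ), coeFn_hardyL2 hb γ, coeFn_hardyL2 ha γ,
      ae_restrict_mem measurableSet_Ioi] with q h1 h2 h3 h4 hq
    rw [h1, Pi.smul_apply, h2, Pi.sub_apply, h3, h4, smul_eq_mul, eulerFst, if_neg h0, eulerSnd]
    have h5 : m * m⁻¹ = 1 := mul_inv_cancel₀ h0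
    linear_combination (2 * m)⁻¹ * (hK q hq - hK' q hq) - Φ q * h5

/-- The double root `1/2` gives only one first integral, so a second integration is needed:
`(q^(-1/2) Φ)' = K/q - q^(-3/2) T`. The first term produces the logarithm and the second a Hardy
tail of a Hardy tail; the Hardy constant at exponent `1/2` is `1`. -/
theorem euler_of_eq_zero {φ γ : L2Half} {Φ Φ₁ : ℝ → ℂ} (h : IsSecondPrimitive φ Φ Φ₁)
    (hode : ∀ᵐ q : ℝ ∂halfLine, (q : ℂ) ^ 2 * φ q + 1 / 4 * Φ q = γ q) :
    ∃ c₁ c₂ : ℂ, ∃ ρ : L2Half, ‖ρ‖ ≤ ‖γ‖ ∧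
      ∀ᵐ q ∂halfLine, Φ q = c₁ * eulerFst 0 q + c₂ * eulerSnd 0 q + ρ q := by
  have ha : -1 / 2 < (1 / 2 : ℂ).re := by norm_num
  obtain ⟨K, hK⟩ := euler_first_integral_tail (a := 1 / 2) (b := 1 / 2) (by norm_num) ha h
    (hode.mono fun q hq => by rw [← hq]; ring)
  set T := hardyTail (1 / 2) γ with hT
  have hTc : ContinuousOn T (Ioi 0) := continuousOn_hardyTail ha γ
  have hTi : ∀ q, 0 < q → IntegrableOn (fun s : ℝ => (s : ℂ) ^ (-(1 / 2) - 1 : ℂ) * T s) (Ioi q) := by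
    intro q hq
    refine (integrableOn_cpow_mul ha (hardyL2 ha γ) hq).congr ?_
    filter_upwards [ae_restrict_of_ae_restrict_of_subset (Ioi_subset_Ioi hq.le)
      (coeFn_hardyL2 ha γ)] with s hs
    rw [hs]
  set u : ℝ → ℂ := fun q => (q : ℂ) ^ (-(1 / 2) : ℂ) * Φ q - K * Real.log q with hu
  set I : ℝ → ℂ := fun q => ∫ s in Ioi q, (s : ℂ) ^ (-(1 / 2) - 1 : ℂ) * T s with hI
  have hdiff : ∀ p q : ℝ, 0 < p → p ≤ q → u q - I q = u p - I p := by
    intro p q hp hpq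
    have hd : ∀ s ∈ uIcc p q, HasDerivAt u (-((s : ℂ) ^ (-(1 / 2) - 1 : ℂ) * T s)) s := by
      intro s hs
      rw [uIcc_of_le hpq] at hs
      have hs0 : 0 < s := hp.trans_le hs.1
      have hs1 : (s : ℂ) ≠ 0 := by exact_mod_cast hs0.ne'
      have h1 := ((hasDerivAt_ofReal_cpow (a := -(1 / 2)) hs0).mul (h.hasDerivAt s hs0)).sub
        (((Real.hasDerivAt_log hs0.ne').ofReal_comp).const_mul K)
      refine h1.congr_deriv ?_
      have h2 := hK s hs0
      have h3 : (s : ℂ) ^ (-(1 / 2) : ℂ) = (s : ℂ) ^ (-(1 / 2) - 1 : ℂ) * s := by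
        rw [show (-(1 / 2) : ℂ) = (-(1 / 2) - 1) + 1 by ring, Complex.cpow_add _ _ hs1,
          Complex.cpow_one]
        ring_nf
      have h4 : ((s⁻¹ : ℝ) : ℂ) = (s : ℂ) ^ (-(1 / 2) - 1 : ℂ) * (s : ℂ) ^ (1 / 2 : ℂ) := by
        rw [← Complex.cpow_add _ _ hs1, show (-(1 / 2) - 1 + 1 / 2 : ℂ) = -1 by ring,
          Complex.cpow_neg_one, Complex.ofReal_inv]
      rw [h3, h4]
      linear_combination ((s : ℂ) ^ (-(1 / 2) - 1 : ℂ)) * h2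
    have hc : ContinuousOn (fun s : ℝ => -((s : ℂ) ^ (-(1 / 2) - 1 : ℂ) * T s)) (uIcc p q) := by
      rw [uIcc_of_le hpq]
      exact ((continuousOn_ofReal_cpow _).mul hTc).neg.mono fun s hs => hp.trans_le hs.1
    have h1 := intervalIntegral.integral_eq_sub_of_hasDerivAt hd hc.intervalIntegrable
    rw [intervalIntegral.integral_neg] at h1
    have h2 := intervalIntegral.integral_interval_add_Ioi (hTi p hp) (hTi q (hp.trans_le hpq))
    simp only [hI]
    linear_combination -h1 - h2
  refine ⟨K, u 1 - I 1, hardyL2 ha (hardyL2 ha γ), ?_, ?_⟩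
  · have h1 := norm_hardyL2_le ha γ
    have h2 := norm_hardyL2_le ha (hardyL2 ha γ)
    norm_num at h1 h2
    exact h2.trans h1
  · filter_upwards [coeFn_hardyL2 ha (hardyL2 ha γ), ae_restrict_mem measurableSet_Ioi] with q h1 hq
    have hq0 : 0 < q := hq
    have h3 : u q - I q = u 1 - I 1 := by
      rcases le_total q 1 with h4 | h4
      · exact (hdiff q 1 hq h4).symm
      · exact hdiff 1 q one_pos h4
    have h4 : hardyTail (1 / 2) (hardyL2 ha γ) q = (q : ℂ) ^ (1 / 2 : ℂ) * I q := by
      rw [hardyTail]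
      congr 1
      refine integral_congr_ae ?_
      filter_upwards [ae_restrict_of_ae_restrict_of_subset (Ioi_subset_Ioi hq0.le)
        (coeFn_hardyL2 ha γ)] with s hs
      rw [hs]
    have hq1 : (q : ℂ) ≠ 0 := by exact_mod_cast hq0.ne'
    have h5 : (q : ℂ) ^ (1 / 2 : ℂ) * (q : ℂ) ^ (-(1 / 2) : ℂ) = 1 := by
      rw [← Complex.cpow_add _ _ hq1, add_neg_cancel, Complex.cpow_zero]
    rw [h1, h4, eulerFst, if_pos rfl, eulerSnd, add_zero]
    simp only [hu] at h3
    linear_combination (-Φ q) * h5 + ((q : ℂ) ^ (1 / 2 : ℂ)) * h3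

theorem exists_euler_bound {m : ℂ} (hm : |m.re| < 1) : ∃ C : ℝ, 0 ≤ C ∧
    ∀ (φ γ : L2Half) (Φ Φ₁ : ℝ → ℂ), IsSecondPrimitive φ Φ Φ₁ →
    (∀ᵐ q : ℝ ∂halfLine, (q : ℂ) ^ 2 * φ q + (1 / 4 - m ^ 2) * Φ q = γ q) →
    ∃ c₁ c₂ : ℂ, ∃ ρ : L2Half, ‖ρ‖ ≤ C * ‖γ‖ ∧
      ∀ᵐ q ∂halfLine, Φ q = c₁ * eulerFst m q + c₂ * eulerSnd m q + ρ q := by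
  by_cases h0 : m = 0
  · subst h0
    refine ⟨1, zero_le_one, fun φ γ Φ Φ₁ h hode => ?_⟩
    rw [one_mul]
    exact euler_of_eq_zero h (hode.mono fun q hq => by rw [← hq]; ring)
  · have : 0 < 1 - |m.re| := by linarith
    exact ⟨‖m‖⁻¹ * (1 - |m.re|)⁻¹, by positivity, fun φ γ Φ Φ₁ h hode =>
      euler_of_ne_zero hm h0 h hode⟩

/-! ### Homogeneous Euler solutions are not square integrable at infinity -/

theorem eq_zero_of_memLp_cpow {b c : ℂ} (hb : -1 / 2 < b.re) {Λ : ℝ} (hΛ : 0 < Λ)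
    (h : MemLp (fun q : ℝ => c * (q : ℂ) ^ b) 2 (volume.restrict (Ioi Λ))) : c = 0 := by
  by_contra hc
  have h1 := (memLp_two_iff_integrable_sq_norm h.1).1 h
  have h2 : IntegrableOn (fun q : ℝ => q ^ (2 * b.re)) (Ioi Λ) := by
    have h3 := h1.const_mul (‖c‖ ^ 2)⁻¹
    refine h3.congr ?_
    filter_upwards [ae_restrict_mem measurableSet_Ioi] with q hq
    have hq0 : 0 < q := hΛ.trans hq
    have : ‖c‖ ≠ 0 := norm_ne_zero_iff.2 hc
    rw [norm_mul, Complex.norm_cpow_eq_rpow_re_of_pos hq0, mul_pow, ← Real.rpow_natCast (q ^ _),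
      ← Real.rpow_mul hq0.le, inv_mul_cancel_left₀ (by positivity)]
    congr 1
    push_cast
    ring
  rw [integrableOn_Ioi_rpow_iff hΛ] at h2
  linarith

theorem memLp_comp_mul_Ioi {h : ℝ → ℂ} {Λ l : ℝ} (hl : 1 ≤ l) (hΛ : 0 < Λ)
    (hh : MemLp h 2 (volume.restrict (Ioi Λ))) :
    MemLp (fun q => h (l * q)) 2 (volume.restrict (Ioi Λ)) := by
  have hl0 : 0 < l := by linarith
  have hsub : Ioi (l * Λ) ⊆ Ioi Λ := Ioi_subset_Ioi (by nlinarith)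
  have h1 : MemLp h 2 (volume.restrict (Ioi (l * Λ))) :=
    hh.mono_measure (Measure.restrict_mono hsub le_rfl)
  have hmap : (volume.restrict (Ioi Λ)).map (fun q => l * q) =
      ENNReal.ofReal l⁻¹ • volume.restrict (Ioi (l * Λ)) := by
    have e : Ioi Λ = (fun q => l * q) ⁻¹' Ioi (l * Λ) := by
      ext q
      exact (mul_lt_mul_iff_right₀ hl0).symm
    rw [e, ← Measure.restrict_map (by fun_prop) measurableSet_Ioi,
      Real.map_volume_mul_left hl0.ne', Measure.restrict_smul, abs_of_pos (inv_pos.2 hl0)]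
  have h2 : MemLp h 2 ((volume.restrict (Ioi Λ)).map (fun q => l * q)) := by
    rw [hmap]
    exact h1.smul_measure ENNReal.ofReal_ne_top
  exact h2.comp_of_map (by fun_prop)

theorem eulerFst_mul {m : ℂ} (h0 : m ≠ 0) {l q : ℝ} (hl : 0 < l) (hq : 0 < q) :
    eulerFst m (l * q) = (l : ℂ) ^ (1 / 2 - m) * eulerFst m q := by
  simp only [eulerFst, if_neg h0]
  rw [Complex.ofReal_mul, Complex.mul_cpow_ofReal_nonneg hl.le hq.le]

theorem eulerSnd_mul (m : ℂ) {l q : ℝ} (hl : 0 < l) (hq : 0 < q) :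
    eulerSnd m (l * q) = (l : ℂ) ^ (1 / 2 + m) * eulerSnd m q := by
  simp only [eulerSnd]
  rw [Complex.ofReal_mul, Complex.mul_cpow_ofReal_nonneg hl.le hq.le]

theorem eulerFst_zero_mul {l q : ℝ} (hl : 0 < l) (hq : 0 < q) :
    eulerFst 0 (l * q) = (l : ℂ) ^ (1 / 2 : ℂ) * (eulerFst 0 q + Real.log l * eulerSnd 0 q) := by
  simp only [eulerFst, if_pos, eulerSnd, add_zero]
  rw [Complex.ofReal_mul, Complex.mul_cpow_ofReal_nonneg hl.le hq.le, Real.log_mul hl.ne' hq.ne']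
  push_cast
  ring

/-- For imaginary `m` both solutions have the same modulus, so comparing growth does not separate
them. Dilations do: `L²` near infinity is stable under `q ↦ l q` with `l ≥ 1`, and a combination of
a function with its dilate eliminates one solution, leaving a single power to be excluded. -/
theorem eq_zero_of_memLp_euler {m : ℂ} (hm : |m.re| < 1) {Λ : ℝ} (hΛ : 0 < Λ) {c₁ c₂ : ℂ}
    (h : MemLp (fun q => c₁ * eulerFst m q + c₂ * eulerSnd m q) 2 (volume.restrict (Ioi Λ))) :
    c₁ = 0 ∧ c₂ = 0 := by
  have hm' := abs_lt.1 hm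
  have hb : -1 / 2 < (1 / 2 + m).re := by
    simp only [Complex.add_re, Complex.div_ofNat_re, Complex.one_re]; linarith
  have ha : -1 / 2 < (1 / 2 - m).re := by
    simp only [Complex.sub_re, Complex.div_ofNat_re, Complex.one_re]; linarith
  by_cases h0 : m = 0
  · subst h0
    -- Dilating by `e` adds one to the logarithm, so this difference is a pure multiple of
    -- `q^(1/2)`.
    have h1 := (memLp_comp_mul_Ioi (l := Real.exp 1) (by simp) hΛ h).sub
      (h.const_mul (((Real.exp 1 : ℝ) : ℂ) ^ (1 / 2 : ℂ)))
    have h2 : MemLp (fun q : ℝ => (c₁ * ((Real.exp 1 : ℝ) : ℂ) ^ (1 / 2 : ℂ)) *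
        (q : ℂ) ^ (1 / 2 + 0 : ℂ)) 2 (volume.restrict (Ioi Λ)) := by
      refine h1.ae_eq ?_
      filter_upwards [ae_restrict_mem measurableSet_Ioi] with q hq
      have hq0 : 0 < q := hΛ.trans hq
      simp only [Pi.sub_apply]
      rw [eulerFst_zero_mul (Real.exp_pos 1) hq0, eulerSnd_mul 0 (Real.exp_pos 1) hq0,
        Real.log_exp, eulerSnd, Complex.ofReal_one, add_zero]
      ring
    have h3 := eq_zero_of_memLp_cpow hb hΛ h2
    have h4 : c₁ = 0 := by
      refine (mul_eq_zero.1 h3).resolve_right ?_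
      intro h4
      rw [Complex.cpow_eq_zero_iff] at h4
      exact (Real.exp_pos 1).ne' (Complex.ofReal_eq_zero.1 h4.1)
    refine ⟨h4, eq_zero_of_memLp_cpow hb hΛ (h.ae_eq (Eventually.of_forall fun q => ?_))⟩
    simp [h4, eulerSnd]
  -- The choice `l = exp(1/‖m‖)` guarantees `l^(2m) ≠ 1`: equality would make `m/‖m‖`, of modulus
  -- one, an integer multiple of `πi`.
  · set t : ℝ := ‖m‖⁻¹ with ht
    have hmpos : 0 < ‖m‖ := norm_pos_iff.2 h0
    have ht0 : 0 < t := inv_pos.2 hmpos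
    set l := Real.exp t with hl
    have hl0 : 0 < l := Real.exp_pos t
    have hl1 : 1 ≤ l := Real.one_le_exp ht0.le
    have h1 := (memLp_comp_mul_Ioi hl1 hΛ h).sub (h.const_mul ((l : ℂ) ^ (1 / 2 - m)))
    have h2 : MemLp (fun q : ℝ => (c₂ * ((l : ℂ) ^ (1 / 2 + m) - (l : ℂ) ^ (1 / 2 - m))) *
        (q : ℂ) ^ (1 / 2 + m)) 2 (volume.restrict (Ioi Λ)) := by
      refine h1.ae_eq ?_
      filter_upwards [ae_restrict_mem measurableSet_Ioi] with q hq
      have hq0 : 0 < q := hΛ.trans hq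
      simp only [Pi.sub_apply]
      rw [eulerFst_mul h0 hl0 hq0, eulerSnd_mul m hl0 hq0, eulerSnd]
      ring
    have hne : (l : ℂ) ^ (1 / 2 + m) - (l : ℂ) ^ (1 / 2 - m) ≠ 0 := by
      intro h5
      have hlc : (l : ℂ) ≠ 0 := by exact_mod_cast hl0.ne'
      have hlog : Complex.log (l : ℂ) = t := by
        rw [← Complex.ofReal_log hl0.le, hl, Real.log_exp]
      rw [Complex.cpow_def_of_ne_zero hlc, Complex.cpow_def_of_ne_zero hlc, hlog, sub_eq_zero,
        Complex.exp_eq_exp_iff_exists_int] at h5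
      obtain ⟨n, hn⟩ := h5
      have h6 : (t : ℂ) * m = n * (Real.pi * Complex.I) := by linear_combination hn / 2
      have h7 := congrArg norm h6
      rw [norm_mul, Complex.norm_real, Real.norm_of_nonneg ht0.le, ht, inv_mul_cancel₀ hmpos.ne',
        norm_mul, norm_mul, Complex.norm_I, Complex.norm_real, Real.norm_of_nonneg Real.pi_pos.le,
        mul_one, Complex.norm_intCast] at h7
      have h8 : n ≠ 0 := by
        rintro rfl
        simp at h7
      have h9 : (1 : ℝ) ≤ |(n : ℝ)| := by exact_mod_cast Int.one_le_abs h8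
      nlinarith [Real.pi_gt_three]
    have h3 : c₂ = 0 := (mul_eq_zero.1 (eq_zero_of_memLp_cpow hb hΛ h2)).resolve_right hne
    refine ⟨eq_zero_of_memLp_cpow ha hΛ (h.ae_eq (Eventually.of_forall fun q => ?_)), h3⟩
    simp [h3, eulerFst, h0]

/-! ### Iterated primitives from the origin -/

/-- The second primitive `∫₀^q (q - p) φ(p) dp`. -/
noncomputable def originPrimitive (φ : ℝ → ℂ) (q : ℝ) : ℂ := ∫ p in (0 : ℝ)..q, ((q : ℂ) - p) * φ p

theorem originPrimitive_eq (φ : L2Half) {q : ℝ} (hq : 0 ≤ q) :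
    originPrimitive φ q = ∫ s in (0 : ℝ)..q, ∫ p in (0 : ℝ)..s, φ p := by
  have hi : ∀ s, 0 ≤ s → ∀ t, 0 ≤ t → IntervalIntegrable φ volume s t := fun s hs t ht =>
    intervalIntegrable_of_L2 φ hs ht
  have h := integral_mul_eq_of_primitive hq (g := fun s => (s : ℂ)) (g' := fun _ => 1) (φ := φ)
    (Φ := fun s => ∫ p in (0 : ℝ)..s, φ p) (fun s _ => Complex.ofRealCLM.hasDerivAt)
    continuousOn_const (integrableOn_Ioc_of_L2 φ le_rfl) (fun s hs => by
      rw [intervalIntegral.integral_interval_sub_left (hi 0 le_rfl q hq) (hi 0 le_rfl s hs.1)])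
  have e : originPrimitive φ q = q * (∫ p in (0 : ℝ)..q, φ p) - ∫ p in (0 : ℝ)..q, p * φ p := by
    rw [originPrimitive, ← intervalIntegral.integral_const_mul, ← intervalIntegral.integral_sub]
    · congr 1 with p
      ring
    · exact (hi 0 le_rfl q hq).const_mul _
    · exact (hi 0 le_rfl q hq).continuousOn_mul (by fun_prop)
  rw [e, h]
  simp

theorem isSecondPrimitive_originPrimitive (φ : L2Half) :
    IsSecondPrimitive φ (originPrimitive φ) (fun q => ∫ p in (0 : ℝ)..q, φ p) := by
  have hi : ∀ s, 0 ≤ s → ∀ t, 0 ≤ t → IntervalIntegrable φ volume s t := fun s hs t ht =>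
    intervalIntegrable_of_L2 φ hs ht
  refine ⟨fun q hq => ?_, fun p q hp hq => ?_⟩
  · have hc : ContinuousOn (fun q => ∫ p in (0 : ℝ)..q, φ p) (Icc 0 (q + 1)) := by
      have := intervalIntegral.continuousOn_primitive_interval' (hi 0 le_rfl (q + 1) (by linarith))
        left_mem_uIcc
      rwa [uIcc_of_le (by linarith)] at this
    have hca : ContinuousAt (fun q => ∫ p in (0 : ℝ)..q, φ p) q :=
      hc.continuousAt (Icc_mem_nhds hq (by linarith))
    have hd := intervalIntegral.integral_hasDerivAt_right
      (f := fun q => ∫ p in (0 : ℝ)..q, φ p) (a := 0) (b := q)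
      ((hc.mono (by rw [uIcc_of_le hq.le]; exact Icc_subset_Icc_right (by linarith))
        ).intervalIntegrable)
      ((hc.mono Ioo_subset_Icc_self).stronglyMeasurableAtFilter isOpen_Ioo q
        ⟨hq, by linarith⟩) hca
    refine hd.congr_of_eventuallyEq ?_
    filter_upwards [lt_mem_nhds hq] with x hx
    exact originPrimitive_eq φ (le_of_lt hx)
  · exact intervalIntegral.integral_interval_sub_left (hi 0 le_rfl q hq.le) (hi 0 le_rfl p hp.le)

/-- Second primitives are unique only up to affine functions; this freedom absorbs the terms `c
p^j`. -/
theorem IsSecondPrimitive.add_mul_pow {φ Φ Φ₁ : ℝ → ℂ} (h : IsSecondPrimitive φ Φ Φ₁) {j : ℕ}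
    (hj : j ≤ 1) (c : ℂ) :
    IsSecondPrimitive φ (fun q => Φ q + c * (q : ℂ) ^ j) (fun q => Φ₁ q + c * j) := by
  refine ⟨fun q hq => (h.hasDerivAt q hq).add ?_, fun p q hp hq => ?_⟩
  · have hd : HasDerivAt (fun q : ℝ => (q : ℂ)) 1 q := Complex.ofRealCLM.hasDerivAt
    interval_cases j
    · simpa using hasDerivAt_const q c
    · simpa using hd.const_mul c
  · rw [← h.sub_eq p q hp hq]
    ring

/-- From `‖φ‖ ≤ 1 + ‖φ‖²` pointwise. Linear growth is all that the later integrability arguments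
use. -/
theorem integral_norm_le (φ : L2Half) {q : ℝ} (hq : 0 ≤ q) :
    ∫ p in Ioc 0 q, ‖φ p‖ ≤ q + ‖φ‖ ^ 2 := by
  have hsub : Ioc 0 q ⊆ Ioi (0 : ℝ) := fun x hx => hx.1
  have h1 : Integrable (fun p => ‖φ p‖ ^ 2) halfLine := (Lp.memLp φ).integrable_norm_pow (by norm_num)
  have h2 : IntegrableOn (fun p => ‖φ p‖ ^ 2) (Ioc 0 q) :=
    h1.mono_measure (Measure.restrict_mono hsub le_rfl)
  have h3 : IntegrableOn (fun _ : ℝ => (1 : ℝ)) (Ioc 0 q) := by simp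
  calc ∫ p in Ioc 0 q, ‖φ p‖ ≤ ∫ p in Ioc 0 q, (1 + ‖φ p‖ ^ 2) := by
        refine integral_mono (integrableOn_Ioc_of_L2 φ le_rfl).norm (h3.add h2) fun p => ?_
        nlinarith [sq_nonneg (‖φ p‖ - 1)]
    _ = q + ∫ p in Ioc 0 q, ‖φ p‖ ^ 2 := by
        rw [integral_add h3 h2]
        simp [hq]
    _ ≤ q + ‖φ‖ ^ 2 := by
        rw [sq_norm_eq_integral]
        gcongr
        · exact Eventually.of_forall fun p => by positivity
        · exact Measure.restrict_mono hsub le_rfl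

theorem norm_originPrimitive_le (φ : L2Half) {q : ℝ} (hq : 0 ≤ q) :
    ‖originPrimitive φ q‖ ≤ q * (q + ‖φ‖ ^ 2) := by
  rw [originPrimitive, intervalIntegral.integral_of_le hq]
  refine (norm_integral_le_integral_norm _).trans ?_
  refine le_trans ?_ (mul_le_mul_of_nonneg_left (integral_norm_le φ hq) hq)
  rw [← integral_const_mul]
  refine integral_mono_of_nonneg (Eventually.of_forall fun p => norm_nonneg _)
    ((integrableOn_Ioc_of_L2 φ le_rfl).norm.const_mul q) ?_
  filter_upwards [ae_restrict_mem measurableSet_Ioc] with p hp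
  rw [norm_mul]
  gcongr
  rw [← Complex.ofReal_sub, Complex.norm_real, Real.norm_eq_abs, abs_of_nonneg (by linarith [hp.2])]
  linarith [hp.1]

theorem continuousOn_originPrimitive (φ : L2Half) : ContinuousOn (originPrimitive φ) (Ioi 0) :=
  fun q hq => ((isSecondPrimitive_originPrimitive φ).hasDerivAt q hq).continuousAt.continuousWithinAt

/-! ### Kernels with a second order jump on the diagonal -/

/-- `k(p,q) = β(p) q^j - (q-p)₊ = β(q) p^j - (p-q)₊`, as for the Dirichlet and Neumann kernels. -/
structure IsParityKernel (j : ℕ) (β : ℝ → ℝ) (k : ℝ → ℝ → ℝ) : Prop where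
  index_le : j ≤ 1
  continuous : Continuous β
  bound : ∀ q, 0 ≤ q → |β q| ≤ 1 + q
  eq_upper : ∀ p q, k p q = β p * q ^ j - max (q - p) 0
  eq_lower : ∀ p q, k p q = β q * p ^ j - max (p - q) 0
  eq_or_eq : k = kernelD ∨ k = kernelN

theorem isParityKernel_kernelD : IsParityKernel 1 (fun _ => 1) kernelD where
  index_le := le_rfl
  continuous := continuous_const
  bound q hq := by simpa using hq
  eq_upper p q := by
    rw [kernelD]
    rcases le_total p q with h | h
    · rw [min_eq_left h, max_eq_left (by linarith)]; ring
    · rw [min_eq_right h, max_eq_right (by linarith)]; ring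
  eq_lower p q := by
    rw [kernelD]
    rcases le_total p q with h | h
    · rw [min_eq_left h, max_eq_right (by linarith)]; ring
    · rw [min_eq_right h, max_eq_left (by linarith)]; ring
  eq_or_eq := Or.inl rfl

theorem isParityKernel_kernelN : IsParityKernel 0 (fun p => -p) kernelN where
  index_le := zero_le_one
  continuous := continuous_neg
  bound q hq := by rw [abs_neg, abs_of_nonneg hq]; linarith
  eq_upper p q := by
    rw [kernelN]
    rcases le_total p q with h | h
    · rw [max_eq_right h, max_eq_left (by linarith)]; ring
    · rw [max_eq_left h, max_eq_right (by linarith)]; ring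
  eq_lower p q := by
    rw [kernelN]
    rcases le_total p q with h | h
    · rw [max_eq_right h, max_eq_right (by linarith)]; ring
    · rw [max_eq_left h, max_eq_left (by linarith)]; ring
  eq_or_eq := Or.inr rfl

/-- `u(p) = p² ψ(p)`. -/
def IsSqMul (ψ u : L2Half) : Prop := ∀ᵐ p : ℝ ∂halfLine, u p = (p : ℂ) ^ 2 * ψ p

theorem IsSqMul.add {ψ u ψ' u' : L2Half} (h : IsSqMul ψ u) (h' : IsSqMul ψ' u') :
    IsSqMul (ψ + ψ') (u + u') := by
  rw [IsSqMul] at *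
  filter_upwards [h, h', Lp.coeFn_add ψ ψ', Lp.coeFn_add u u'] with p h1 h2 h3 h4
  rw [h3, h4, Pi.add_apply, Pi.add_apply, h1, h2]
  ring

theorem IsSqMul.smul {ψ u : L2Half} (h : IsSqMul ψ u) (c : ℂ) : IsSqMul (c • ψ) (c • u) := by
  rw [IsSqMul] at *
  filter_upwards [h, Lp.coeFn_smul c ψ, Lp.coeFn_smul c u] with p h1 h3 h4
  rw [h3, h4, Pi.smul_apply, Pi.smul_apply, h1, smul_eq_mul, smul_eq_mul]
  ring

/-- `p^n / (1 + p²)` as an element of `L²(ℝ₊)`, for `n ≤ 1`. -/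
theorem memLp_momentWeight {n : ℕ} (hn : n ≤ 1) :
    MemLp (fun p : ℝ => ((p ^ n / (1 + p ^ 2) : ℝ) : ℂ)) 2 halfLine := by
  refine MemLp.ofReal (K := ℂ) (f := fun p : ℝ => p ^ n / (1 + p ^ 2)) ?_
  have hm : Continuous (fun p : ℝ => p ^ n / (1 + p ^ 2)) :=
    (continuous_pow n).div (by fun_prop) (fun p => by positivity)
  rw [memLp_two_iff_integrable_sq hm.aestronglyMeasurable]
  refine integrable_inv_one_add_sq.restrict.mono' (hm.pow 2).aestronglyMeasurable
    (Eventually.of_forall fun p => ?_)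
  rw [Real.norm_eq_abs, abs_of_nonneg (by positivity), div_pow, ← one_div,
    div_le_div_iff₀ (by positivity) (by positivity)]
  interval_cases n <;> nlinarith [sq_nonneg p, sq_nonneg (p ^ 2)]

/-- If `u = p² ψ`, then `ψ p^n = (ψ + u) · p^n/(1+p²)`. Thus moments of order at most one are `L²`
pairings, continuous in the graph norm of multiplication by `p²`. -/
noncomputable def momentWeight {n : ℕ} (hn : n ≤ 1) : L2Half := (memLp_momentWeight hn).toLp _

theorem IsSqMul.mul_pow_ae {ψ u : L2Half} (h : IsSqMul ψ u) {n : ℕ} (hn : n ≤ 1) :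
    ∀ᵐ p : ℝ ∂halfLine, ψ p * (p : ℂ) ^ n = (ψ + u) p * momentWeight hn p := by
  rw [IsSqMul] at h
  filter_upwards [h, Lp.coeFn_add ψ u, (memLp_momentWeight hn).coeFn_toLp] with p h1 h2 h3
  have h4 : ((1 + p ^ 2 : ℝ) : ℂ) ≠ 0 := by
    have : (0 : ℝ) < 1 + p ^ 2 := by positivity
    exact_mod_cast this.ne'
  push_cast at h4
  rw [momentWeight, h3, h2, Pi.add_apply, h1]
  push_cast
  field_simp

theorem IsSqMul.integrable_mul_pow {ψ u : L2Half} (h : IsSqMul ψ u) {n : ℕ} (hn : n ≤ 1) :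
    Integrable (fun p : ℝ => ψ p * (p : ℂ) ^ n) halfLine :=
  (integrable_mul_L2 (ψ + u) (momentWeight hn)).congr
    ((h.mul_pow_ae hn).mono fun _ hp => hp.symm)

theorem IsSqMul.integral_mul_pow {ψ u : L2Half} (h : IsSqMul ψ u) {n : ℕ} (hn : n ≤ 1) :
    ∫ p, ψ p * (p : ℂ) ^ n ∂halfLine = ∫ p, (ψ + u) p * momentWeight hn p ∂halfLine :=
  integral_congr_ae (h.mul_pow_ae hn)

theorem IsSqMul.integrable_mul_le {ψ u : L2Half} (h : IsSqMul ψ u) {f : ℝ → ℝ}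
    (hf : Measurable f) {C : ℝ} (hfC : ∀ q, 0 < q → |f q| ≤ C * (1 + q)) :
    Integrable (fun q => (f q : ℂ) * ψ q) halfLine := by
  have h1 := (h.integrable_mul_pow (n := 0) (by norm_num)).norm
  have h2 := (h.integrable_mul_pow (n := 1) le_rfl).norm
  refine ((h1.add h2).const_mul C).mono' ?_ ?_
  · exact (Complex.measurable_ofReal.comp hf).aestronglyMeasurable.mul
      (Lp.aestronglyMeasurable ψ)
  · filter_upwards [ae_restrict_mem measurableSet_Ioi] with q hq
    have hq0 : 0 < q := hq
    have := hfC q hq0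
    simp only [Pi.add_apply, pow_zero, mul_one, pow_one, norm_mul, Complex.norm_real,
      Real.norm_eq_abs, abs_of_pos hq0]
    nlinarith [norm_nonneg (ψ q), mul_le_mul_of_nonneg_right this (norm_nonneg (ψ q))]

/-- `∫₀^∞ k(p,q) ψ(q) dq`. -/
noncomputable def kernelInt (k : ℝ → ℝ → ℝ) (ψ : ℝ → ℂ) (p : ℝ) : ℂ :=
  ∫ q, (k p q : ℂ) * ψ q ∂halfLine

theorem IsSqMul.kernelInt_eq_lower {ψ u : L2Half} (h : IsSqMul ψ u) {j : ℕ} {β : ℝ → ℝ}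
    {k : ℝ → ℝ → ℝ} (hk : IsParityKernel j β k) {p : ℝ} (hp : 0 < p) :
    kernelInt k ψ p = (∫ q, (β q : ℂ) * ψ q ∂halfLine) * (p : ℂ) ^ j - originPrimitive ψ p := by
  have h1 : Integrable (fun q => (β q : ℂ) * ψ q) halfLine :=
    h.integrable_mul_le hk.continuous.measurable (C := 1)
      (fun q hq => by simpa using hk.bound q hq.le)
  have h2 : Integrable (fun q => ((max (p - q) 0 : ℝ) : ℂ) * ψ q) halfLine := by
    refine h.integrable_mul_le (f := fun q => max (p - q) 0) (by fun_prop) (C := p)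
      (fun q hq => ?_)
    rw [abs_of_nonneg (le_max_right _ _)]
    exact max_le (by nlinarith) (by positivity)
  have e : originPrimitive ψ p = ∫ q, ((max (p - q) 0 : ℝ) : ℂ) * ψ q ∂halfLine := by
    rw [originPrimitive, intervalIntegral.integral_of_le hp.le]
    rw [← integral_indicator measurableSet_Ioc, ← integral_indicator measurableSet_Ioi]
    refine integral_congr_ae (Eventually.of_forall fun q => ?_)
    by_cases hq : 0 < q
    · by_cases hqp : q ≤ p
      · rw [indicator_of_mem (show q ∈ Ioc 0 p from ⟨hq, hqp⟩), indicator_of_mem (by exact hq),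
          max_eq_left (by linarith)]
        push_cast; rfl
      · rw [indicator_of_notMem (fun h : q ∈ Ioc 0 p => hqp h.2), indicator_of_mem (by exact hq),
          max_eq_right (by linarith)]
        simp
    · rw [indicator_of_notMem (fun h : q ∈ Ioc 0 p => hq h.1), indicator_of_notMem (by exact hq)]
  rw [e, ← integral_mul_const, ← integral_sub (h1.mul_const _) h2, kernelInt]
  refine integral_congr_ae (Eventually.of_forall fun q => ?_)
  simp only [hk.eq_lower p q]
  push_cast
  ring

/-- The vanishing moment removes the term `β(p) ∫ ψ q^j`. Only values of `ψ` beyond `p` remain,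
which is the form that the Hardy inequality controls. -/
theorem IsSqMul.kernelInt_eq_upper {ψ u : L2Half} (h : IsSqMul ψ u) {j : ℕ} {β : ℝ → ℝ}
    {k : ℝ → ℝ → ℝ} (hk : IsParityKernel j β k) (h0 : ∫ q, ψ q * (q : ℂ) ^ j ∂halfLine = 0)
    {p : ℝ} (hp : 0 < p) :
    kernelInt k ψ p = -∫ q in Ioi p, ((q : ℂ) - p) * ψ q := by
  have h2 : Integrable (fun q => ((max (q - p) 0 : ℝ) : ℂ) * ψ q) halfLine := by
    refine h.integrable_mul_le (f := fun q => max (q - p) 0) (by fun_prop) (C := 1)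
      (fun q hq => ?_)
    rw [abs_of_nonneg (le_max_right _ _)]
    exact max_le (by linarith) (by linarith)
  have e : ∫ q in Ioi p, ((q : ℂ) - p) * ψ q =
      ∫ q, ((max (q - p) 0 : ℝ) : ℂ) * ψ q ∂halfLine := by
    rw [← integral_indicator measurableSet_Ioi, ← integral_indicator measurableSet_Ioi]
    refine integral_congr_ae (Eventually.of_forall fun q => ?_)
    by_cases hq : p < q
    · rw [indicator_of_mem (by exact hq), indicator_of_mem (by exact hp.trans hq),
        max_eq_left (by linarith)]
      push_cast; rfl
    · rw [indicator_of_notMem (by exact hq)]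
      by_cases hq0 : 0 < q
      · rw [indicator_of_mem (by exact hq0), max_eq_right (by linarith)]
        simp
      · rw [indicator_of_notMem (by exact hq0)]
  have e2 : kernelInt k ψ p = (β p : ℂ) * (∫ q, ψ q * (q : ℂ) ^ j ∂halfLine) -
      ∫ q, ((max (q - p) 0 : ℝ) : ℂ) * ψ q ∂halfLine := by
    rw [← integral_const_mul, ← integral_sub ((h.integrable_mul_pow hk.index_le).const_mul _) h2,
      kernelInt]
    refine integral_congr_ae (Eventually.of_forall fun q => ?_)
    simp only [hk.eq_upper p q]
    push_cast
    ring
  rw [e2, h0, e]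
  ring

theorem IsSqMul.aestronglyMeasurable_kernelInt {ψ u : L2Half} (h : IsSqMul ψ u) {j : ℕ} {β : ℝ → ℝ}
    {k : ℝ → ℝ → ℝ} (hk : IsParityKernel j β k) :
    AEStronglyMeasurable (kernelInt k ψ) halfLine := by
  refine (ContinuousOn.congr ?_ fun p hp => h.kernelInt_eq_lower hk hp).aestronglyMeasurable
    measurableSet_Ioi
  exact ((by fun_prop : Continuous fun p : ℝ =>
    (∫ q, (β q : ℂ) * ψ q ∂halfLine) * (p : ℂ) ^ j).continuousOn).sub
    (continuousOn_originPrimitive ψ)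

/-- For `q > p` one has `(q-p) |ψ(q)| ≤ q⁻¹ |u(q)|`, and Hardy with `r = 0` has constant `2`. So on
functions of vanishing moment the kernel is bounded relative to `p²`. -/
theorem IsSqMul.eLpNorm_kernelInt_le {ψ u : L2Half} (h : IsSqMul ψ u) {j : ℕ} {β : ℝ → ℝ}
    {k : ℝ → ℝ → ℝ} (hk : IsParityKernel j β k) (h0 : ∫ q, ψ q * (q : ℂ) ^ j ∂halfLine = 0) :
    eLpNorm (kernelInt k ψ) 2 halfLine ≤ 2 * eLpNorm u 2 halfLine := by
  have h1 := eLpNorm_le_of_le_hardy (r := 0) (by norm_num) u (w := kernelInt k ψ) ?_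
  · refine h1.trans (le_of_eq ?_)
    norm_num
  · filter_upwards [ae_restrict_mem measurableSet_Ioi] with p hp
    rw [h.kernelInt_eq_upper hk h0 hp, enorm_neg]
    refine (enorm_integral_le_lintegral_enorm _).trans ?_
    rw [Real.rpow_zero, ENNReal.ofReal_one, one_mul]
    refine lintegral_mono_ae ?_
    have hp0 : 0 < p := hp
    filter_upwards [ae_restrict_of_ae_restrict_of_subset (Ioi_subset_Ioi hp0.le) h,
      ae_restrict_mem measurableSet_Ioi] with s hs hs'
    have hs0 : 0 < s := hp0.trans hs'
    rw [hs, ← ofReal_norm, ← ofReal_norm, ← ENNReal.ofReal_mul (by positivity)]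
    refine ENNReal.ofReal_le_ofReal ?_
    rw [norm_mul, norm_mul, norm_pow, Complex.norm_real, Real.norm_of_nonneg hs0.le,
      ← Complex.ofReal_sub, Complex.norm_real, Real.norm_of_nonneg (by linarith [mem_Ioi.1 hs']),
      show (-0 - 1 : ℝ) = -1 by norm_num, Real.rpow_neg_one, ← mul_assoc]
    gcongr
    field_simp
    linarith

theorem IsSqMul.memLp_kernelInt {ψ u : L2Half} (h : IsSqMul ψ u) {j : ℕ} {β : ℝ → ℝ}
    {k : ℝ → ℝ → ℝ} (hk : IsParityKernel j β k) (h0 : ∫ q, ψ q * (q : ℂ) ^ j ∂halfLine = 0) :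
    MemLp (kernelInt k ψ) 2 halfLine :=
  ⟨h.aestronglyMeasurable_kernelInt hk, (h.eLpNorm_kernelInt_le hk h0).trans_lt
    (ENNReal.mul_lt_top (by norm_num) (Lp.memLp u).2)⟩

/-- Up to sign, the kernel inverts the second derivative: by `kernelInt_eq_lower`, `-∫ k ψ` differs
from `originPrimitive ψ` by a multiple of `p^j`, which is affine. -/
theorem IsSqMul.isSecondPrimitive_kernelInt {ψ u : L2Half} (h : IsSqMul ψ u) {j : ℕ} {β : ℝ → ℝ}
    {k : ℝ → ℝ → ℝ} (hk : IsParityKernel j β k) :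
    ∃ Φ₁, IsSecondPrimitive ψ (fun p => -kernelInt k ψ p) Φ₁ := by
  have h1 := (isSecondPrimitive_originPrimitive ψ).add_mul_pow hk.index_le
    (-∫ q, (β q : ℂ) * ψ q ∂halfLine)
  refine ⟨_, ⟨fun q hq => (h1.hasDerivAt q hq).congr_of_eventuallyEq ?_, h1.sub_eq⟩⟩
  filter_upwards [lt_mem_nhds hq] with x hx
  rw [h.kernelInt_eq_lower hk hx]
  ring

/-! ### Truncation -/

/-- The restriction of `f` to `]0,R[`. -/
noncomputable def truncL2 (R : ℝ) (f : L2Half) : L2Half :=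
  ((Lp.memLp f).indicator (measurableSet_Iio (a := R))).toLp _

theorem coeFn_truncL2 (R : ℝ) (f : L2Half) :
    truncL2 R f =ᵐ[halfLine] (Iio R).indicator f :=
  ((Lp.memLp f).indicator measurableSet_Iio).coeFn_toLp

theorem tendsto_truncL2 (f : L2Half) :
    Tendsto (fun n : ℕ => truncL2 n f) atTop (𝓝 f) := by
  rw [tendsto_iff_norm_sub_tendsto_zero]
  have h : Tendsto (fun n : ℕ => ‖truncL2 n f - f‖ ^ 2) atTop (𝓝 0) := by
    simp_rw [sq_norm_eq_integral]
    have h0 : (0 : ℝ) = ∫ _, (0 : ℝ) ∂halfLine := by simp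
    rw [h0]
    refine tendsto_integral_of_dominated_convergence (fun x => ‖f x‖ ^ 2)
      (fun n => (Lp.aestronglyMeasurable _).norm.pow 2)
      ((Lp.memLp f).integrable_norm_pow (by norm_num)) (fun n => ?_) ?_
    · filter_upwards [Lp.coeFn_sub (truncL2 n f) f, coeFn_truncL2 n f] with x h1 h2
      rw [h1, Pi.sub_apply, h2, Real.norm_eq_abs, abs_of_nonneg (by positivity)]
      by_cases hx : x < n
      · rw [indicator_of_mem (by exact hx), sub_self, norm_zero]
        simp
      · rw [indicator_of_notMem (by exact hx), zero_sub, norm_neg]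
    · have h1 : ∀ᵐ x ∂halfLine, ∀ n : ℕ, (truncL2 n f - f) x = (Iio (n : ℝ)).indicator f x - f x := by
        rw [ae_all_iff]
        intro n
        filter_upwards [Lp.coeFn_sub (truncL2 n f) f, coeFn_truncL2 n f] with x h1 h2
        rw [h1, Pi.sub_apply, h2]
      filter_upwards [h1] with x hx
      refine tendsto_const_nhds.congr' ?_
      obtain ⟨N, hN⟩ := exists_nat_gt x
      filter_upwards [eventually_ge_atTop N] with n hn
      have : x < n := hN.trans_le (by exact_mod_cast hn)
      rw [hx, indicator_of_mem (by exact this), sub_self, norm_zero, zero_pow two_ne_zero]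
  have h2 := h.sqrt
  simpa using h2

theorem isRapidlyDecaying_of_ae_eq_zero {ψ : L2Half} {R : ℝ}
    (h : ∀ᵐ p ∂halfLine, R ≤ p → ψ p = 0) : IsRapidlyDecaying ψ := by
  intro n
  refine (((Lp.memLp ψ).integrable_norm_pow (p := 2) (by norm_num)).const_mul (|R| ^ n)).mono' ?_ ?_
  · exact ((Lp.aestronglyMeasurable ψ).norm.pow 2).mul (by fun_prop)
  · filter_upwards [h, ae_restrict_mem measurableSet_Ioi] with p hp hp0
    have hp0' : 0 < p := hp0
    rw [Real.norm_eq_abs, abs_of_nonneg (by positivity)]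
    by_cases hR : R ≤ p
    · rw [hp hR]
      simp
    · rw [mul_comm]
      gcongr
      exact (not_le.1 hR).le.trans (le_abs_self R)

/-- Multiplication by `p²` for elements of bounded support. -/
theorem exists_isSqMul_of_isRapidlyDecaying {ψ : L2Half} (h : IsRapidlyDecaying ψ) :
    ∃ u, IsSqMul ψ u := by
  have hm : MemLp (fun p : ℝ => (p : ℂ) ^ 2 * ψ p) 2 halfLine := by
    have hs : AEStronglyMeasurable (fun p : ℝ => (p : ℂ) ^ 2 * ψ p) halfLine :=
      AEStronglyMeasurable.mul (by fun_prop) (Lp.aestronglyMeasurable ψ)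
    rw [memLp_two_iff_integrable_sq_norm hs]
    refine (h 4).congr (Eventually.of_forall fun p => ?_)
    simp only
    rw [norm_mul, norm_pow, Complex.norm_real, Real.norm_eq_abs, sq_abs]
    ring
  exact ⟨hm.toLp _, hm.coeFn_toLp⟩

theorem IsSqMul.integrable_kernel {ψ u : L2Half} (h : IsSqMul ψ u) {k : ℝ → ℝ → ℝ}
    (hk : k = kernelD ∨ k = kernelN) (p : ℝ) : Integrable (fun q => (k p q : ℂ) * ψ q) halfLine := by
  refine h.integrable_mul_le ?_ (C := 1 + |p|) fun q hq => ?_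
  · rcases hk with rfl | rfl
    · exact measurable_const.min measurable_id
    · exact (measurable_const.max measurable_id).neg
  · have h1 : |k p q| ≤ |p| + |q| := by
      rcases hk with rfl | rfl
      · exact abs_min_le_max_abs_abs.trans (max_le_add_of_nonneg (abs_nonneg _) (abs_nonneg _))
      · rw [kernelN, abs_neg]
        exact abs_max_le_max_abs_abs.trans (max_le_add_of_nonneg (abs_nonneg _) (abs_nonneg _))
    rw [abs_of_pos hq] at h1
    nlinarith [mul_nonneg (abs_nonneg p) hq.le]

/-! ### The minimal operator on its full domain -/

/-- Multiplication by a function is a closed operator: along a subsequence of a subsequence both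
components converge almost everywhere. -/
theorem isClosed_isSqMul : IsClosed {z : L2Half × L2Half | IsSqMul z.1 z.2} := by
  refine IsSeqClosed.isClosed fun x z hx hz => ?_
  have h1 : Tendsto (fun n => (x n).1) atTop (𝓝 z.1) := (continuous_fst.tendsto z).comp hz
  obtain ⟨ns, hns, h3⟩ := (tendstoInMeasure_of_tendsto_Lp h1).exists_seq_tendsto_ae
  have h2 : Tendsto (fun n => (x (ns n)).2) atTop (𝓝 z.2) :=
    ((continuous_snd.tendsto z).comp hz).comp hns.tendsto_atTop
  obtain ⟨ms, hms, h4⟩ := (tendstoInMeasure_of_tendsto_Lp h2).exists_seq_tendsto_ae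
  have h5 : ∀ᵐ p : ℝ ∂halfLine, ∀ n, (x n).2 p = (p : ℂ) ^ 2 * (x n).1 p := ae_all_iff.2 hx
  change ∀ᵐ p : ℝ ∂halfLine, _
  filter_upwards [h3, h4, h5] with p h6 h7 h8
  refine tendsto_nhds_unique h7 ?_
  simp only [h8]
  exact (h6.comp hms.tendsto_atTop).const_mul _

/-- The pairs `(ψ, p² ψ)` in `L²(ℝ₊)` with `∫ ψ(p) p^j dp = 0`. -/
noncomputable def weightedSpace {j : ℕ} (hj : j ≤ 1) : Submodule ℂ (L2Half × L2Half) where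
  carrier := {z | IsSqMul z.1 z.2 ∧ ∫ p, (z.1 + z.2) p * momentWeight hj p ∂halfLine = 0}
  zero_mem' := by
    refine ⟨?_, ?_⟩
    · change ∀ᵐ p : ℝ ∂halfLine, _
      filter_upwards [coeFn_zero_half] with p hp
      simp only [Prod.fst_zero, Prod.snd_zero, hp, mul_zero]
    · refine integral_eq_zero_of_ae ?_
      rw [Prod.fst_zero, Prod.snd_zero, add_zero]
      filter_upwards [coeFn_zero_half] with p hp
      rw [hp, zero_mul, Pi.zero_apply]
  add_mem' := by
    rintro z z' ⟨h1, h2⟩ ⟨h3, h4⟩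
    refine ⟨h1.add h3, ?_⟩
    have e : ∫ p, ((z + z').1 + (z + z').2) p * momentWeight hj p ∂halfLine =
        ∫ p, ((z.1 + z.2) p * momentWeight hj p + (z'.1 + z'.2) p * momentWeight hj p)
          ∂halfLine := by
      refine integral_congr_ae ?_
      have e1 : (z + z').1 + (z + z').2 = (z.1 + z.2) + (z'.1 + z'.2) := by
        rw [Prod.fst_add, Prod.snd_add]; abel
      rw [e1]
      filter_upwards [Lp.coeFn_add (z.1 + z.2) (z'.1 + z'.2)] with p hp
      rw [hp, Pi.add_apply, add_mul]
    rw [e, integral_add (integrable_mul_L2 _ _) (integrable_mul_L2 _ _), h2, h4, add_zero]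
  smul_mem' := by
    rintro c z ⟨h1, h2⟩
    refine ⟨h1.smul c, ?_⟩
    have e : ∫ p, ((c • z).1 + (c • z).2) p * momentWeight hj p ∂halfLine =
        ∫ p, c * ((z.1 + z.2) p * momentWeight hj p) ∂halfLine := by
      refine integral_congr_ae ?_
      rw [Prod.smul_fst, Prod.smul_snd, ← smul_add]
      filter_upwards [Lp.coeFn_smul c (z.1 + z.2)] with p hp
      rw [hp, Pi.smul_apply, smul_eq_mul, mul_assoc]
    rw [e, integral_const_mul, h2, mul_zero]

theorem mem_weightedSpace {j : ℕ} (hj : j ≤ 1) {z : L2Half × L2Half} :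
    z ∈ weightedSpace hj ↔ IsSqMul z.1 z.2 ∧ ∫ p, z.1 p * (p : ℂ) ^ j ∂halfLine = 0 := by
  refine and_congr_right fun h => ?_
  rw [h.integral_mul_pow hj]

theorem isClosed_weightedSpace {j : ℕ} (hj : j ≤ 1) :
    IsClosed (weightedSpace hj : Set (L2Half × L2Half)) := by
  refine isClosed_isSqMul.inter (isClosed_eq ?_ continuous_const)
  exact (continuous_integral_mul_left (momentWeight hj)).comp (continuous_fst.add continuous_snd)

instance {j : ℕ} (hj : j ≤ 1) : CompleteSpace (weightedSpace hj) :=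
  (isClosed_weightedSpace hj).completeSpace_coe

section MinimalOperator

variable {j : ℕ} {β : ℝ → ℝ} {k : ℝ → ℝ → ℝ}

/-- `ψ ↦ ∫₀^∞ k(p,q) ψ(q) dq` as a linear map. -/
noncomputable def kernelL2 (hk : IsParityKernel j β k) :
    weightedSpace hk.index_le →ₗ[ℂ] L2Half where
  toFun z := (((mem_weightedSpace hk.index_le).1 z.2).1.memLp_kernelInt hk
    ((mem_weightedSpace hk.index_le).1 z.2).2).toLp _
  map_add' z z' := by
    rw [← MemLp.toLp_add]
    refine MemLp.toLp_congr _ _ ?_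
    filter_upwards with p
    rw [Pi.add_apply, kernelInt, kernelInt, kernelInt, ← integral_add]
    · refine integral_congr_ae ?_
      filter_upwards [Lp.coeFn_add z.1.1 z'.1.1] with q hq
      rw [Submodule.coe_add, Prod.fst_add, hq, Pi.add_apply, mul_add]
    · exact ((mem_weightedSpace hk.index_le).1 z.2).1.integrable_kernel hk.eq_or_eq p
    · exact ((mem_weightedSpace hk.index_le).1 z'.2).1.integrable_kernel hk.eq_or_eq p
  map_smul' c z := by
    rw [RingHom.id_apply, ← MemLp.toLp_const_smul]
    refine MemLp.toLp_congr _ _ ?_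
    filter_upwards with p
    rw [Pi.smul_apply, kernelInt, kernelInt, smul_eq_mul, ← integral_const_mul]
    refine integral_congr_ae ?_
    filter_upwards [Lp.coeFn_smul c z.1.1] with q hq
    rw [Submodule.coe_smul, Prod.smul_fst, hq, Pi.smul_apply, smul_eq_mul]
    ring

theorem coeFn_kernelL2 (hk : IsParityKernel j β k) (z : weightedSpace hk.index_le) :
    kernelL2 hk z =ᵐ[halfLine] kernelInt k z.1.1 :=
  (((mem_weightedSpace hk.index_le).1 z.2).1.memLp_kernelInt hk
    ((mem_weightedSpace hk.index_le).1 z.2).2).coeFn_toLp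

theorem norm_kernelL2_le (hk : IsParityKernel j β k) (z : weightedSpace hk.index_le) :
    ‖kernelL2 hk z‖ ≤ 2 * ‖z.1.2‖ := by
  have h := ((mem_weightedSpace hk.index_le).1 z.2).1.eLpNorm_kernelInt_le hk
    ((mem_weightedSpace hk.index_le).1 z.2).2
  have h2 : ‖kernelL2 hk z‖ = (eLpNorm (kernelInt k z.1.1) 2 halfLine).toReal :=
    Lp.norm_toLp _ (((mem_weightedSpace hk.index_le).1 z.2).1.memLp_kernelInt hk
      ((mem_weightedSpace hk.index_le).1 z.2).2)
  rw [h2, Lp.norm_def, ← ENNReal.toReal_ofNat, ← ENNReal.toReal_mul]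
  exact ENNReal.toReal_mono (ENNReal.mul_ne_top (by norm_num) (Lp.memLp _).2.ne) h

/-- `(ψ, p² ψ) ↦ (ψ, p² ψ + (α - 1/4) ∫ k(p,q) ψ(q) dq)`. -/
noncomputable def minMap (α : ℝ) (hk : IsParityKernel j β k) :
    weightedSpace hk.index_le →L[ℂ] L2Half × L2Half :=
  LinearMap.mkContinuous
    ((LinearMap.fst ℂ L2Half L2Half ∘ₗ Submodule.subtype _).prod
      (LinearMap.snd ℂ L2Half L2Half ∘ₗ Submodule.subtype _ +
        ((α : ℂ) - 1 / 4) • kernelL2 hk)) (1 + ‖(α : ℂ) - 1 / 4‖ * 2) (by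
    intro z
    have h1 : ‖z.1.1‖ ≤ ‖z‖ := norm_fst_le z.1
    have h2 : ‖z.1.2‖ ≤ ‖z‖ := norm_snd_le z.1
    refine max_le ?_ ?_
    · change ‖z.1.1‖ ≤ _
      nlinarith [norm_nonneg ((α : ℂ) - 1 / 4), norm_nonneg z,
        mul_nonneg (norm_nonneg ((α : ℂ) - 1 / 4)) (norm_nonneg z)]
    · change ‖z.1.2 + ((α : ℂ) - 1 / 4) • kernelL2 hk z‖ ≤ _
      refine (norm_add_le _ _).trans ?_
      rw [norm_smul]
      nlinarith [norm_kernelL2_le hk z, norm_nonneg ((α : ℂ) - 1 / 4),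
        mul_le_mul_of_nonneg_left ((norm_kernelL2_le hk z).trans
          (mul_le_mul_of_nonneg_left h2 zero_le_two)) (norm_nonneg ((α : ℂ) - 1 / 4))])

theorem minMap_apply (α : ℝ) (hk : IsParityKernel j β k) (z : weightedSpace hk.index_le) :
    minMap α hk z = (z.1.1, z.1.2 + ((α : ℂ) - 1 / 4) • kernelL2 hk z) := rfl

theorem coeFn_minMap_snd (α : ℝ) (hk : IsParityKernel j β k) (z : weightedSpace hk.index_le) :
    ∀ᵐ p : ℝ ∂halfLine, (minMap α hk z).2 p =
      (p : ℂ) ^ 2 * z.1.1 p + ((α : ℂ) - 1 / 4) * kernelInt k z.1.1 p := by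
  have h1 := ((mem_weightedSpace hk.index_le).1 z.2).1
  rw [IsSqMul] at h1
  rw [minMap_apply]
  filter_upwards [h1, coeFn_kernelL2 hk z, Lp.coeFn_smul ((α : ℂ) - 1 / 4) (kernelL2 hk z),
    Lp.coeFn_add z.1.2 (((α : ℂ) - 1 / 4) • kernelL2 hk z)] with p h2 h3 h4 h5
  rw [h5, Pi.add_apply, h4, Pi.smul_apply, h3, h2, smul_eq_mul]

/-- The a priori estimate. With `v` the image of `ψ`, the function `-∫ k ψ` solves the Euler
equation with right-hand side `v`. Being in `L²`, it contains no homogeneous solution, so its norm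
is at most `C ‖v‖`. Then `p² ψ = v - (α-1/4) ∫ k ψ` is controlled as well. -/
theorem exists_norm_le_minMap {α : ℝ} {m : ℂ} (hm : m ^ 2 = (α : ℂ)) (hm1 : |m.re| < 1) (hk : IsParityKernel j β k) :
    ∃ C : ℝ, 0 ≤ C ∧ ∀ z : weightedSpace hk.index_le, ‖z‖ ≤ C * ‖minMap α hk z‖ := by
  obtain ⟨C, hC, hE⟩ := exists_euler_bound hm1
  set δ : ℂ := (α : ℂ) - 1 / 4 with hδ
  refine ⟨1 + ‖δ‖ * C, by positivity, fun z => ?_⟩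
  obtain ⟨h1, h2⟩ := (mem_weightedSpace hk.index_le).1 z.2
  obtain ⟨Φ₁, hΦ⟩ := h1.isSecondPrimitive_kernelInt hk
  set v := (minMap α hk z).2 with hv
  have hv1 : ‖v‖ ≤ ‖minMap α hk z‖ := norm_snd_le _
  obtain ⟨c₁, c₂, ρ, hρ, hΦρ⟩ := hE z.1.1 v _ Φ₁ hΦ (by
    filter_upwards [coeFn_minMap_snd α hk z] with p hp
    rw [hp, hm]
    ring)
  have hmem : MemLp (fun q => c₁ * eulerFst m q + c₂ * eulerSnd m q) 2 halfLine := by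
    refine ((h1.memLp_kernelInt hk h2).neg.sub (Lp.memLp ρ)).ae_eq ?_
    filter_upwards [hΦρ] with q hq
    simp only [Pi.sub_apply, Pi.neg_apply]
    rw [hq]
    ring
  obtain ⟨hc1, hc2⟩ := eq_zero_of_memLp_euler hm1 one_pos (hmem.mono_measure
    (Measure.restrict_mono (Ioi_subset_Ioi zero_le_one) le_rfl))
  have hK : kernelL2 hk z = -ρ := by
    refine Lp.ext ?_
    filter_upwards [coeFn_kernelL2 hk z, hΦρ, Lp.coeFn_neg ρ] with q h3 h4 h5
    rw [h3, h5, Pi.neg_apply]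
    rw [hc1, hc2] at h4
    linear_combination -h4
  have hu : z.1.2 = v + δ • ρ := by
    have : v = z.1.2 + δ • kernelL2 hk z := rfl
    rw [this, hK]
    simp
  have h6 : ‖z.1.2‖ ≤ (1 + ‖δ‖ * C) * ‖minMap α hk z‖ := by
    rw [hu]
    refine (norm_add_le _ _).trans ?_
    rw [norm_smul]
    nlinarith [norm_nonneg δ, mul_le_mul_of_nonneg_left
      (hρ.trans (mul_le_mul_of_nonneg_left hv1 hC)) (norm_nonneg δ)]
  have h7 : ‖z.1.1‖ ≤ (1 + ‖δ‖ * C) * ‖minMap α hk z‖ := by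
    have : ‖z.1.1‖ ≤ ‖minMap α hk z‖ := norm_fst_le (minMap α hk z)
    nlinarith [mul_nonneg (mul_nonneg (norm_nonneg δ) hC) (norm_nonneg (minMap α hk z))]
  exact max_le h7 h6

theorem isClosed_range_minMap {α : ℝ} {m : ℂ} (hm : m ^ 2 = (α : ℂ)) (hm1 : |m.re| < 1) (hk : IsParityKernel j β k) :
    IsClosed (Set.range (minMap α hk)) := by
  obtain ⟨C, hC, h⟩ := exists_norm_le_minMap hm hm1 hk
  have h2 : AntilipschitzWith ⟨C, hC⟩ (minMap α hk) :=
    (minMap α hk).antilipschitz_of_bound h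
  exact h2.isClosed_range (minMap α hk).uniformContinuous

theorem mem_coreGraph_iff {α : ℝ} (hk : IsParityKernel j β k) {y : L2Half × L2Half} :
    y ∈ coreGraph α j k hk.eq_or_eq ↔
      y.1 ∈ momentSpace j ∧ y ∈ Set.range (minMap α hk) := by
  constructor
  · rintro ⟨h1, h2⟩
    refine ⟨h1, ?_⟩
    obtain ⟨u, hu⟩ := exists_isSqMul_of_isRapidlyDecaying h1.1
    refine ⟨⟨(y.1, u), (mem_weightedSpace hk.index_le).2 ⟨hu, h1.2⟩⟩, ?_⟩
    refine Prod.ext rfl (Lp.ext ?_)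
    filter_upwards [coeFn_minMap_snd α hk ⟨(y.1, u), (mem_weightedSpace hk.index_le).2
      ⟨hu, h1.2⟩⟩, h2] with p h3 h4
    rw [h3, h4]
    rfl
  · rintro ⟨h1, z, rfl⟩
    exact ⟨h1, coeFn_minMap_snd α hk z⟩

theorem exists_mem_coreGraph (α : ℝ) (hk : IsParityKernel j β k) {ψ : L2Half}
    (h : ψ ∈ momentSpace j) : ∃ v, (ψ, v) ∈ coreGraph α j k hk.eq_or_eq := by
  obtain ⟨u, hu⟩ := exists_isSqMul_of_isRapidlyDecaying h.1
  exact ⟨_, (mem_coreGraph_iff hk).2 ⟨h, ⟨⟨(ψ, u), (mem_weightedSpace hk.index_le).2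
    ⟨hu, h.2⟩⟩, Prod.ext rfl rfl⟩⟩⟩

/-- The normalized indicator function of `]0,1[`. -/
theorem exists_unit_moment (j : ℕ) : ∃ χ υ : L2Half, IsSqMul χ υ ∧
    (∀ᵐ p ∂halfLine, 1 ≤ p → χ p = 0) ∧ ∫ p, χ p * (p : ℂ) ^ j ∂halfLine = 1 := by
  have hm : MemLp ((Ioo (0 : ℝ) 1).indicator fun _ => ((j : ℂ) + 1)) 2 halfLine :=
    memLp_indicator_const 2 measurableSet_Ioo _ (Or.inr (by
      rw [Measure.restrict_apply measurableSet_Ioo]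
      refine ((measure_mono inter_subset_left).trans_lt ?_).ne
      simp))
  have h0 : ∀ᵐ p ∂halfLine, 1 ≤ p → hm.toLp _ p = 0 := by
    filter_upwards [hm.coeFn_toLp] with p hp h1
    rw [hp, indicator_of_notMem (fun h => not_le.2 h.2 h1)]
  obtain ⟨υ, hυ⟩ := exists_isSqMul_of_isRapidlyDecaying (isRapidlyDecaying_of_ae_eq_zero h0)
  refine ⟨hm.toLp _, υ, hυ, h0, ?_⟩
  have e : ∫ p, hm.toLp _ p * (p : ℂ) ^ j ∂halfLine =
      ∫ p in (0 : ℝ)..1, ((j : ℂ) + 1) * (p : ℂ) ^ j := by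
    rw [intervalIntegral.integral_of_le zero_le_one, integral_Ioc_eq_integral_Ioo,
      ← integral_indicator measurableSet_Ioo, ← integral_indicator measurableSet_Ioi]
    have h1 := (ae_restrict_iff' measurableSet_Ioi).1 hm.coeFn_toLp
    refine integral_congr_ae ?_
    filter_upwards [h1] with p hp
    by_cases hp0 : p ∈ Ioi (0 : ℝ)
    · rw [indicator_of_mem hp0, hp hp0]
      by_cases hp1 : p ∈ Ioo (0 : ℝ) 1
      · rw [indicator_of_mem hp1, indicator_of_mem hp1]
      · rw [indicator_of_notMem hp1, indicator_of_notMem hp1, zero_mul]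
    · rw [indicator_of_notMem hp0, indicator_of_notMem (fun h => hp0 h.1)]
  rw [e, intervalIntegral.integral_const_mul]
  have e2 : ∫ p in (0 : ℝ)..1, (p : ℂ) ^ j = ((∫ p in (0 : ℝ)..1, p ^ j : ℝ) : ℂ) := by
    rw [← intervalIntegral.integral_ofReal]
    push_cast
    rfl
  rw [e2, integral_pow]
  push_cast
  have : (j : ℂ) + 1 ≠ 0 := by exact_mod_cast Nat.succ_ne_zero j
  field_simp
  simp

theorem isSqMul_truncL2 {ψ u : L2Half} (h : IsSqMul ψ u) (R : ℝ) :
    IsSqMul (truncL2 R ψ) (truncL2 R u) := by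
  rw [IsSqMul] at *
  filter_upwards [h, coeFn_truncL2 R ψ, coeFn_truncL2 R u] with p h1 h2 h3
  rw [h2, h3]
  by_cases hp : p ∈ Iio R
  · rw [indicator_of_mem hp, indicator_of_mem hp, h1]
  · rw [indicator_of_notMem hp, indicator_of_notMem hp, mul_zero]

theorem sub_smul_mem_weightedSpace {j : ℕ} (hj : j ≤ 1) {ψ u χ υ : L2Half} (h : IsSqMul ψ u)
    (hχ : IsSqMul χ υ) (hχ1 : ∫ p, χ p * (p : ℂ) ^ j ∂halfLine = 1) :
    (ψ, u) - (∫ p, ψ p * (p : ℂ) ^ j ∂halfLine) • (χ, υ) ∈ weightedSpace hj := by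
  set c := ∫ p, ψ p * (p : ℂ) ^ j ∂halfLine with hc
  have e : (ψ, u) - c • (χ, υ) = (ψ + (-c) • χ, u + (-c) • υ) := by
    rw [neg_smul, neg_smul, ← sub_eq_add_neg, ← sub_eq_add_neg]
    rfl
  rw [e, mem_weightedSpace]
  refine ⟨h.add (hχ.smul _), ?_⟩
  have e2 : ∫ p, (ψ + (-c) • χ) p * (p : ℂ) ^ j ∂halfLine =
      ∫ p, (ψ p * (p : ℂ) ^ j + (-c) * (χ p * (p : ℂ) ^ j)) ∂halfLine := by
    refine integral_congr_ae ?_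
    filter_upwards [Lp.coeFn_add ψ ((-c) • χ), Lp.coeFn_smul (-c) χ] with p h1 h2
    rw [h1, Pi.add_apply, h2, Pi.smul_apply, smul_eq_mul]
    ring
  change ∫ p, (ψ + (-c) • χ) p * (p : ℂ) ^ j ∂halfLine = 0
  rw [e2, integral_add (h.integrable_mul_pow hj) ((hχ.integrable_mul_pow hj).const_mul _),
    integral_const_mul, hχ1, ← hc]
  ring

/-- Truncation destroys the moment condition; subtracting `c n • χ` restores it, where `χ` has unit
moment. The corrections tend to zero because the moment is continuous in the graph norm of `p²`. -/
theorem dense_momentSpace {j : ℕ} (hj : j ≤ 1) :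
    Dense {z : weightedSpace hj | z.1.1 ∈ momentSpace j} := by
  intro z
  obtain ⟨χ, υ, hχ, hχ0, hχ1⟩ := exists_unit_moment j
  obtain ⟨h1, h2⟩ := (mem_weightedSpace hj).1 z.2
  set c : ℕ → ℂ := fun n => ∫ p, truncL2 n z.1.1 p * (p : ℂ) ^ j ∂halfLine with hc
  set x : ℕ → weightedSpace hj := fun n => ⟨_, sub_smul_mem_weightedSpace hj
    (isSqMul_truncL2 h1 n) hχ hχ1⟩ with hx
  have hc0 : Tendsto c atTop (𝓝 0) := by
    have h3 : ∀ n, c n = ∫ p, (truncL2 n z.1.1 + truncL2 n z.1.2) p * momentWeight hj p ∂halfLine :=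
      fun n => (isSqMul_truncL2 h1 n).integral_mul_pow hj
    rw [funext h3, ← h2, h1.integral_mul_pow hj]
    exact ((continuous_integral_mul_left (momentWeight hj)).tendsto _).comp
      ((tendsto_truncL2 z.1.1).add (tendsto_truncL2 z.1.2))
  refine mem_closure_of_tendsto (f := x) (b := atTop) ?_ ?_
  · rw [tendsto_subtype_rng]
    have h3 : Tendsto (fun n : ℕ => ((truncL2 n z.1.1, truncL2 n z.1.2) : L2Half × L2Half) -
        c n • (χ, υ)) atTop (𝓝 ((z.1.1, z.1.2) - (0 : ℂ) • (χ, υ))) :=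
      ((tendsto_truncL2 z.1.1).prodMk_nhds (tendsto_truncL2 z.1.2)).sub (hc0.smul_const _)
    rw [zero_smul, sub_zero] at h3
    exact h3
  · refine Eventually.of_forall fun n => ?_
    -- The truncation lives below `n` and the correction `χ` below `1`.
    refine ⟨isRapidlyDecaying_of_ae_eq_zero (R := max n 1) ?_, ((mem_weightedSpace hj).1 (x n).2).2⟩
    have h3 : (x n).1.1 = truncL2 n z.1.1 - c n • χ := rfl
    rw [h3]
    filter_upwards [Lp.coeFn_sub (truncL2 n z.1.1) (c n • χ), Lp.coeFn_smul (c n) χ,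
      coeFn_truncL2 n z.1.1, hχ0] with p h4 h5 h6 h7 hp
    rw [h4, Pi.sub_apply, h5, Pi.smul_apply, h6, h7 ((le_max_right _ _).trans hp),
      indicator_of_notMem (fun h : p ∈ Iio (n : ℝ) =>
        absurd ((le_max_left _ _).trans hp) (not_le.2 h))]
    simp

/-- The range is closed by the a priori estimate, and the core is the image of a dense subspace
under a continuous map. -/
theorem closure_coreGraph {α : ℝ} {m : ℂ} (hm : m ^ 2 = (α : ℂ)) (hm1 : |m.re| < 1)
    (hk : IsParityKernel j β k) :
    (coreGraph α j k hk.eq_or_eq).topologicalClosure =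
      LinearMap.range (minMap α hk : weightedSpace hk.index_le →ₗ[ℂ] L2Half × L2Half) := by
  refine SetLike.coe_injective ?_
  rw [Submodule.topologicalClosure_coe, LinearMap.coe_range]
  refine Subset.antisymm ?_ ?_
  · exact closure_minimal (fun y hy => ((mem_coreGraph_iff hk).1 hy).2)
      (isClosed_range_minMap hm hm1 hk)
  · refine ((minMap α hk).continuous.range_subset_closure_image_dense
      (dense_momentSpace hk.index_le)).trans (closure_mono ?_)
    rintro _ ⟨z, hz, rfl⟩
    exact (mem_coreGraph_iff hk).2 ⟨hz, z, rfl⟩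

theorem minMap_snd_eq_zero {α : ℝ} (hk : IsParityKernel j β k) {z : weightedSpace hk.index_le}
    (h : (minMap α hk z).1 = 0) : (minMap α hk z).2 = 0 := by
  have h1 : z = 0 := by
    have h2 := ((mem_weightedSpace hk.index_le).1 z.2).1
    have h3 : z.1.1 = 0 := h
    refine Subtype.ext (Prod.ext h3 (Lp.ext ?_))
    rw [IsSqMul, h3] at h2
    rw [Submodule.coe_zero, Prod.snd_zero]
    filter_upwards [h2, coeFn_zero_half] with p h4 h5
    rw [h4, h5, mul_zero]
  rw [h1, map_zero, Prod.snd_zero]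

/-- `Submodule.toLinearPMap` and `LinearPMap.closure` take default values when the submodule is not
single-valued or the operator is not closable. Both conditions are therefore checked before the
graph is identified. -/
theorem graph_closure_coreGraph {α : ℝ} {m : ℂ} (hm : m ^ 2 = (α : ℂ)) (hm1 : |m.re| < 1)
    (hk : IsParityKernel j β k) :
    (coreGraph α j k hk.eq_or_eq).toLinearPMap.closure.graph =
      LinearMap.range (minMap α hk : weightedSpace hk.index_le →ₗ[ℂ] L2Half × L2Half) := by
  have hr : (LinearMap.range (minMap α hk : weightedSpace hk.index_le →ₗ[ℂ]
      L2Half × L2Half)).toLinearPMap.graph = LinearMap.range (minMap α hk :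
        weightedSpace hk.index_le →ₗ[ℂ] L2Half × L2Half) := by
    refine Submodule.toLinearPMap_graph_eq _ ?_
    rintro _ ⟨z, rfl⟩ hz
    exact minMap_snd_eq_zero hk hz
  have hg : (coreGraph α j k hk.eq_or_eq).toLinearPMap.graph = coreGraph α j k hk.eq_or_eq := by
    refine Submodule.toLinearPMap_graph_eq _ fun y hy hy0 => ?_
    obtain ⟨z, rfl⟩ := ((mem_coreGraph_iff hk).1 hy).2
    exact minMap_snd_eq_zero hk hy0
  have hc := closure_coreGraph hm hm1 hk
  have hcl : (coreGraph α j k hk.eq_or_eq).toLinearPMap.IsClosable := by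
    refine ⟨(LinearMap.range (minMap α hk : weightedSpace hk.index_le →ₗ[ℂ]
      L2Half × L2Half)).toLinearPMap, ?_⟩
    rw [hg, hc, hr]
  rw [← hcl.graph_closure_eq_closure_graph, hg, hc]

theorem mem_domain_closure_coreGraph {α : ℝ} {m : ℂ} (hm : m ^ 2 = (α : ℂ)) (hm1 : |m.re| < 1)
    (hk : IsParityKernel j β k) {ψ : L2Half} :
    ψ ∈ (coreGraph α j k hk.eq_or_eq).toLinearPMap.closure.domain ↔
      (∃ u, IsSqMul ψ u) ∧ ∫ p, ψ p * (p : ℂ) ^ j ∂halfLine = 0 := by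
  rw [LinearPMap.mem_domain_iff]
  simp_rw [graph_closure_coreGraph hm hm1 hk]
  constructor
  · rintro ⟨v, z, hz⟩
    have h1 : z.1.1 = ψ := congrArg Prod.fst hz
    rw [← h1]
    have h2 := (mem_weightedSpace hk.index_le).1 z.2
    exact ⟨⟨_, h2.1⟩, h2.2⟩
  · rintro ⟨⟨u, hu⟩, h0⟩
    exact ⟨_, ⟨⟨(ψ, u), (mem_weightedSpace hk.index_le).2 ⟨hu, h0⟩⟩, rfl⟩⟩

end MinimalOperator

/-! ### The maximal operator as the transpose of the minimal one -/

section Transpose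

variable {j : ℕ} {β : ℝ → ℝ} {k : ℝ → ℝ → ℝ}

/-- `φ` is locally integrable up to the origin, and its integral grows at most linearly. -/
structure IsLinearGrowth (B : ℝ) (φ : ℝ → ℂ) : Prop where
  measurable : StronglyMeasurable φ
  nonneg : 0 ≤ B
  integrable : ∀ q : ℝ, IntegrableOn φ (Ioc 0 q)
  le : ∀ q : ℝ, 0 ≤ q → ∫ p in Ioc 0 q, ‖φ p‖ ≤ q + B

theorem isLinearGrowth_L2 (φ : L2Half) : IsLinearGrowth (‖φ‖ ^ 2) φ where
  measurable := Lp.stronglyMeasurable φ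
  nonneg := by positivity
  integrable q := integrableOn_Ioc_of_L2 φ le_rfl
  le q hq := integral_norm_le φ hq

theorem isLinearGrowth_of_norm_le_one {φ : ℝ → ℂ} (h : StronglyMeasurable φ) (h1 : ∀ p, ‖φ p‖ ≤ 1) :
    IsLinearGrowth 0 φ where
  measurable := h
  nonneg := le_rfl
  integrable q := by
    refine Measure.integrableOn_of_bounded (M := 1) (by simp) h.aestronglyMeasurable
      (Eventually.of_forall h1)
  le q hq := by
    have hi : IntegrableOn φ (Ioc 0 q) := Measure.integrableOn_of_bounded (M := 1) (by simp)
      h.aestronglyMeasurable (Eventually.of_forall h1)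
    calc ∫ p in Ioc 0 q, ‖φ p‖ ≤ ∫ p in Ioc 0 q, (1 : ℝ) :=
          integral_mono hi.norm (by simp) h1
      _ = q + 0 := by simp [hq]

/-- Integrating in `p` first: `|q - p| ≤ q` and linear growth give the bound `(q + B) q |ψ(q)|`,
integrable by rapid decay. -/
theorem integrable_kernel_pairing {φ : ℝ → ℂ} {B : ℝ} (hφ : IsLinearGrowth B φ) {ψ : L2Half} (hψ : IsRapidlyDecaying ψ) :
    Integrable (fun z : ℝ × ℝ => {z : ℝ × ℝ | z.1 < z.2}.indicator
      (fun z => φ z.1 * (((z.2 : ℂ) - z.1) * ψ z.2)) z) (halfLine.prod halfLine) := by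
  have hm : AEStronglyMeasurable (fun z : ℝ × ℝ => {z : ℝ × ℝ | z.1 < z.2}.indicator
      (fun z => φ z.1 * (((z.2 : ℂ) - z.1) * ψ z.2)) z) (halfLine.prod halfLine) := by
    refine (StronglyMeasurable.indicator ?_
      (measurableSet_lt measurable_fst measurable_snd)).aestronglyMeasurable
    refine (hφ.measurable.comp_measurable measurable_fst).mul ?_
    refine StronglyMeasurable.mul ?_ ((Lp.stronglyMeasurable ψ).comp_measurable measurable_snd)
    fun_prop
  have hq : ∀ q : ℝ, ∀ p : ℝ, ({z : ℝ × ℝ | z.1 < z.2}.indicator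
      (fun z => φ z.1 * (((z.2 : ℂ) - z.1) * ψ z.2)) (p, q)) =
      (Iio q).indicator (fun p => φ p * (((q : ℂ) - p) * ψ q)) p := by
    intro q p
    simp [indicator_apply]
  have hb : ∀ q : ℝ, 0 < q → ∀ p, 0 < p → ‖(Iio q).indicator
      (fun p => φ p * (((q : ℂ) - p) * ψ q)) p‖ ≤
      (Ioc 0 q).indicator (fun p => ‖φ p‖ * (q * ‖ψ q‖)) p := by
    intro q hq0 p hp
    by_cases hpq : p < q
    · rw [indicator_of_mem (by exact hpq), indicator_of_mem (show p ∈ Ioc 0 q from ⟨hp, hpq.le⟩), norm_mul, norm_mul,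
        ← Complex.ofReal_sub, Complex.norm_real, Real.norm_of_nonneg (by linarith)]
      gcongr
      linarith
    · rw [indicator_of_notMem (by exact hpq), norm_zero]
      exact indicator_nonneg (fun x _ => by positivity) p
  have hbi : ∀ q : ℝ, Integrable ((Ioc 0 q).indicator fun p => ‖φ p‖ * (q * ‖ψ q‖)) halfLine := by
    intro q
    rw [integrable_indicator_iff measurableSet_Ioc, IntegrableOn,
      Measure.restrict_restrict measurableSet_Ioc,
      inter_eq_left.2 (show Ioc 0 q ⊆ Ioi (0 : ℝ) from fun x hx => hx.1)]
    exact (hφ.integrable q).norm.mul_const _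
  rw [integrable_prod_iff' hm]
  constructor
  · filter_upwards [ae_restrict_mem measurableSet_Ioi, hm.prodMk_right] with q hq0 hmq
    refine (hbi q).mono' hmq ?_
    filter_upwards [ae_restrict_mem measurableSet_Ioi] with p hp
    rw [hq]
    exact hb q hq0 p hp
  · have h1 : Integrable (fun q => ‖ψ q * (q : ℂ) ^ 2‖ + B * ‖ψ q * (q : ℂ) ^ 1‖) halfLine :=
      (hψ.integrable 2).norm.add ((hψ.integrable 1).norm.const_mul _)
    refine h1.mono' hm.norm.prod_swap.integral_prod_right' ?_
    filter_upwards [ae_restrict_mem measurableSet_Ioi] with q hq0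
    have hq0' : 0 < q := hq0
    rw [Real.norm_of_nonneg (integral_nonneg fun p => norm_nonneg _)]
    calc _ ≤ ∫ p, (Ioc 0 q).indicator (fun p => ‖φ p‖ * (q * ‖ψ q‖)) p ∂halfLine := by
          refine integral_mono_of_nonneg (Eventually.of_forall fun p => norm_nonneg _) (hbi q) ?_
          filter_upwards [ae_restrict_mem measurableSet_Ioi] with p hp
          rw [hq]
          exact hb q hq0 p hp
      _ = (∫ p in Ioc 0 q, ‖φ p‖) * (q * ‖ψ q‖) := by
          rw [integral_indicator measurableSet_Ioc, Measure.restrict_restrict measurableSet_Ioc,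
            inter_eq_left.2 (show Ioc 0 q ⊆ Ioi (0 : ℝ) from fun x hx => hx.1), integral_mul_const]
      _ ≤ (q + B) * (q * ‖ψ q‖) := by
          gcongr
          exact hφ.le q hq0'.le
      _ = _ := by
          rw [norm_mul, norm_mul, norm_pow, norm_pow, Complex.norm_real,
            Real.norm_of_nonneg hq0'.le]
          ring

/-- Fubini turns the integral over `q > p` into one over `p < q`. On the zero-moment space the
transpose of the kernel is thus `-originPrimitive`, with no trace of `β`. It is used for `φ` in `L²`
and for the bounded function `t(xp)`. -/
theorem integral_mul_kernelInt (hk : IsParityKernel j β k) {φ : ℝ → ℂ} {B : ℝ}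
    (hφ : IsLinearGrowth B φ) {ψ : L2Half} (hψ : ψ ∈ momentSpace j) :
    ∫ p, φ p * kernelInt k ψ p ∂halfLine = -∫ q, ψ q * originPrimitive φ q ∂halfLine := by
  obtain ⟨u, hu⟩ := exists_isSqMul_of_isRapidlyDecaying hψ.1
  have hsw := integral_integral_swap (f := fun p q => {z : ℝ × ℝ | z.1 < z.2}.indicator
      (fun z => φ z.1 * (((z.2 : ℂ) - z.1) * ψ z.2)) (p, q)) (integrable_kernel_pairing hφ hψ.1)
  have e1 : ∫ p, φ p * kernelInt k ψ p ∂halfLine =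
      -∫ p, ∫ q, {z : ℝ × ℝ | z.1 < z.2}.indicator
      (fun z => φ z.1 * (((z.2 : ℂ) - z.1) * ψ z.2)) (p, q) ∂halfLine ∂halfLine := by
    rw [← integral_neg]
    refine setIntegral_congr_fun measurableSet_Ioi fun p hp => ?_
    have hp0 : 0 < p := hp
    have : ∀ q, {z : ℝ × ℝ | z.1 < z.2}.indicator
        (fun z => φ z.1 * (((z.2 : ℂ) - z.1) * ψ z.2)) (p, q) =
        (Ioi p).indicator (fun q => φ p * (((q : ℂ) - p) * ψ q)) q := fun q => by
      simp [indicator_apply]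
    simp_rw [this]
    rw [integral_indicator measurableSet_Ioi, Measure.restrict_restrict measurableSet_Ioi,
      inter_eq_left.2 (Ioi_subset_Ioi hp0.le), integral_const_mul,
      hu.kernelInt_eq_upper hk hψ.2 hp0, mul_neg]
  have e2 : ∫ q, ψ q * originPrimitive φ q ∂halfLine =
      ∫ q, ∫ p, {z : ℝ × ℝ | z.1 < z.2}.indicator
      (fun z => φ z.1 * (((z.2 : ℂ) - z.1) * ψ z.2)) (p, q) ∂halfLine ∂halfLine := by
    refine setIntegral_congr_fun measurableSet_Ioi fun q hq => ?_
    have hq0 : 0 < q := hq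
    have : ∀ p, {z : ℝ × ℝ | z.1 < z.2}.indicator
        (fun z => φ z.1 * (((z.2 : ℂ) - z.1) * ψ z.2)) (p, q) =
        (Iio q).indicator (fun p => ψ q * (((q : ℂ) - p) * φ p)) p := fun p => by
      simp only [indicator_apply, mem_ofPred_eq, mem_Iio]
      split_ifs <;> ring
    simp_rw [this]
    rw [integral_indicator measurableSet_Iio, Measure.restrict_restrict measurableSet_Iio,
      inter_comm, Ioi_inter_Iio, integral_const_mul, originPrimitive,
      intervalIntegral.integral_of_le hq0.le, integral_Ioc_eq_integral_Ioo]
  rw [e1, e2, hsw]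

theorem integrable_mul_originPrimitive (φ : L2Half) {ψ : L2Half} (hψ : IsRapidlyDecaying ψ) :
    Integrable (fun q => ψ q * originPrimitive φ q) halfLine := by
  have h1 : Integrable (fun q => ‖ψ q * (q : ℂ) ^ 2‖ + ‖φ‖ ^ 2 * ‖ψ q * (q : ℂ) ^ 1‖) halfLine :=
    (hψ.integrable 2).norm.add ((hψ.integrable 1).norm.const_mul _)
  refine h1.mono' ((Lp.aestronglyMeasurable ψ).mul
    ((continuousOn_originPrimitive φ).aestronglyMeasurable measurableSet_Ioi)) ?_
  filter_upwards [ae_restrict_mem measurableSet_Ioi] with q hq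
  have hq0 : 0 < q := hq
  rw [norm_mul, norm_mul, norm_mul, norm_pow, norm_pow, Complex.norm_real,
    Real.norm_of_nonneg hq0.le]
  nlinarith [mul_le_mul_of_nonneg_left (norm_originPrimitive_le φ hq0.le) (norm_nonneg (ψ q))]

/-- `p² φ(p) - γ(p) - (α - 1/4) ∫₀^p (p - q) φ(q) dq`. -/
noncomputable def defect (α : ℝ) (φ γ : L2Half) (p : ℝ) : ℂ :=
  (p : ℂ) ^ 2 * φ p - γ p - ((α : ℂ) - 1 / 4) * originPrimitive φ p

theorem integrable_mul_defect (α : ℝ) (φ γ : L2Half) {ψ : L2Half} (hψ : IsRapidlyDecaying ψ) :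
    Integrable (fun p => ψ p * defect α φ γ p) halfLine := by
  obtain ⟨u, hu⟩ := exists_isSqMul_of_isRapidlyDecaying hψ
  have h := ((integrable_mul_L2 u φ).sub (integrable_mul_L2 ψ γ)).sub
    ((integrable_mul_originPrimitive φ hψ).const_mul ((α : ℂ) - 1 / 4))
  rw [IsSqMul] at hu
  refine h.congr ?_
  filter_upwards [hu] with p hp
  simp only [Pi.sub_apply]
  rw [hp, defect]
  ring

theorem integral_mul_sub_eq_defect (α : ℝ) (hk : IsParityKernel j β k) (φ γ : L2Half)
    {y : L2Half × L2Half} (hy : y ∈ coreGraph α j k hk.eq_or_eq) :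
    ∫ p, φ p * y.2 p ∂halfLine - ∫ p, γ p * y.1 p ∂halfLine =
      ∫ p, y.1 p * defect α φ γ p ∂halfLine := by
  obtain ⟨hψ, z, rfl⟩ := (mem_coreGraph_iff hk).1 hy
  have hψ' : z.1.1 ∈ momentSpace j := hψ
  change ∫ p, φ p * (minMap α hk z).2 p ∂halfLine - ∫ p, γ p * z.1.1 p ∂halfLine =
      ∫ p, z.1.1 p * defect α φ γ p ∂halfLine
  have hu := ((mem_weightedSpace hk.index_le).1 z.2).1
  rw [IsSqMul] at hu
  have e1 : ∫ p, φ p * (minMap α hk z).2 p ∂halfLine =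
      ∫ p, φ p * z.1.2 p ∂halfLine + ((α : ℂ) - 1 / 4) * ∫ p, φ p * kernelInt k z.1.1 p ∂halfLine := by
    have hi : Integrable (fun p => φ p * kernelInt k z.1.1 p) halfLine :=
      (integrable_mul_L2 φ (kernelL2 hk z)).congr (by
        filter_upwards [coeFn_kernelL2 hk z] with p hp
        rw [hp])
    rw [← integral_const_mul, ← integral_add (integrable_mul_L2 _ _) (hi.const_mul _)]
    refine integral_congr_ae ?_
    filter_upwards [coeFn_minMap_snd α hk z, hu] with p h1 h2
    rw [h1, h2]
    ring
  have hP := integrable_mul_originPrimitive φ hψ'.1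
  have h12 : Integrable (fun p => φ p * z.1.2 p - ((α : ℂ) - 1 / 4) *
      (z.1.1 p * originPrimitive φ p)) halfLine := (integrable_mul_L2 _ _).sub (hP.const_mul _)
  rw [e1, integral_mul_kernelInt hk (isLinearGrowth_L2 φ) hψ', mul_neg, ← sub_eq_add_neg, ← integral_const_mul,
    ← integral_sub (integrable_mul_L2 _ _) (hP.const_mul _), ← integral_sub h12 (integrable_mul_L2 _ _)]
  refine integral_congr_ae ?_
  filter_upwards [hu] with p h2
  rw [h2, defect]
  ring

theorem memLp_indicator_defect (α : ℝ) (φ γ : L2Half) (hj : j ≤ 1) (c : ℂ) (n : ℕ) :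
    MemLp ((Iio (n : ℝ)).indicator fun p : ℝ => defect α φ γ p - c * (p : ℂ) ^ j) 2 halfLine := by
  have hc : MemLp ((Ioo (0 : ℝ) n).indicator fun _ =>
      ‖(α : ℂ) - 1 / 4‖ * (n * (n + ‖φ‖ ^ 2)) + ‖c‖ * (1 + n)) 2 halfLine :=
    memLp_indicator_const 2 measurableSet_Ioo _ (Or.inr (by
      rw [Measure.restrict_apply measurableSet_Ioo]
      refine ((measure_mono inter_subset_left).trans_lt ?_).ne
      simp))
  have hb := (((Lp.memLp φ).norm.const_mul ((n : ℝ) ^ 2)).add (Lp.memLp γ).norm).add hc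
  refine hb.mono' ?_ ?_
  · refine AEStronglyMeasurable.indicator ?_ measurableSet_Iio
    refine AEStronglyMeasurable.sub ?_ (by fun_prop)
    refine AEStronglyMeasurable.sub (AEStronglyMeasurable.sub ?_ (Lp.aestronglyMeasurable γ)) ?_
    · exact AEStronglyMeasurable.mul (by fun_prop) (Lp.aestronglyMeasurable φ)
    · exact aestronglyMeasurable_const.mul
        ((continuousOn_originPrimitive φ).aestronglyMeasurable measurableSet_Ioi)
  · filter_upwards [ae_restrict_mem measurableSet_Ioi] with p hp
    have hp0 : 0 < p := hp
    simp only [Pi.add_apply]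
    by_cases hpn : p < n
    · rw [indicator_of_mem (by exact hpn), indicator_of_mem (show p ∈ Ioo (0 : ℝ) n from ⟨hp0, hpn⟩)]
      rw [defect]
      refine (norm_sub_le _ _).trans ?_
      have h1 : ‖c * (p : ℂ) ^ j‖ ≤ ‖c‖ * (1 + n) := by
        rw [norm_mul, norm_pow, Complex.norm_real, Real.norm_of_nonneg hp0.le]
        gcongr
        interval_cases j
        · simp
        · rw [pow_one]; linarith
      have h2 : ‖(p : ℂ) ^ 2 * φ p - γ p - ((α : ℂ) - 1 / 4) * originPrimitive φ p‖ ≤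
          (n : ℝ) ^ 2 * ‖φ p‖ + ‖γ p‖ + ‖(α : ℂ) - 1 / 4‖ * (n * (n + ‖φ‖ ^ 2)) := by
        refine (norm_sub_le _ _).trans (add_le_add ((norm_sub_le _ _).trans
          (add_le_add ?_ le_rfl)) ?_)
        · rw [norm_mul, norm_pow, Complex.norm_real, Real.norm_of_nonneg hp0.le]
          gcongr
        · rw [norm_mul]
          gcongr
          refine (norm_originPrimitive_le φ hp0.le).trans ?_
          gcongr
      linarith
    · rw [indicator_of_notMem (by exact hpn), norm_zero]
      have : 0 ≤ (Ioo (0 : ℝ) n).indicator (fun _ => ‖(α : ℂ) - 1 / 4‖ * (n * (n + ‖φ‖ ^ 2)) +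
          ‖c‖ * (1 + n)) p := indicator_nonneg (fun x _ => by positivity) p
      positivity

/-- The pairing condition says that the defect annihilates all rapidly decaying functions of
vanishing `j`-th moment. Subtracting a multiple of `χ` turns an arbitrary function of bounded
support into such a function, so the defect must be a multiple of `p^j`. -/
theorem forall_coreGraph_iff (α : ℝ) (hk : IsParityKernel j β k) (φ γ : L2Half) :
    (∀ y ∈ coreGraph α j k hk.eq_or_eq,
      ∫ p, φ p * y.2 p ∂halfLine = ∫ p, γ p * y.1 p ∂halfLine) ↔
    ∃ c : ℂ, ∀ᵐ p : ℝ ∂halfLine, γ p =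
      (p : ℂ) ^ 2 * φ p - ((α : ℂ) - 1 / 4) * originPrimitive φ p + c * (p : ℂ) ^ j := by
  constructor
  · intro h
    have h' : ∀ ψ ∈ momentSpace j, ∫ p, ψ p * defect α φ γ p ∂halfLine = 0 := by
      intro ψ hψ
      obtain ⟨v, hv⟩ := exists_mem_coreGraph α hk hψ
      have := integral_mul_sub_eq_defect α hk φ γ hv
      rw [← this, h _ hv, sub_self]
    obtain ⟨χ, υ, hχ, hχ0, hχ1⟩ := exists_unit_moment j
    have hχr := isRapidlyDecaying_of_ae_eq_zero hχ0
    set c := ∫ p, χ p * defect α φ γ p ∂halfLine with hc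
    have key : ∀ (ψ : L2Half) (R : ℝ), (∀ᵐ p ∂halfLine, R ≤ p → ψ p = 0) →
        ∫ p, ψ p * (defect α φ γ p - c * (p : ℂ) ^ j) ∂halfLine = 0 := by
      intro ψ R hR
      have hψr := isRapidlyDecaying_of_ae_eq_zero hR
      obtain ⟨u, hu⟩ := exists_isSqMul_of_isRapidlyDecaying hψr
      set μ := ∫ p, ψ p * (p : ℂ) ^ j ∂halfLine with hμ
      have h1 := (mem_weightedSpace hk.index_le).1
        (sub_smul_mem_weightedSpace hk.index_le hu hχ hχ1)
      have h2 : ψ - μ • χ ∈ momentSpace j := by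
        refine ⟨isRapidlyDecaying_of_ae_eq_zero (R := max R 1) ?_, h1.2⟩
        filter_upwards [Lp.coeFn_sub ψ (μ • χ), Lp.coeFn_smul μ χ, hR, hχ0] with p h3 h4 h5 h6 hp
        rw [h3, Pi.sub_apply, h4, Pi.smul_apply, h5 ((le_max_left _ _).trans hp),
          h6 ((le_max_right _ _).trans hp), smul_zero, sub_zero]
      have h3 := h' _ h2
      have e1 : ∫ p, (ψ - μ • χ) p * defect α φ γ p ∂halfLine =
          ∫ p, (ψ p * defect α φ γ p - μ * (χ p * defect α φ γ p)) ∂halfLine := by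
        refine integral_congr_ae ?_
        filter_upwards [Lp.coeFn_sub ψ (μ • χ), Lp.coeFn_smul μ χ] with p h3 h4
        rw [h3, Pi.sub_apply, h4, Pi.smul_apply, smul_eq_mul]
        ring
      rw [e1, integral_sub (integrable_mul_defect α φ γ hψr)
        ((integrable_mul_defect α φ γ hχr).const_mul _), integral_const_mul] at h3
      have e2 : ∫ p, ψ p * (defect α φ γ p - c * (p : ℂ) ^ j) ∂halfLine =
          ∫ p, (ψ p * defect α φ γ p - c * (ψ p * (p : ℂ) ^ j)) ∂halfLine := by
        congr 1 with p
        ring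
      rw [e2, integral_sub (integrable_mul_defect α φ γ hψr)
        ((hψr.integrable j).const_mul _), integral_const_mul]
      linear_combination h3
    refine ⟨-c, ?_⟩
    have hn : ∀ n : ℕ, ∀ᵐ p : ℝ ∂halfLine, p < (n : ℝ) → defect α φ γ p - c * (p : ℂ) ^ j = 0 := by
      intro n
      have hm := memLp_indicator_defect α φ γ hk.index_le c n
      -- Testing with the conjugate of the truncated function itself turns the pairing into its
      -- squared norm.
      set g : L2Half := conjL2 (hm.toLp _) with hg
      have hg1 : ∀ᵐ p : ℝ ∂halfLine, g p = (starRingEnd ℂ) ((Iio (n : ℝ)).indicator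
          (fun p : ℝ => defect α φ γ p - c * (p : ℂ) ^ j) p) := by
        filter_upwards [coeFn_conjL2 (hm.toLp _), hm.coeFn_toLp] with p h1 h2
        rw [hg, h1, h2]
      have h1 := key g n (by
        filter_upwards [hg1] with p h2 h3
        rw [h2, indicator_of_notMem (by simpa using h3), map_zero])
      have h2 : ∫ p, ‖hm.toLp _ p‖ ^ 2 ∂halfLine = 0 := by
        have : ((∫ p, ‖hm.toLp _ p‖ ^ 2 ∂halfLine : ℝ) : ℂ) = 0 := by
          rw [← integral_complex_ofReal, ← h1]
          refine integral_congr_ae ?_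
          filter_upwards [hg1, hm.coeFn_toLp] with p h3 h4
          rw [h3, h4]
          by_cases hp : p ∈ Iio (n : ℝ)
          · rw [indicator_of_mem hp, ← Complex.normSq_eq_conj_mul_self, Complex.normSq_eq_norm_sq]
          · rw [indicator_of_notMem hp]
            simp
        exact_mod_cast this
      rw [← sq_norm_eq_integral] at h2
      have h3 : hm.toLp _ = 0 := norm_eq_zero.1 (pow_eq_zero_iff two_ne_zero |>.1 h2)
      filter_upwards [hm.coeFn_toLp, coeFn_zero_half] with p h4 h5 hp
      rw [h3, h5, indicator_of_mem (by exact hp)] at h4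
      exact h4.symm
    filter_upwards [ae_all_iff.2 hn] with p hp
    obtain ⟨n, hn⟩ := exists_nat_gt p
    have := hp n hn
    rw [defect] at this
    linear_combination -this
  · rintro ⟨c, hc⟩ y hy
    rw [← sub_eq_zero, integral_mul_sub_eq_defect α hk φ γ hy]
    have h0 := hy.1.2
    have e : ∫ p, y.1 p * defect α φ γ p ∂halfLine =
        ∫ p, (-c) * (y.1 p * (p : ℂ) ^ j) ∂halfLine := by
      refine integral_congr_ae ?_
      filter_upwards [hc] with p hp
      rw [defect, hp]
      ring
    rw [e, integral_const_mul, h0, mul_zero]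

end Transpose

/-! ### Sine and cosine integrals of rapidly decaying functions -/

/-- `t` is the sine (`j = 1`) or the cosine (`j = 0`), with derivative `t'`. -/
structure IsTrigKernel (j : ℕ) (t t' : ℝ → ℝ) : Prop where
  hasDerivAt : ∀ u, HasDerivAt t (t' u) u
  hasDerivAt' : ∀ u, HasDerivAt t' (-t u) u
  abs_le : ∀ u, |t u| ≤ 1
  abs_le' : ∀ u, |t' u| ≤ 1
  index_le : j ≤ 1
  eq_pow : ∀ u, t 0 + t' 0 * u = u ^ j

theorem isTrigKernel_sin : IsTrigKernel 1 Real.sin Real.cos where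
  hasDerivAt := Real.hasDerivAt_sin
  hasDerivAt' := Real.hasDerivAt_cos
  abs_le := Real.abs_sin_le_one
  abs_le' := Real.abs_cos_le_one
  index_le := le_rfl
  eq_pow := by simp

theorem isTrigKernel_cos : IsTrigKernel 0 Real.cos (fun u => -Real.sin u) where
  hasDerivAt := Real.hasDerivAt_cos
  hasDerivAt' u := (Real.hasDerivAt_sin u).neg
  abs_le := Real.abs_cos_le_one
  abs_le' u := by simpa using Real.abs_sin_le_one u
  index_le := zero_le_one
  eq_pow := by simp

/-- `∫₀^∞ t(x p) ψ(p) dp`. -/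
noncomputable def trigInt (t : ℝ → ℝ) (ψ : ℝ → ℂ) (x : ℝ) : ℂ :=
  ∫ p, (t (x * p) : ℂ) * ψ p ∂halfLine

section TrigInt

variable {j : ℕ} {t t' : ℝ → ℝ}

theorem IsTrigKernel.continuous (h : IsTrigKernel j t t') : Continuous t :=
  continuous_iff_continuousAt.2 fun u => (h.hasDerivAt u).continuousAt

theorem IsTrigKernel.continuous' (h : IsTrigKernel j t t') : Continuous t' :=
  continuous_iff_continuousAt.2 fun u => (h.hasDerivAt' u).continuousAt

theorem integrable_trig_mul (hc : Continuous t) (hb : ∀ u, |t u| ≤ 1) {ψ : ℝ → ℂ}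
    (hψ : Integrable ψ halfLine) (x : ℝ) :
    Integrable (fun p => (t (x * p) : ℂ) * ψ p) halfLine := by
  refine hψ.bdd_mul (c := 1) (by fun_prop) (Eventually.of_forall fun p => ?_)
  rw [Complex.norm_real]
  exact hb _

theorem norm_trigInt_le (hb : ∀ u, |t u| ≤ 1) {ψ : ℝ → ℂ}
    (hψ : Integrable ψ halfLine) (x : ℝ) : ‖trigInt t ψ x‖ ≤ ∫ p, ‖ψ p‖ ∂halfLine := by
  refine norm_integral_le_of_norm_le hψ.norm (Eventually.of_forall fun p => ?_)
  rw [norm_mul, Complex.norm_real]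
  exact mul_le_of_le_one_left (norm_nonneg _) (hb _)

theorem hasDerivAt_trigInt (hc : Continuous t) (hb : ∀ u, |t u| ≤ 1) (hc' : Continuous t')
    (ht : ∀ u, HasDerivAt t (t' u) u) (hb' : ∀ u, |t' u| ≤ 1) {ψ : ℝ → ℂ}
    (hψ : Integrable ψ halfLine) (hψ' : Integrable (fun p : ℝ => (p : ℂ) * ψ p) halfLine) (x : ℝ) :
    HasDerivAt (trigInt t ψ) (trigInt t' (fun p => (p : ℂ) * ψ p) x) x := by
  refine (hasDerivAt_integral_of_dominated_loc_of_deriv_le (s := univ) univ_mem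
    (F := fun (x p : ℝ) => (t (x * p) : ℂ) * ψ p) (F' := fun (x p : ℝ) => (t' (x * p) : ℂ) * ((p : ℂ) * ψ p))
    (bound := fun p : ℝ => ‖(p : ℂ) * ψ p‖)
    (Eventually.of_forall fun x => (integrable_trig_mul hc hb hψ x).aestronglyMeasurable)
    (integrable_trig_mul hc hb hψ x) (integrable_trig_mul hc' hb' hψ' x).aestronglyMeasurable
    (Eventually.of_forall fun p x _ => ?_) hψ'.norm (Eventually.of_forall fun p x _ => ?_)).2
  · rw [norm_mul, Complex.norm_real]
    exact mul_le_of_le_one_left (norm_nonneg _) (hb' _)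
  · have h1 : HasDerivAt (fun x : ℝ => t (x * p)) (t' (x * p) * p) x :=
      (ht (x * p)).comp x (hasDerivAt_mul_const p)
    have h2 := (h1.ofReal_comp).mul_const (ψ p)
    refine h2.congr_deriv ?_
    push_cast
    ring

/-- All moments of `ψ` are finite. -/
def HasMoments (ψ : ℝ → ℂ) : Prop := ∀ n : ℕ, Integrable (fun p : ℝ => (p : ℂ) ^ n * ψ p) halfLine

theorem HasMoments.mul {ψ : ℝ → ℂ} (h : HasMoments ψ) : HasMoments fun p => (p : ℂ) * ψ p := by
  intro n
  refine (h (n + 1)).congr (Eventually.of_forall fun p => ?_)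
  ring

theorem HasMoments.integrable {ψ : ℝ → ℂ} (h : HasMoments ψ) : Integrable ψ halfLine := by
  simpa using h 0

theorem IsRapidlyDecaying.hasMoments {ψ : L2Half} (h : IsRapidlyDecaying ψ) : HasMoments ψ := by
  intro n
  simpa only [mul_comm] using h.integrable n

theorem trigInt_neg (ψ : ℝ → ℂ) (x : ℝ) : trigInt (fun u => -t u) ψ x = -trigInt t ψ x := by
  rw [trigInt, trigInt, ← integral_neg]
  congr 1 with p
  push_cast
  ring

theorem IsTrigKernel.hasDerivAt_trigInt (h : IsTrigKernel j t t') {ψ : ℝ → ℂ} (hψ : HasMoments ψ)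
    (x : ℝ) : HasDerivAt (trigInt t ψ) (trigInt t' (fun p => (p : ℂ) * ψ p) x) x :=
  _root_.hasDerivAt_trigInt h.continuous h.abs_le h.continuous' h.hasDerivAt h.abs_le' hψ.integrable
    hψ.mul.integrable x

theorem IsTrigKernel.hasDerivAt_trigInt' (h : IsTrigKernel j t t') {ψ : ℝ → ℂ} (hψ : HasMoments ψ)
    (x : ℝ) : HasDerivAt (trigInt t' ψ) (-trigInt t (fun p => (p : ℂ) * ψ p) x) x := by
  rw [← trigInt_neg]
  exact _root_.hasDerivAt_trigInt (t' := fun u => -t u) h.continuous' h.abs_le' h.continuous.neg h.hasDerivAt'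
    (fun u => by rw [abs_neg]; exact h.abs_le u) hψ.integrable hψ.mul.integrable x

/-- Differentiation exchanges `t` and `t'` up to sign and multiplies `ψ` by `p`, so the induction
carries both kernels and all `ψ` with finite moments. -/
theorem IsTrigKernel.contDiff_nat_trigInt (h : IsTrigKernel j t t') (n : ℕ) :
    ∀ ψ : ℝ → ℂ, HasMoments ψ →
      ContDiff ℝ n (trigInt t ψ) ∧ ContDiff ℝ n (trigInt t' ψ) := by
  induction n with
  | zero =>
    intro ψ hψ
    simp only [Nat.cast_zero, contDiff_zero]
    exact ⟨continuous_iff_continuousAt.2 fun x => (h.hasDerivAt_trigInt hψ x).continuousAt,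
      continuous_iff_continuousAt.2 fun x => (h.hasDerivAt_trigInt' hψ x).continuousAt⟩
  | succ n ih =>
    intro ψ hψ
    have h1 : deriv (trigInt t ψ) = trigInt t' fun p => (p : ℂ) * ψ p :=
      funext fun x => (h.hasDerivAt_trigInt hψ x).deriv
    have h2 : deriv (trigInt t' ψ) = fun x => -trigInt t (fun p => (p : ℂ) * ψ p) x :=
      funext fun x => (h.hasDerivAt_trigInt' hψ x).deriv
    push_cast
    rw [contDiff_succ_iff_deriv, contDiff_succ_iff_deriv, h1, h2]
    refine ⟨⟨fun x => (h.hasDerivAt_trigInt hψ x).differentiableAt, by simp, (ih _ hψ.mul).2⟩,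
      ⟨fun x => (h.hasDerivAt_trigInt' hψ x).differentiableAt, by simp, (ih _ hψ.mul).1.neg⟩⟩

theorem IsTrigKernel.contDiff_trigInt (h : IsTrigKernel j t t') {ψ : ℝ → ℂ} (hψ : HasMoments ψ) :
    ContDiff ℝ ∞ (trigInt t ψ) :=
  contDiff_infty.2 fun n => (h.contDiff_nat_trigInt n ψ hψ).1

theorem IsTrigKernel.abs_sub_le' (h : IsTrigKernel j t t') (u : ℝ) : |t' u - t' 0| ≤ |u| := by
  have := convex_univ.norm_image_sub_le_of_norm_hasDerivWithin_le (f := t') (C := 1)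
    (fun x _ => (h.hasDerivAt' x).hasDerivWithinAt)
    (fun x _ => by rw [norm_neg]; exact h.abs_le x) (mem_univ (0 : ℝ)) (mem_univ u)
  simpa using this

theorem IsTrigKernel.abs_sub_pow_le (h : IsTrigKernel j t t') (u : ℝ) : |t u - u ^ j| ≤ u ^ 2 := by
  have := (convex_uIcc (0 : ℝ) u).norm_image_sub_le_of_norm_hasDerivWithin_le
    (f := fun v => t v - t' 0 * v) (f' := fun v => t' v - t' 0) (C := |u|)
    (fun x _ => by
      have := (h.hasDerivAt x).fun_sub ((hasDerivAt_id' x).const_mul (t' 0))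
      rw [mul_one] at this
      exact this.hasDerivWithinAt)
    (fun x hx => (h.abs_sub_le' x).trans (by
      rcases mem_uIcc.1 hx with hx | hx
      · rw [abs_of_nonneg hx.1]; exact hx.2.trans (le_abs_self u)
      · rw [abs_of_nonpos hx.2]; exact (neg_le_neg hx.1).trans (neg_le_abs u)))
    left_mem_uIcc right_mem_uIcc
  rw [← h.eq_pow u, ← sq_abs u]
  simp only [mul_zero, sub_zero, Real.norm_eq_abs] at this
  calc _ = |t u - t' 0 * u - t 0| := by congr 1; ring
    _ ≤ _ := this
    _ = _ := by ring

/-- Here `x^j` is the first-order Taylor polynomial of `t`. The behaviour of a transform at the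
origin therefore reads off the `j`-th moment, up to `O(x²)`. -/
theorem IsTrigKernel.norm_trigInt_sub_le (h : IsTrigKernel j t t') {ψ : ℝ → ℂ} (hψ : HasMoments ψ)
    (x : ℝ) : ‖trigInt t ψ x - (x : ℂ) ^ j * ∫ p, ψ p * (p : ℂ) ^ j ∂halfLine‖ ≤
      x ^ 2 * ∫ p, ‖(p : ℂ) ^ 2 * ψ p‖ ∂halfLine := by
  have h1 : Integrable (fun p : ℝ => ψ p * (p : ℂ) ^ j) halfLine := by
    simpa only [mul_comm] using hψ j
  rw [trigInt, ← integral_const_mul, ← integral_sub (integrable_trig_mul h.continuous h.abs_le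
    hψ.integrable x) (h1.const_mul _), ← integral_const_mul]
  refine norm_integral_le_of_norm_le ((hψ 2).norm.const_mul _) (Eventually.of_forall fun p => ?_)
  calc ‖(t (x * p) : ℂ) * ψ p - (x : ℂ) ^ j * (ψ p * (p : ℂ) ^ j)‖
      = ‖((t (x * p) - (x * p) ^ j : ℝ) : ℂ) * ψ p‖ := by
        congr 1
        push_cast
        ring
    _ ≤ (x * p) ^ 2 * ‖ψ p‖ := by
        rw [norm_mul, Complex.norm_real]
        gcongr
        exact h.abs_sub_pow_le _
    _ = _ := by
        rw [norm_mul, norm_pow, Complex.norm_real, Real.norm_eq_abs, sq_abs]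
        ring

/-- The value of the derivative at the origin is `t'(0)` times the first moment. It vanishes since
`t'(0) = 0` for the cosine and the first moment is zero in the sine case. -/
theorem IsTrigKernel.norm_trigInt_mul_le (h : IsTrigKernel j t t') {ψ : ℝ → ℂ} (hψ : HasMoments ψ)
    (h0 : ∫ p, ψ p * (p : ℂ) ^ j ∂halfLine = 0) (x : ℝ) :
    ‖trigInt t' (fun p => (p : ℂ) * ψ p) x‖ ≤ |x| * ∫ p, ‖(p : ℂ) ^ 2 * ψ p‖ ∂halfLine := by
  have hz : (t' 0 : ℂ) * ∫ p, (p : ℂ) * ψ p ∂halfLine = 0 := by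
    have h1 := h.eq_pow 1
    have h2 := h.eq_pow 0
    rcases Nat.le_one_iff_eq_zero_or_eq_one.1 h.index_le with rfl | rfl
    · have : t' 0 = 0 := by
        rw [pow_zero] at h1 h2
        linarith
      rw [this, Complex.ofReal_zero, zero_mul]
    · simp only [pow_one] at h0
      simp only [mul_comm (Complex.ofReal _) (ψ _)]
      rw [h0, mul_zero]
  have h1 := hψ.mul.integrable
  rw [← sub_zero (trigInt _ _ x), ← hz, trigInt, ← integral_const_mul,
    ← integral_sub (integrable_trig_mul h.continuous' h.abs_le' h1 x) (h1.const_mul _),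
    ← integral_const_mul]
  refine norm_integral_le_of_norm_le ((hψ 2).norm.const_mul _) (Eventually.of_forall fun p => ?_)
  calc ‖(t' (x * p) : ℂ) * ((p : ℂ) * ψ p) - (t' 0 : ℂ) * ((p : ℂ) * ψ p)‖
      = ‖((t' (x * p) - t' 0 : ℝ) : ℂ) * ((p : ℂ) * ψ p)‖ := by
        congr 1
        push_cast
        ring
    _ ≤ |x * p| * ‖(p : ℂ) * ψ p‖ := by
        rw [norm_mul, Complex.norm_real]
        gcongr
        exact h.abs_sub_le' _
    _ = _ := by
        rw [norm_mul, norm_mul, norm_pow, Complex.norm_real, Real.norm_eq_abs, abs_mul]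
        ring

end TrigInt

/-! ### Cutoff functions -/

/-- A smooth function on the line, equal to `0` on `]-∞,1]` and to `1` on `[2,∞[`. -/
noncomputable def smoothStep (u : ℝ) : ℝ := Real.smoothTransition (u - 1)

theorem contDiff_smoothStep : ContDiff ℝ ∞ smoothStep :=
  Real.smoothTransition.contDiff.comp (contDiff_id.sub contDiff_const)

theorem smoothStep_eventuallyEq {u : ℝ} (hu : u < 1 ∨ 2 < u) :
    ∃ c : ℝ, smoothStep =ᶠ[𝓝 u] fun _ => c := by
  rcases hu with hu | hu
  · refine ⟨0, ?_⟩
    filter_upwards [Iio_mem_nhds hu] with v hv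
    exact Real.smoothTransition.zero_of_nonpos (by simpa using (le_of_lt hv))
  · refine ⟨1, ?_⟩
    filter_upwards [Ioi_mem_nhds hu] with v hv
    have hv' : 2 < v := hv
    exact Real.smoothTransition.one_of_one_le (by linarith)

theorem deriv_smoothStep_of_notMem {u : ℝ} (hu : u < 1 ∨ 2 < u) :
    deriv smoothStep u = 0 ∧ deriv (deriv smoothStep) u = 0 := by
  obtain ⟨c, hc⟩ := smoothStep_eventuallyEq hu
  refine ⟨by rw [hc.deriv_eq]; simp, ?_⟩
  rw [hc.deriv.deriv_eq]
  simp

theorem exists_bound_of_continuous {b : ℝ → ℝ} (hb : Continuous b)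
    (h0 : ∀ u, u < 1 ∨ 2 < u → b u = 0) : ∃ C, 0 ≤ C ∧ ∀ u, |b u| ≤ C := by
  obtain ⟨C, hC⟩ := isCompact_Icc.exists_bound_of_continuousOn (s := Icc (1 : ℝ) 2) hb.continuousOn
  refine ⟨max C 0, le_max_right _ _, fun u => ?_⟩
  by_cases hu : u ∈ Icc (1 : ℝ) 2
  · exact (hC u hu).trans (le_max_left _ _)
  · rw [h0 u, abs_zero]
    · exact le_max_right _ _
    · rw [mem_Icc, not_and_or, not_le, not_le] at hu
      exact hu

/-- Cutoff functions on the half-line, with the scaling behaviour of `x d/dx`. -/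
structure IsCutoff (C : ℝ) (ξ : ℝ → ℝ) : Prop where
  contDiff : ContDiff ℝ ∞ ξ
  hasCompactSupport : HasCompactSupport ξ
  tsupport_subset : tsupport ξ ⊆ Ioi 0
  abs_le : ∀ x, |ξ x| ≤ C
  abs_deriv_le : ∀ x, |x * deriv ξ x| ≤ C
  abs_deriv_deriv_le : ∀ x, |x ^ 2 * deriv (deriv ξ) x| ≤ C

/-- `x ↦ a(ν x) - a(x / ν)` with `a = smoothStep`. -/
noncomputable def cutoff (ν x : ℝ) : ℝ := smoothStep (ν * x) - smoothStep (ν⁻¹ * x)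

theorem deriv_comp_const_mul {f : ℝ → ℝ} (c : ℝ) :
    deriv (fun x => f (c * x)) = fun x => c * deriv f (c * x) := by
  funext x
  have := deriv_comp_mul_left c f x
  simpa using this

theorem deriv_cutoff (ν x : ℝ) : deriv (cutoff ν) x =
    ν * deriv smoothStep (ν * x) - ν⁻¹ * deriv smoothStep (ν⁻¹ * x) := by
  have hd : Differentiable ℝ smoothStep := contDiff_smoothStep.differentiable (by simp)
  have h1 : ∀ c : ℝ, DifferentiableAt ℝ (fun x => smoothStep (c * x)) x := fun c =>
    (hd _).comp x (by fun_prop)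
  change deriv (fun x => smoothStep (ν * x) - smoothStep (ν⁻¹ * x)) x = _
  rw [deriv_fun_sub (h1 _) (h1 _), deriv_comp_const_mul, deriv_comp_const_mul]

theorem deriv_deriv_cutoff (ν x : ℝ) : deriv (deriv (cutoff ν)) x =
    ν ^ 2 * deriv (deriv smoothStep) (ν * x) - ν⁻¹ ^ 2 * deriv (deriv smoothStep) (ν⁻¹ * x) := by
  have hc : ContDiff ℝ ∞ (deriv smoothStep) := by
    simpa using contDiff_smoothStep.iterate_deriv 1
  have hd : Differentiable ℝ (deriv smoothStep) := hc.differentiable (by simp)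
  have h1 : ∀ c : ℝ, DifferentiableAt ℝ (fun x => c * deriv smoothStep (c * x)) x := fun c =>
    ((hd _).comp x (by fun_prop)).const_mul c
  rw [funext (deriv_cutoff ν), deriv_fun_sub (h1 _) (h1 _), deriv_const_mul_field,
    deriv_const_mul_field, deriv_comp_const_mul, deriv_comp_const_mul]
  ring

/-- The expressions `x ξ'` and `x² ξ''` are invariant under dilation, so the bounds for the single
profile `smoothStep` hold for all `ν` with one constant. -/
theorem exists_isCutoff : ∃ C, 0 ≤ C ∧ ∀ ν : ℝ, 1 ≤ ν → IsCutoff C (cutoff ν) := by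
  have hc : ContDiff ℝ ∞ (deriv smoothStep) := by
    simpa using contDiff_smoothStep.iterate_deriv 1
  have hcc : Continuous (deriv (deriv smoothStep)) := hc.continuous_deriv (by simp)
  have hc' := hc.continuous
  obtain ⟨A, hA0, hA⟩ := exists_bound_of_continuous (b := fun u => u * deriv smoothStep u)
    (by fun_prop) (fun u hu => by rw [(deriv_smoothStep_of_notMem hu).1, mul_zero])
  obtain ⟨B, hB0, hB⟩ := exists_bound_of_continuous (b := fun u => u ^ 2 * deriv (deriv smoothStep) u)
    (by fun_prop) (fun u hu => by rw [(deriv_smoothStep_of_notMem hu).2, mul_zero])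
  have h1 : ∀ u, |smoothStep u| ≤ 1 := fun u => by
    rw [smoothStep, abs_of_nonneg (Real.smoothTransition.nonneg _)]
    exact Real.smoothTransition.le_one _
  refine ⟨2 + 2 * A + 2 * B, by positivity, fun ν hν => ?_⟩
  have hν0 : 0 < ν := by linarith
  -- Below `1/ν` both steps are still `0`, and above `2ν` both are already `1`.
  have hs : Function.support (cutoff ν) ⊆ Icc ν⁻¹ (2 * ν) := by
    intro x hx
    by_contra hx'
    refine hx ?_
    rw [mem_Icc, not_and_or, not_le, not_le] at hx'
    rw [cutoff, smoothStep, smoothStep]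
    rcases hx' with hx' | hx'
    · have e1 : ν * x ≤ 1 := by
        calc ν * x ≤ ν * ν⁻¹ := by gcongr
          _ = 1 := mul_inv_cancel₀ hν0.ne'
      have e2 : ν⁻¹ * x ≤ 1 := by
        have : ν⁻¹ ≤ 1 := inv_le_one_of_one_le₀ hν
        calc ν⁻¹ * x ≤ ν⁻¹ * ν⁻¹ := by gcongr
          _ ≤ 1 * 1 := by gcongr
          _ = 1 := one_mul 1
      rw [Real.smoothTransition.zero_of_nonpos (by linarith),
        Real.smoothTransition.zero_of_nonpos (by linarith), sub_zero]
    · have e2 : 2 ≤ ν⁻¹ * x := by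
        calc 2 = ν⁻¹ * (2 * ν) := by field_simp
          _ ≤ _ := by gcongr
      have e1 : 2 ≤ ν * x := by nlinarith
      rw [Real.smoothTransition.one_of_one_le (by linarith),
        Real.smoothTransition.one_of_one_le (by linarith), sub_self]
  have hts : tsupport (cutoff ν) ⊆ Icc ν⁻¹ (2 * ν) := closure_minimal hs isClosed_Icc
  refine ⟨?_, HasCompactSupport.of_support_subset_isCompact isCompact_Icc hs,
    hts.trans fun x hx => (inv_pos.2 hν0).trans_le hx.1, fun x => ?_, fun x => ?_, fun x => ?_⟩
  · exact (contDiff_smoothStep.comp (contDiff_const.mul contDiff_id)).sub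
      (contDiff_smoothStep.comp (contDiff_const.mul contDiff_id))
  · refine (abs_sub _ _).trans ?_
    linarith [h1 (ν * x), h1 (ν⁻¹ * x)]
  · rw [deriv_cutoff]
    calc |x * (ν * deriv smoothStep (ν * x) - ν⁻¹ * deriv smoothStep (ν⁻¹ * x))|
        = |ν * x * deriv smoothStep (ν * x) - ν⁻¹ * x * deriv smoothStep (ν⁻¹ * x)| := by
          congr 1; ring
      _ ≤ _ := (abs_sub _ _).trans (add_le_add (hA _) (hA _))
      _ ≤ _ := by linarith
  · rw [deriv_deriv_cutoff]
    calc |x ^ 2 * (ν ^ 2 * deriv (deriv smoothStep) (ν * x) -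
          ν⁻¹ ^ 2 * deriv (deriv smoothStep) (ν⁻¹ * x))|
        = |(ν * x) ^ 2 * deriv (deriv smoothStep) (ν * x) -
          (ν⁻¹ * x) ^ 2 * deriv (deriv smoothStep) (ν⁻¹ * x)| := by
          congr 1; ring
      _ ≤ _ := (abs_sub _ _).trans (add_le_add (hB _) (hB _))
      _ ≤ _ := by linarith

theorem cutoff_of_lt {ν x : ℝ} (hν : 0 < ν) (h1 : 2 < ν * x) (h2 : x < ν) :
    cutoff ν x = 1 ∧ deriv (cutoff ν) x = 0 ∧ deriv (deriv (cutoff ν)) x = 0 := by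
  have h3 : ν⁻¹ * x < 1 := by
    rw [inv_mul_lt_iff₀ hν]
    simpa using h2
  have e1 := deriv_smoothStep_of_notMem (Or.inr h1)
  have e2 := deriv_smoothStep_of_notMem (Or.inl h3)
  refine ⟨?_, ?_, ?_⟩
  · rw [cutoff, smoothStep, smoothStep, Real.smoothTransition.one_of_one_le (by linarith),
      Real.smoothTransition.zero_of_nonpos (by linarith), sub_zero]
  · rw [deriv_cutoff, e1.1, e2.1, mul_zero, mul_zero, sub_zero]
  · rw [deriv_deriv_cutoff, e1.2, e2.2, mul_zero, mul_zero, sub_zero]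

/-! ### Testing the Bessel equation -/

section Testing

theorem deriv_deriv_mul {F : ℝ → ℂ} {ξ : ℝ → ℝ} (hF : ContDiff ℝ ∞ F) (hξ : ContDiff ℝ ∞ ξ)
    (x : ℝ) : deriv (deriv fun x => (ξ x : ℂ) * F x) x =
      ((deriv (deriv ξ) x : ℝ) : ℂ) * F x + 2 * (((deriv ξ x : ℝ) : ℂ) * deriv F x) +
        (ξ x : ℂ) * deriv (deriv F) x := by
  have hF1 : ContDiff ℝ ∞ (deriv F) := by simpa using hF.iterate_deriv 1
  have hξ1 : ContDiff ℝ ∞ (deriv ξ) := by simpa using hξ.iterate_deriv 1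
  have dF := fun x => (hF.differentiable (by simp) x).hasDerivAt
  have dF1 := fun x => (hF1.differentiable (by simp) x).hasDerivAt
  have dξ := fun x => (hξ.differentiable (by simp) x).hasDerivAt.ofReal_comp
  have dξ1 := fun x => (hξ1.differentiable (by simp) x).hasDerivAt.ofReal_comp
  have e1 : (deriv fun x => (ξ x : ℂ) * F x) =
      fun x => ((deriv ξ x : ℝ) : ℂ) * F x + (ξ x : ℂ) * deriv F x :=
    funext fun x => ((dξ x).fun_mul (dF x)).deriv
  rw [e1, (((dξ1 x).fun_mul (dF x)).fun_add ((dξ x).fun_mul (dF1 x))).deriv]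
  ring

theorem IsCutoff.isTestFunction_mul {C : ℝ} {ξ : ℝ → ℝ} (hξ : IsCutoff C ξ) {F : ℝ → ℂ}
    (hF : ContDiff ℝ ∞ F) : IsTestFunction fun x => (ξ x : ℂ) * F x := by
  have h1 : HasCompactSupport fun x => (ξ x : ℂ) :=
    hξ.hasCompactSupport.comp_left Complex.ofReal_zero
  have h2 : tsupport (fun x => (ξ x : ℂ)) ⊆ Ioi 0 :=
    (tsupport_comp_subset Complex.ofReal_zero ξ).trans hξ.tsupport_subset
  exact ⟨(Complex.ofRealCLM.contDiff.comp hξ.contDiff).mul hF, h1.mul_right,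
    (tsupport_mul_subset_left).trans h2⟩

/-- Each derivative falling on the cutoff costs a factor `1/x`, uniformly in the cutoff. The
right-hand side thus dominates the whole family. -/
theorem IsCutoff.norm_besselExpr_mul_le {C : ℝ} {ξ : ℝ → ℝ} (hξ : IsCutoff C ξ) {F : ℝ → ℂ}
    (hF : ContDiff ℝ ∞ F) (α : ℝ) {x : ℝ} (hx : 0 < x) :
    ‖besselExpr α (fun x => (ξ x : ℂ) * F x) x‖ ≤
      C * (‖deriv (deriv F) x‖ + 2 * ‖deriv F x / x‖ + (1 + |α - 1 / 4|) * ‖F x / (x : ℂ) ^ 2‖) := by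
  have hx0 : (x : ℂ) ≠ 0 := by exact_mod_cast hx.ne'
  have e : besselExpr α (fun x => (ξ x : ℂ) * F x) x =
      -((ξ x : ℂ) * deriv (deriv F) x) - 2 * (((x * deriv ξ x : ℝ) : ℂ) * (deriv F x / x)) -
        ((x ^ 2 * deriv (deriv ξ) x : ℝ) : ℂ) * (F x / (x : ℂ) ^ 2) +
        (ξ x : ℂ) * (((α - 1 / 4 : ℝ) : ℂ) * (F x / (x : ℂ) ^ 2)) := by
    rw [besselExpr, deriv_deriv_mul hF hξ.contDiff]
    push_cast
    field_simp
    ring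
  rw [e]
  refine (norm_add_le _ _).trans (le_trans (add_le_add ((norm_sub_le _ _).trans (add_le_add
    ((norm_sub_le _ _).trans (add_le_add (norm_neg _).le le_rfl)) le_rfl)) le_rfl) ?_)
  simp only [norm_mul, Complex.norm_real, Real.norm_eq_abs, Complex.norm_ofNat]
  have h1 := mul_le_mul_of_nonneg_right (hξ.abs_le x) (norm_nonneg (deriv (deriv F) x))
  have h2 := mul_le_mul_of_nonneg_right (hξ.abs_deriv_le x) (norm_nonneg (deriv F x / x))
  have h3 := mul_le_mul_of_nonneg_right (hξ.abs_deriv_deriv_le x) (norm_nonneg (F x / (x : ℂ) ^ 2))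
  have h4 := mul_le_mul_of_nonneg_right (hξ.abs_le x)
    (mul_nonneg (abs_nonneg (α - 1 / 4)) (norm_nonneg (F x / (x : ℂ) ^ 2)))
  simp only [abs_mul] at h1 h2 h3 h4 ⊢
  linarith

/-- The elements of the graph of `L_α^max` may be tested with functions which, with their
derivatives, are square integrable with the appropriate weights. -/
theorem integral_mul_besselExpr {α : ℝ} {f g : L2Half} (h : (f, g) ∈ besselMaxGraph α) {F : ℝ → ℂ}
    (hF : ContDiff ℝ ∞ F) (h0 : MemLp F 2 halfLine) (h1 : MemLp (fun x => deriv F x / x) 2 halfLine)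
    (h2 : MemLp (deriv (deriv F)) 2 halfLine) (h3 : MemLp (fun x => F x / (x : ℂ) ^ 2) 2 halfLine) :
    ∫ x, f x * besselExpr α F x ∂halfLine = ∫ x, g x * F x ∂halfLine := by
  obtain ⟨C, hC0, hC⟩ := exists_isCutoff
  -- The shift keeps the parameter at least `1`, as the uniform bounds require. At each `x > 0` the
  -- cutoff is eventually `1` with vanishing derivatives, so the commutator terms disappear by
  -- dominated convergence.
  set ξ : ℕ → ℝ → ℝ := fun n => cutoff (n + 1) with hξdef
  have hξ : ∀ n, IsCutoff C (ξ n) := fun n => hC _ (by simp)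
  have hev : ∀ x : ℝ, 0 < x → ∀ᶠ n in atTop, ξ n x = 1 ∧ deriv (ξ n) x = 0 ∧
      deriv (deriv (ξ n)) x = 0 := by
    intro x hx
    obtain ⟨N, hN⟩ := exists_nat_gt (max x (2 / x))
    filter_upwards [eventually_ge_atTop N] with n hn
    have hn' : (N : ℝ) ≤ n := by exact_mod_cast hn
    have e1 : 2 / x < n + 1 := by linarith [(le_max_right _ _).trans_lt hN]
    refine cutoff_of_lt (by positivity) ?_ (by linarith [(le_max_left x (2 / x)).trans_lt hN])
    rwa [div_lt_iff₀ hx] at e1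
  have heq : ∀ n, ∫ x, f x * besselExpr α (fun x => (ξ n x : ℂ) * F x) x ∂halfLine =
      ∫ x, g x * ((ξ n x : ℂ) * F x) ∂halfLine := fun n => h _ ((hξ n).isTestFunction_mul hF)
  have L1 : Tendsto (fun n => ∫ x, f x * besselExpr α (fun x => (ξ n x : ℂ) * F x) x ∂halfLine)
      atTop (𝓝 (∫ x, f x * besselExpr α F x ∂halfLine)) := by
    have hm : MemLp (fun x => C * (‖deriv (deriv F) x‖ + 2 * ‖deriv F x / x‖ +
        (1 + |α - 1 / 4|) * ‖F x / (x : ℂ) ^ 2‖)) 2 halfLine :=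
      ((h2.norm.add (h1.norm.const_mul 2)).add (h3.norm.const_mul _)).const_mul C
    refine tendsto_integral_of_dominated_convergence
      (fun x => ‖f x‖ * (C * (‖deriv (deriv F) x‖ + 2 * ‖deriv F x / x‖ +
        (1 + |α - 1 / 4|) * ‖F x / (x : ℂ) ^ 2‖)))
      (fun n => (integrable_mul_besselExpr α f ((hξ n).isTestFunction_mul hF)).aestronglyMeasurable)
      ((Lp.memLp f).norm.integrable_mul hm) (fun n => ?_) ?_
    · filter_upwards [ae_restrict_mem measurableSet_Ioi] with x hx
      rw [norm_mul]
      gcongr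
      exact (hξ n).norm_besselExpr_mul_le hF α hx
    · filter_upwards [ae_restrict_mem measurableSet_Ioi] with x hx
      refine tendsto_const_nhds.congr' ?_
      filter_upwards [hev x hx] with n hn
      rw [besselExpr, besselExpr, deriv_deriv_mul hF (hξ n).contDiff, hn.1, hn.2.1, hn.2.2]
      simp
  have L2 : Tendsto (fun n => ∫ x, g x * ((ξ n x : ℂ) * F x) ∂halfLine)
      atTop (𝓝 (∫ x, g x * F x ∂halfLine)) := by
    refine tendsto_integral_of_dominated_convergence (fun x => ‖g x‖ * (C * ‖F x‖))
      (fun n => (integrable_mul_test g ((hξ n).isTestFunction_mul hF).1.continuous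
        ((hξ n).isTestFunction_mul hF).2.1).aestronglyMeasurable)
      ((Lp.memLp g).norm.integrable_mul (h0.norm.const_mul C)) (fun n => ?_) ?_
    · refine Eventually.of_forall fun x => ?_
      rw [norm_mul, norm_mul, Complex.norm_real]
      gcongr
      exact (hξ n).abs_le x
    · filter_upwards [ae_restrict_mem measurableSet_Ioi] with x hx
      refine tendsto_const_nhds.congr' ?_
      filter_upwards [hev x hx] with n hn
      rw [hn.1, Complex.ofReal_one, one_mul]
  simp only [heq] at L1
  exact tendsto_nhds_unique L1 L2

end Testing

/-! ### The kernel in position space: division by `x²` -/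

section Transform

variable {j : ℕ} {β : ℝ → ℝ} {k : ℝ → ℝ → ℝ} {t t' : ℝ → ℝ}

/-- Integrability of the double integral with weight `1`. It makes the transform of `∫ k ψ`
available as an honest integral. -/
theorem integrable_kernelInt (hk : IsParityKernel j β k) {ψ : L2Half} (hψ : ψ ∈ momentSpace j) :
    Integrable (kernelInt k ψ) halfLine := by
  obtain ⟨u, hu⟩ := exists_isSqMul_of_isRapidlyDecaying hψ.1
  have h := (integrable_kernel_pairing (φ := fun _ => 1) (isLinearGrowth_of_norm_le_one
    stronglyMeasurable_const (by simp)) hψ.1).integral_prod_left.neg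
  refine h.congr ?_
  filter_upwards [ae_restrict_mem measurableSet_Ioi] with p hp
  have hp0 : 0 < p := hp
  have : ∀ q, {z : ℝ × ℝ | z.1 < z.2}.indicator
      (fun z => (1 : ℂ) * (((z.2 : ℂ) - z.1) * ψ z.2)) (p, q) =
      (Ioi p).indicator (fun q => (((q : ℂ) - p) * ψ q)) q := fun q => by
    simp [indicator_apply]
  rw [Pi.neg_apply]
  simp_rw [this]
  rw [integral_indicator measurableSet_Ioi, Measure.restrict_restrict measurableSet_Ioi,
    inter_eq_left.2 (Ioi_subset_Ioi hp0.le), hu.kernelInt_eq_upper hk hψ.2 hp0]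

/-- Taylor's formula with integral remainder for `p ↦ t(xp)`, using `t'' = -t`. -/
theorem IsTrigKernel.originPrimitive_eq (h : IsTrigKernel j t t') (x q : ℝ) :
    (x : ℂ) ^ 2 * originPrimitive (fun p => (t (x * p) : ℂ)) q =
      (x : ℂ) ^ j * (q : ℂ) ^ j - t (x * q) := by
  have hd : ∀ p : ℝ, HasDerivAt (fun p : ℝ => (q - p) * (x * t' (x * p)) + t (x * p))
      (-(x ^ 2 * ((q - p) * t (x * p)))) p := by
    intro p
    have e1 : HasDerivAt (fun p => x * p) x p := by simpa using (hasDerivAt_id p).const_mul x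
    have h1 := (h.hasDerivAt (x * p)).comp p e1
    have h2 := ((h.hasDerivAt' (x * p)).comp p e1).const_mul x
    have h3 := (((hasDerivAt_id p).const_sub q).mul h2).add h1
    refine h3.congr_deriv ?_
    simp only [id, Function.comp]
    ring
  have hc := h.continuous
  have hi := intervalIntegral.integral_eq_sub_of_hasDerivAt (a := 0) (b := q)
    (fun p _ => hd p) (Continuous.intervalIntegrable (by fun_prop) _ _)
  rw [intervalIntegral.integral_neg, intervalIntegral.integral_const_mul] at hi
  have h4 := h.eq_pow (x * q)
  simp only [mul_zero, sub_self, zero_mul, zero_add, sub_zero] at hi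
  have e : originPrimitive (fun p => (t (x * p) : ℂ)) q =
      ((∫ p in (0 : ℝ)..q, (q - p) * t (x * p) : ℝ) : ℂ) := by
    rw [originPrimitive, ← intervalIntegral.integral_ofReal]
    congr 1 with p
    push_cast
    ring
  rw [e]
  have h5 : x ^ 2 * ∫ p in (0 : ℝ)..q, (q - p) * t (x * p) = x ^ j * q ^ j - t (x * q) := by
    rw [← mul_pow]
    linarith
  exact_mod_cast h5

/-- After transposition the second primitive of `t(xp)` appears. Its term `x^j q^j` pairs to zero
with `ψ`, and the remaining term is the transform of `ψ`. -/
theorem IsTrigKernel.trigInt_kernelInt (h : IsTrigKernel j t t') (hk : IsParityKernel j β k)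
    {ψ : L2Half} (hψ : ψ ∈ momentSpace j) (x : ℝ) :
    (x : ℂ) ^ 2 * trigInt t (kernelInt k ψ) x = trigInt t ψ x := by
  have hc := h.continuous
  have hm : StronglyMeasurable fun p : ℝ => (t (x * p) : ℂ) :=
    Continuous.stronglyMeasurable (by fun_prop)
  have h1 := integral_mul_kernelInt hk (isLinearGrowth_of_norm_le_one hm
    (fun p => by rw [Complex.norm_real]; exact h.abs_le _)) hψ
  rw [trigInt, h1, mul_neg, ← integral_const_mul]
  have h2 : ∫ q, (x : ℂ) ^ 2 * (ψ q * originPrimitive (fun p => (t (x * p) : ℂ)) q) ∂halfLine =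
      ∫ q, ((x : ℂ) ^ j * (ψ q * (q : ℂ) ^ j) - (t (x * q) : ℂ) * ψ q) ∂halfLine := by
    congr 1 with q
    have := h.originPrimitive_eq x q
    linear_combination ψ q * this
  rw [h2, integral_sub ((hψ.1.integrable j).const_mul _)
    (integrable_trig_mul hc h.abs_le hψ.1.hasMoments.integrable x), integral_const_mul, hψ.2,
    mul_zero, zero_sub, neg_neg, trigInt]

end Transform

/-! ### The maximal Bessel operator in the momentum representation -/

section Momentum

variable {j : ℕ} {β : ℝ → ℝ} {k : ℝ → ℝ → ℝ} {t t' : ℝ → ℝ} {U : L2Half →ₗ[ℂ] L2Half}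

theorem sub_quarter_ne_zero {α : ℝ} (hα : α ≠ 1 / 4) : (α : ℂ) - 1 / 4 ≠ 0 := by
  intro h0
  refine hα ?_
  have : ((α : ℝ) : ℂ) = ((1 / 4 : ℝ) : ℂ) := by
    push_cast
    exact sub_eq_zero.1 h0
  exact_mod_cast this

/-- The normalization `√(2/π)` of the sine and cosine transformations. -/
noncomputable def trigConst : ℂ := ((Real.sqrt (2 / Real.pi) : ℝ) : ℂ)

theorem trigConst_ne_zero : trigConst ≠ 0 := by
  have : 0 < Real.sqrt (2 / Real.pi) := by positivity
  rw [trigConst, Complex.ofReal_ne_zero]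
  exact this.ne'

theorem IsTrigTransform.ae_eq (hU : IsTrigTransform t U) {f : L2Half} {F : ℝ → ℂ}
    (hf : f =ᵐ[halfLine] F) (hF : Integrable F halfLine) :
    U f =ᵐ[halfLine] fun x => trigConst * trigInt t F x := by
  filter_upwards [hU.coeFn_eq f (hF.congr hf.symm)] with x hx
  rw [hx, trigConst, trigInt]
  congr 1
  refine integral_congr_ae ?_
  filter_upwards [hf] with p hp
  rw [hp]

theorem IsTrigTransform.integral_map_mul_map (hU : IsTrigTransform t U) (f g : L2Half) :
    ∫ x, U f x * U g x ∂halfLine = ∫ x, f x * g x ∂halfLine := by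
  rw [hU.symm, hU.involutive]

/-- The two bounds control `F/x` near the origin and at infinity; together they give the majorant
`2C/(1+x)`. -/
theorem memLp_of_bounds {F : ℝ → ℂ} (hm : Continuous F) {C : ℝ} (h1 : ∀ x, 0 < x → ‖F x‖ ≤ C * x)
    (h2 : ∀ x, ‖F x‖ ≤ C) : MemLp (fun x => F x / x) 2 halfLine := by
  have hb : MemLp (fun x : ℝ => (2 * C) * (1 + x)⁻¹) 2 halfLine := by
    refine MemLp.const_mul ?_ _
    have hmeas : AEStronglyMeasurable (fun x : ℝ => (1 + x)⁻¹) halfLine := by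
      refine Measurable.aestronglyMeasurable ?_
      fun_prop
    rw [memLp_two_iff_integrable_sq hmeas]
    refine (integrable_inv_one_add_sq.restrict (s := Ioi 0)).mono' (hmeas.pow 2) ?_
    filter_upwards [ae_restrict_mem measurableSet_Ioi] with x hx
    have hx0 : 0 < x := hx
    rw [Real.norm_of_nonneg (by positivity), inv_pow]
    gcongr
    nlinarith
  refine hb.mono' ?_ ?_
  · refine ContinuousOn.aestronglyMeasurable ?_ measurableSet_Ioi
    refine hm.continuousOn.div (by fun_prop) fun x hx => ?_
    have : x ≠ 0 := ne_of_gt hx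
    exact_mod_cast this
  · filter_upwards [ae_restrict_mem measurableSet_Ioi] with x hx
    have hx0 : 0 < x := hx
    rw [norm_div, Complex.norm_real, Real.norm_of_nonneg hx0.le, div_le_iff₀ hx0, ← div_eq_mul_inv,
      div_mul_eq_mul_div, le_div_iff₀ (by positivity)]
    have := h1 x hx0
    have := h2 x
    nlinarith

theorem deriv_deriv_trigInt (ht : IsTrigKernel j t t') {ψ : ℝ → ℂ} (hψ : HasMoments ψ) (x : ℝ) :
    deriv (trigInt t ψ) x = trigInt t' (fun p => (p : ℂ) * ψ p) x ∧
    deriv (deriv (trigInt t ψ)) x = -trigInt t (fun p => (p : ℂ) * ((p : ℂ) * ψ p)) x := by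
  have h1 : deriv (trigInt t ψ) = trigInt t' (fun p => (p : ℂ) * ψ p) :=
    funext fun x => (ht.hasDerivAt_trigInt hψ x).deriv
  rw [h1]
  exact ⟨rfl, (ht.hasDerivAt_trigInt' hψ.mul x).deriv⟩

/-- Position representation of an element of the core. -/
theorem ae_eq_besselExpr_trigInt (hU : IsTrigTransform t U) (ht : IsTrigKernel j t t')
    (hk : IsParityKernel j β k) {α : ℝ} {y : L2Half × L2Half}
    (hy : y ∈ coreGraph α j k hk.eq_or_eq) :
    ∀ᵐ x : ℝ ∂halfLine, U y.2 x = trigConst *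
      (trigInt t (fun p => (p : ℂ) * ((p : ℂ) * y.1 p)) x +
        ((α : ℂ) - 1 / 4) / (x : ℂ) ^ 2 * trigInt t y.1 x) := by
  have hψ : y.1 ∈ momentSpace j := hy.1
  have h2 := hψ.1.hasMoments.mul.mul.integrable
  have h3 := integrable_kernelInt hk hψ
  have hi := h2.add (h3.const_mul ((α : ℂ) - 1 / 4))
  have hv : y.2 =ᵐ[halfLine] (fun p : ℝ => (p : ℂ) * ((p : ℂ) * y.1 p)) +
      fun p => ((α : ℂ) - 1 / 4) * kernelInt k y.1 p := by
    filter_upwards [hy.2] with p hp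
    rw [hp, Pi.add_apply, kernelInt]
    ring
  filter_upwards [hU.ae_eq hv hi, ae_restrict_mem measurableSet_Ioi] with x hx hx0
  have hx1 : (x : ℂ) ≠ 0 := by exact_mod_cast (ne_of_gt hx0 : x ≠ 0)
  rw [hx]
  congr 1
  have e : trigInt t ((fun p : ℝ => (p : ℂ) * ((p : ℂ) * y.1 p)) +
      fun p => ((α : ℂ) - 1 / 4) * kernelInt k y.1 p) x =
      trigInt t (fun p => (p : ℂ) * ((p : ℂ) * y.1 p)) x +
        ((α : ℂ) - 1 / 4) * trigInt t (kernelInt k y.1) x := by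
    rw [trigInt, trigInt, trigInt, ← integral_const_mul,
      ← integral_add (integrable_trig_mul ht.continuous ht.abs_le h2 x)
      ((integrable_trig_mul ht.continuous ht.abs_le h3 x).const_mul _)]
    congr 1 with p
    simp only [Pi.add_apply]
    ring
  rw [e, ← ht.trigInt_kernelInt hk hψ x]
  field_simp

/-- The transform `F` of a core element is not compactly supported in `]0,∞[`. Its decay and its
vanishing at the origin allow it as a test function in `integral_mul_besselExpr`. Moreover `L_α F`
is the transform of `y.2`, so the distributional equation becomes the pairing identity. -/
theorem integral_eq_of_mem_besselMaxGraph (hU : IsTrigTransform t U) (ht : IsTrigKernel j t t')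
    (hk : IsParityKernel j β k) {α : ℝ} (hα : α ≠ 1 / 4) {φ γ : L2Half} (h : (U φ, U γ) ∈ besselMaxGraph α)
    {y : L2Half × L2Half} (hy : y ∈ coreGraph α j k hk.eq_or_eq) :
    ∫ p, φ p * y.2 p ∂halfLine = ∫ p, γ p * y.1 p ∂halfLine := by
  have hψ : y.1 ∈ momentSpace j := hy.1
  have hm := hψ.1.hasMoments
  have hα0 := sub_quarter_ne_zero hα
  obtain ⟨F, hFdef⟩ : ∃ F : ℝ → ℂ, F = fun x => trigConst * trigInt t y.1 x := ⟨_, rfl⟩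
  have hF : ContDiff ℝ ∞ F := hFdef ▸ contDiff_const.mul (ht.contDiff_trigInt hm)
  have hF1 : deriv F = fun x => trigConst * trigInt t' (fun p => (p : ℂ) * y.1 p) x :=
    funext fun x => by
      rw [hFdef, deriv_const_mul_field, (deriv_deriv_trigInt ht hm x).1]
  have hF2 : deriv (deriv F) =
      fun x => -(trigConst * trigInt t (fun p => (p : ℂ) * ((p : ℂ) * y.1 p)) x) :=
    funext fun x => by
      have : deriv F = fun x => trigConst * deriv (trigInt t y.1) x :=
        funext fun x => by rw [hFdef, deriv_const_mul_field]
      rw [this, deriv_const_mul_field, (deriv_deriv_trigInt ht hm x).2, mul_neg]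
  obtain ⟨u, hu⟩ := exists_isSqMul_of_isRapidlyDecaying hψ.1
  have hUψ : U y.1 =ᵐ[halfLine] F := hFdef ▸ hU.ae_eq (ae_eq_refl _) hm.integrable
  have hu' : u =ᵐ[halfLine] fun p : ℝ => (p : ℂ) * ((p : ℂ) * y.1 p) := by
    rw [IsSqMul] at hu
    filter_upwards [hu] with p hp
    rw [hp]
    ring
  have hUu := hU.ae_eq hu' hm.mul.mul.integrable
  have hUv := ae_eq_besselExpr_trigInt hU ht hk hy
  have hL : U y.2 =ᵐ[halfLine] besselExpr α F := by
    filter_upwards [hUv] with x hx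
    rw [hx, besselExpr, hF2, hFdef]
    push_cast
    ring
  have h0 : MemLp F 2 halfLine := (Lp.memLp (U y.1)).ae_eq hUψ
  have h2 : MemLp (deriv (deriv F)) 2 halfLine := by
    rw [hF2]
    exact ((Lp.memLp (U u)).ae_eq hUu).neg
  obtain ⟨M, hM⟩ : ∃ M : ℝ, M = ∫ p : ℝ, ‖(p : ℂ) ^ 2 * y.1 p‖ ∂halfLine := ⟨_, rfl⟩
  obtain ⟨M1, hM1⟩ : ∃ M1 : ℝ, M1 = ∫ p : ℝ, ‖(p : ℂ) * y.1 p‖ ∂halfLine := ⟨_, rfl⟩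
  have hM0 : 0 ≤ M := hM ▸ integral_nonneg fun p => norm_nonneg _
  have hM10 : 0 ≤ M1 := hM1 ▸ integral_nonneg fun p => norm_nonneg _
  have h1 : MemLp (fun x => deriv F x / x) 2 halfLine := by
    refine memLp_of_bounds (C := ‖trigConst‖ * (M + M1)) ?_ (fun x hx => ?_) (fun x => ?_)
    · exact hF.continuous_deriv (by simp)
    · rw [hF1, norm_mul, mul_assoc]
      gcongr
      refine (ht.norm_trigInt_mul_le hm hψ.2 x).trans ?_
      rw [abs_of_pos hx, mul_comm, ← hM]
      gcongr
      linarith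
    · rw [hF1, norm_mul]
      gcongr
      refine (norm_trigInt_le ht.abs_le' hm.mul.integrable x).trans ?_
      rw [← hM1]
      linarith
  -- No estimate is needed: `(α-1/4) F/x² = L_α F + F''` is a sum of two `L²` functions. This is
  -- where `α ≠ 1/4` enters.
  have h3 : MemLp (fun x : ℝ => F x / (x : ℂ) ^ 2) 2 halfLine := by
    have h4 : MemLp ((U y.2 : ℝ → ℂ) + deriv (deriv F)) 2 halfLine := (Lp.memLp (U y.2)).add h2
    refine (h4.const_mul ((α : ℂ) - 1 / 4)⁻¹).ae_eq ?_
    filter_upwards [hL] with x hx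
    rw [Pi.add_apply, hx, besselExpr]
    push_cast
    rw [neg_add_eq_sub, sub_add_cancel, div_mul_eq_mul_div, mul_div_assoc, inv_mul_cancel_left₀ hα0]
  have key := integral_mul_besselExpr h hF h0 h1 h2 h3
  have e1 : ∫ x, U φ x * besselExpr α F x ∂halfLine = ∫ x, U φ x * U y.2 x ∂halfLine :=
    integral_congr_ae (by filter_upwards [hL] with x hx; rw [hx])
  have e2 : ∫ x, U γ x * F x ∂halfLine = ∫ x, U γ x * U y.1 x ∂halfLine :=
    integral_congr_ae (by filter_upwards [hUψ] with x hx; rw [hx])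
  rw [e1, e2, hU.integral_map_mul_map, hU.integral_map_mul_map] at key
  exact key

end Momentum

/-! ### Transforms of test functions -/

section TestTransform

variable {j : ℕ} {β : ℝ → ℝ} {k : ℝ → ℝ → ℝ} {t t' : ℝ → ℝ} {U : L2Half →ₗ[ℂ] L2Half}
  {F : ℝ → ℂ}

theorem IsTestFunction.memLp (hF : IsTestFunction F) : MemLp F 2 halfLine :=
  (hF.1.continuous.memLp_of_hasCompactSupport hF.2.1).restrict _

theorem IsTestFunction.integrable (hF : IsTestFunction F) : Integrable F halfLine :=
  (hF.1.continuous.integrable_of_hasCompactSupport hF.2.1).restrict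

theorem IsTestFunction.deriv (hF : IsTestFunction F) : IsTestFunction (deriv F) :=
  ⟨by simpa using hF.1.iterate_deriv 1, hF.2.1.deriv, (tsupport_deriv_subset (𝕜 := ℝ)).trans hF.2.2⟩

theorem IsTestFunction.eq_zero (hF : IsTestFunction F) {x : ℝ} (hx : x ∉ Ioi 0) : F x = 0 :=
  image_eq_zero_of_notMem_tsupport fun h => hx (hF.2.2 h)

theorem IsTestFunction.exists_eq_zero_near (hF : IsTestFunction F) :
    ∃ δ > 0, ∀ x, x < δ → F x = 0 := by
  have h0 : (0 : ℝ) ∉ tsupport F := fun h => lt_irrefl (0 : ℝ) (hF.2.2 h)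
  obtain ⟨δ, hδ, hb⟩ := Metric.mem_nhds_iff.1 ((isClosed_tsupport F).isOpen_compl.mem_nhds h0)
  refine ⟨δ, hδ, fun x hx => ?_⟩
  by_cases hx0 : 0 < x
  · exact image_eq_zero_of_notMem_tsupport (hb (by simpa [abs_of_pos hx0] using hx))
  · exact hF.eq_zero hx0

theorem IsTestFunction.trigInt_deriv_deriv (hF : IsTestFunction F) (ht : IsTrigKernel j t t')
    (x : ℝ) : trigInt t (_root_.deriv (_root_.deriv F)) x = -((x : ℂ) ^ 2 * trigInt t F x) := by
  have hc := ht.continuous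
  have hc' := ht.continuous'
  have hint : ∀ {s : ℝ → ℝ} {G : ℝ → ℂ}, Continuous s → IsTestFunction G →
      Integrable (fun p => (s (x * p) : ℂ) * G p) := by
    intro s G hs hG
    have hG' := hG.1.continuous
    exact Continuous.integrable_of_hasCompactSupport (by fun_prop) hG.2.1.mul_left
  have hvol : ∀ {G : ℝ → ℂ}, IsTestFunction G →
      trigInt t G x = ∫ p, (t (x * p) : ℂ) * G p := by
    intro G hG
    exact setIntegral_eq_integral_of_forall_compl_eq_zero fun p hp => by
      rw [hG.eq_zero hp, mul_zero]
  have hd : ∀ p : ℝ, HasDerivAt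
      (fun p => (t (x * p) : ℂ) * _root_.deriv F p - (x : ℂ) * ((t' (x * p) : ℂ) * F p))
      ((t (x * p) : ℂ) * _root_.deriv (_root_.deriv F) p + (x : ℂ) ^ 2 * ((t (x * p) : ℂ) * F p)) p := by
    intro p
    have e1 : HasDerivAt (fun p => x * p) x p := by simpa using (hasDerivAt_id p).const_mul x
    have h1 : HasDerivAt (fun p => ((t (x * p) : ℝ) : ℂ)) ((t' (x * p) * x : ℝ) : ℂ) p :=
      ((ht.hasDerivAt (x * p)).comp p e1).ofReal_comp
    have h2 : HasDerivAt (fun p => ((t' (x * p) : ℝ) : ℂ)) ((-t (x * p) * x : ℝ) : ℂ) p :=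
      ((ht.hasDerivAt' (x * p)).comp p e1).ofReal_comp
    have d1 := (hF.1.differentiable (by simp) p).hasDerivAt
    have d2 := (hF.deriv.1.differentiable (by simp) p).hasDerivAt
    refine ((h1.fun_mul d2).fun_sub ((h2.fun_mul d1).const_mul (x : ℂ))).congr_deriv ?_
    push_cast
    ring
  have h0 := integral_eq_zero_of_hasDerivAt_of_integrable hd
    ((hint hc hF.deriv.deriv).add ((hint hc hF).const_mul _))
    ((hint hc hF.deriv).sub ((hint hc' hF).const_mul _))
  rw [integral_add (hint hc hF.deriv.deriv) ((hint hc hF).const_mul _), integral_const_mul] at h0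
  rw [hvol hF.deriv.deriv, hvol hF]
  linear_combination h0

/-- Two derivatives of `F` produce the factor `-x²` in its transform, so smoothness gives decay. -/
theorem IsTestFunction.memLp_pow_mul_trigInt (hU : IsTrigTransform t U) (ht : IsTrigKernel j t t')
    (n : ℕ) : ∀ F : ℝ → ℂ, IsTestFunction F →
      MemLp (fun x : ℝ => (x : ℂ) ^ (2 * n) * trigInt t F x) 2 halfLine := by
  induction n with
  | zero =>
    intro F hF
    have h := hU.ae_eq hF.memLp.coeFn_toLp hF.integrable
    refine ((Lp.memLp (U (hF.memLp.toLp F))).const_mul trigConst⁻¹).ae_eq ?_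
    filter_upwards [h] with x hx
    rw [hx, inv_mul_cancel_left₀ trigConst_ne_zero]
    simp
  | succ n ih =>
    intro F hF
    refine (ih _ hF.deriv.deriv).neg.ae_eq (Eventually.of_forall fun x => ?_)
    simp only [Pi.neg_apply]
    rw [hF.trigInt_deriv_deriv ht]
    ring

theorem IsTestFunction.isRapidlyDecaying (hF : IsTestFunction F) (hU : IsTrigTransform t U)
    (ht : IsTrigKernel j t t') : IsRapidlyDecaying (U (hF.memLp.toLp F)) := by
  intro n
  have h := hU.ae_eq hF.memLp.coeFn_toLp hF.integrable
  have h1 := ((Lp.memLp (U (hF.memLp.toLp F))).integrable_norm_pow two_ne_zero)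
  have h2 := (((IsTestFunction.memLp_pow_mul_trigInt hU ht n F hF).const_mul
    trigConst).integrable_norm_pow two_ne_zero)
  refine (h1.add h2).mono' ?_ ?_
  · exact ((Lp.aestronglyMeasurable _).norm.pow 2).mul (by fun_prop)
  · filter_upwards [h, ae_restrict_mem measurableSet_Ioi] with x hx hx0
    have hx0' : 0 < x := hx0
    have e : trigConst * ((x : ℂ) ^ (2 * n) * trigInt t F x) =
        (x : ℂ) ^ (2 * n) * (trigConst * trigInt t F x) := by ring
    simp only [Pi.add_apply]
    rw [e, ← hx, Real.norm_of_nonneg (by positivity), norm_mul, norm_pow, Complex.norm_real,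
      Real.norm_of_nonneg hx0'.le]
    have hp : x ^ n ≤ 1 + (x ^ (2 * n)) ^ 2 := by
      rw [mul_comm 2 n, pow_mul]
      nlinarith [sq_nonneg (x ^ n - 1), sq_nonneg ((x ^ n) ^ 2 - 1), pow_pos hx0' n]
    nlinarith [mul_le_mul_of_nonneg_left hp (sq_nonneg ‖U (hF.memLp.toLp F) x‖)]

/-- By involutivity `F` is the transform of `ψ = U F`, hence equals a constant times `x^j ∫ ψ p^j +
O(x²)`. Since `F` vanishes near the origin, the moment must be zero. -/
theorem IsTestFunction.mem_momentSpace (hF : IsTestFunction F) (hU : IsTrigTransform t U)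
    (ht : IsTrigKernel j t t') : U (hF.memLp.toLp F) ∈ momentSpace j := by
  have hr := hF.isRapidlyDecaying hU ht
  refine ⟨hr, ?_⟩
  obtain ⟨ψ, hψ⟩ : ∃ ψ, ψ = U (hF.memLp.toLp F) := ⟨_, rfl⟩
  rw [← hψ] at hr ⊢
  have hm := hr.hasMoments
  have h := hU.ae_eq (ae_eq_refl ψ) hm.integrable
  rw [hψ, hU.involutive, ← hψ] at h
  obtain ⟨δ, hδ, hz⟩ := hF.exists_eq_zero_near
  obtain ⟨M, hM⟩ : ∃ M : ℝ, M = ∫ p : ℝ, ‖(p : ℂ) ^ 2 * ψ p‖ ∂halfLine := ⟨_, rfl⟩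
  have hM0 : 0 ≤ M := hM ▸ integral_nonneg fun p => norm_nonneg _
  have hae : ∀ᵐ x : ℝ ∂halfLine, x < δ → trigInt t ψ x = 0 := by
    filter_upwards [h, hF.memLp.coeFn_toLp] with x h1 h2 hx
    rw [h2, hz x hx] at h1
    exact (mul_eq_zero.1 h1.symm).resolve_left trigConst_ne_zero
  -- The transform of `ψ` agrees with `F` only almost everywhere, so suitable zeros are picked in an
  -- interval of positive measure.
  have hex : ∀ ε : ℝ, 0 < ε → ∃ x, 0 < x ∧ x < ε ∧ x < δ ∧ trigInt t ψ x = 0 := by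
    intro ε hε
    have h1 : ∀ᵐ x : ℝ, x ∈ Ioo 0 (min ε δ) → trigInt t ψ x = 0 := by
      filter_upwards [(ae_restrict_iff' measurableSet_Ioi).1 hae] with x h1 h2
      exact h1 h2.1 (h2.2.trans_le (min_le_right _ _))
    have h2 : volume (Ioo 0 (min ε δ)) ≠ 0 := by
      rw [Real.volume_Ioo]
      simpa using ⟨hε, hδ⟩
    obtain ⟨x, hx, hx'⟩ := ((frequently_ae_mem_iff.2 h2).and_eventually h1).exists
    exact ⟨x, hx.1, hx.2.trans_le (min_le_left _ _), hx.2.trans_le (min_le_right _ _), hx' hx⟩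
  by_contra hne
  obtain ⟨a, ha⟩ : ∃ a : ℝ, a = ‖∫ p, ψ p * (p : ℂ) ^ j ∂halfLine‖ := ⟨_, rfl⟩
  have hpos : 0 < a := ha ▸ norm_pos_iff.2 hne
  -- The bound `x < a/(M+1)` gives `x M < a`, which contradicts `a ≤ x² M` if `j = 0` (using `x <
  -- 1`) and `x a ≤ x² M` if `j = 1`.
  obtain ⟨x, h1, h2, h3, h4⟩ := hex (min 1 (a / (M + 1))) (by positivity)
  have h5 := ht.norm_trigInt_sub_le hm x
  rw [h4, zero_sub, norm_neg, norm_mul, norm_pow, Complex.norm_real, Real.norm_of_nonneg h1.le,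
    ← hM, ← ha] at h5
  have h6 := (lt_div_iff₀ (by positivity)).1 (h2.trans_le (min_le_right _ _))
  have h7 := h2.trans_le (min_le_left _ _)
  have h8 : x ^ 2 * M ≤ x * M := by
    gcongr
    nlinarith
  rcases Nat.le_one_iff_eq_zero_or_eq_one.1 ht.index_le with hj | hj
  · rw [hj, pow_zero, one_mul] at h5
    linarith
  · rw [hj, pow_one, sq, mul_assoc] at h5
    linarith [le_of_mul_le_mul_left h5 h1]

/-- Every test function `F` is the transform of a core element, whose image under the core operator
transforms into `L_α F`. Pairing with the core therefore includes all distributional tests. -/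
theorem mem_besselMaxGraph_of_forall (hU : IsTrigTransform t U) (ht : IsTrigKernel j t t')
    (hk : IsParityKernel j β k) {α : ℝ} {φ γ : L2Half}
    (h : ∀ y ∈ coreGraph α j k hk.eq_or_eq,
      ∫ p, φ p * y.2 p ∂halfLine = ∫ p, γ p * y.1 p ∂halfLine) :
    (U φ, U γ) ∈ besselMaxGraph α := by
  intro F hF
  have hψ := hF.mem_momentSpace hU ht
  obtain ⟨v, hv⟩ := exists_mem_coreGraph α hk hψ
  have hm := hψ.1.hasMoments
  have h1 := hU.ae_eq (ae_eq_refl _) hm.integrable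
  rw [hU.involutive] at h1
  have h2 := hU.ae_eq hF.deriv.deriv.memLp.coeFn_toLp hF.deriv.deriv.integrable
  have h3 := hU.ae_eq hF.memLp.coeFn_toLp hF.integrable
  have hUv := ae_eq_besselExpr_trigInt hU ht hk hv
  obtain ⟨u, hu⟩ : ∃ u, u = U (hF.deriv.deriv.memLp.toLp _) := ⟨_, rfl⟩
  have hu1 : u =ᵐ[halfLine] fun p => -((p : ℂ) * ((p : ℂ) * U (hF.memLp.toLp F) p)) := by
    filter_upwards [h2, h3] with p h4 h5
    rw [hu, h4, h5, hF.trigInt_deriv_deriv ht]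
    ring
  have h6 := hU.ae_eq hu1 hm.mul.mul.integrable.neg
  rw [hu, hU.involutive] at h6
  have hL : U v =ᵐ[halfLine] besselExpr α F := by
    filter_upwards [hUv, h1, h6, hF.memLp.coeFn_toLp, hF.deriv.deriv.memLp.coeFn_toLp]
      with x e1 e2 e3 e4 e5
    rw [e4] at e2
    rw [e5] at e3
    rw [e1, besselExpr, e3, e2]
    have e6 : trigInt t (fun p => -((p : ℂ) * ((p : ℂ) * U (hF.memLp.toLp F) p))) x =
        -trigInt t (fun p => (p : ℂ) * ((p : ℂ) * U (hF.memLp.toLp F) p)) x := by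
      rw [trigInt, trigInt, ← integral_neg]
      congr 1 with p
      ring
    rw [e6]
    push_cast
    ring
  have key := h _ hv
  rw [← hU.integral_map_mul_map φ v, ← hU.integral_map_mul_map γ, hU.involutive] at key
  have e1 : ∫ x, U φ x * besselExpr α F x ∂halfLine = ∫ x, U φ x * U v x ∂halfLine :=
    integral_congr_ae (by filter_upwards [hL] with x hx; rw [hx])
  have e2 : ∫ x, U γ x * F x ∂halfLine = ∫ x, U γ x * hF.memLp.toLp F x ∂halfLine :=
    integral_congr_ae (by filter_upwards [hF.memLp.coeFn_toLp] with x hx; rw [hx])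
  simp only at key ⊢
  rw [e1, e2, key]

theorem mem_besselMaxGraph_iff (hU : IsTrigTransform t U) (ht : IsTrigKernel j t t')
    (hk : IsParityKernel j β k) {α : ℝ} (hα : α ≠ 1 / 4) {φ γ : L2Half} :
    (U φ, U γ) ∈ besselMaxGraph α ↔ ∃ c : ℂ, ∀ᵐ p : ℝ ∂halfLine, γ p =
      (p : ℂ) ^ 2 * φ p - ((α : ℂ) - 1 / 4) * originPrimitive φ p + c * (p : ℂ) ^ j := by
  rw [← forall_coreGraph_iff α hk]
  exact ⟨fun h y hy => integral_eq_of_mem_besselMaxGraph hU ht hk hα h hy,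
    fun h => mem_besselMaxGraph_of_forall hU ht hk h⟩

end TestTransform

/-! ### Graph and domain of the maximal momentum operator -/

theorem originPrimitive_eq_sub (φ : L2Half) {q : ℝ} (hq : 0 ≤ q) :
    originPrimitive φ q = q * (∫ p in (0 : ℝ)..q, φ p) - ∫ p in (0 : ℝ)..q, (p : ℂ) * φ p := by
  have hi := intervalIntegrable_of_L2 φ le_rfl hq
  rw [originPrimitive, ← intervalIntegral.integral_const_mul, ← intervalIntegral.integral_sub]
  · congr 1 with p
    ring
  · exact hi.const_mul _
  · exact hi.continuousOn_mul (by fun_prop)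

/-- `ψ` is regular near the origin and equal to `e(p) / p²` at infinity, where `e` solves the Euler
equation; `b` is the divergent part of its integral against `β`. -/
def IsTail (α : ℝ) (j : ℕ) (β : ℝ → ℝ) (e b : ℝ → ℂ) (ψ : L2Half) (κ : ℂ) : Prop :=
  ∃ Λ₀ : ℝ, 0 < Λ₀ ∧ (∀ᵐ p : ℝ ∂halfLine, Λ₀ < p → (p : ℂ) ^ 2 * ψ p = e p) ∧
    (∀ Λ, Λ₀ ≤ Λ → (∫ q in (0 : ℝ)..Λ, (β q : ℂ) * ψ q) = b Λ + κ) ∧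
    ∀ p, Λ₀ < p → ((α : ℂ) - 1 / 4) * (κ * (p : ℂ) ^ j - originPrimitive ψ p) = -e p

theorem mem_graph_conjugateBy_iff {U : L2Half →ₗ[ℂ] L2Half} (hU : ∀ f, U (U f) = f)
    {A : L2Half →ₗ.[ℂ] L2Half} {φ γ : L2Half} :
    (φ, γ) ∈ (conjugateBy U A).graph ↔ (U φ, U γ) ∈ A.graph := by
  rw [LinearPMap.mem_graph_iff, LinearPMap.mem_graph_iff]
  constructor
  · rintro ⟨y, rfl, h⟩
    refine ⟨⟨U y, y.2⟩, rfl, ?_⟩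
    simp only at h
    rw [← h]
    exact (hU _).symm
  · rintro ⟨y, hy, h⟩
    have hφ : U φ ∈ A.domain := by
      have := y.2
      rwa [hy] at this
    refine ⟨⟨φ, hφ⟩, rfl, ?_⟩
    have e : y = ⟨U φ, hφ⟩ := Subtype.ext hy
    rw [e] at h
    calc _ = U (A ⟨U φ, hφ⟩) := rfl
      _ = γ := by rw [h, hU]

section MomentumMax

variable {j : ℕ} {β : ℝ → ℝ} {k : ℝ → ℝ → ℝ} {t t' : ℝ → ℝ} {U : L2Half →ₗ[ℂ] L2Half} {α : ℝ}

theorem mem_graph_iff (hU : IsTrigTransform t U) (ht : IsTrigKernel j t t')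
    (hk : IsParityKernel j β k) (hα : α ≠ 1 / 4) {φ γ : L2Half} :
    (φ, γ) ∈ (conjugateBy U (besselMax α)).graph ↔ ∃ c : ℂ, ∀ᵐ p : ℝ ∂halfLine, γ p =
      (p : ℂ) ^ 2 * φ p - ((α : ℂ) - 1 / 4) * originPrimitive φ p + c * (p : ℂ) ^ j := by
  rw [mem_graph_conjugateBy_iff hU.involutive, besselMax_graph, mem_besselMaxGraph_iff hU ht hk hα]

/-- As a transpose, the operator has a graph cut out by continuous bilinear conditions, one for each
core element. -/
theorem isClosed_conjugateBy_besselMax (hU : IsTrigTransform t U) (ht : IsTrigKernel j t t')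
    (hk : IsParityKernel j β k) (hα : α ≠ 1 / 4) : (conjugateBy U (besselMax α)).IsClosed := by
  have e : ((conjugateBy U (besselMax α)).graph : Set (L2Half × L2Half)) =
      ⋂ y ∈ coreGraph α j k hk.eq_or_eq, {z : L2Half × L2Half |
        ∫ p, z.1 p * (y : L2Half × L2Half).2 p ∂halfLine = ∫ p, z.2 p * y.1 p ∂halfLine} := by
    ext ⟨φ, γ⟩
    rw [SetLike.mem_coe, mem_graph_iff hU ht hk hα, ← forall_coreGraph_iff α hk]
    simp only [mem_iInter, mem_ofPred_eq]
  rw [LinearPMap.IsClosed, e]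
  refine isClosed_biInter fun y _ => isClosed_eq ?_ ?_
  · exact (continuous_integral_mul_left y.2).comp continuous_fst
  · exact (continuous_integral_mul_left y.1).comp continuous_snd

/-- The minimal operator is contained in the maximal one: `kernelInt_eq_lower` has the shape of the
graph condition, with `c = (α-1/4) ∫ β ψ`. -/
theorem exists_mem_graph_of_isSqMul (hU : IsTrigTransform t U) (ht : IsTrigKernel j t t')
    (hk : IsParityKernel j β k) (hα : α ≠ 1 / 4) {ψ u : L2Half} (h : IsSqMul ψ u)
    (h0 : ∫ p, ψ p * (p : ℂ) ^ j ∂halfLine = 0) :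
    ∃ v, (ψ, v) ∈ (conjugateBy U (besselMax α)).graph ∧
      ∀ᵐ p : ℝ ∂halfLine, v p = (p : ℂ) ^ 2 * ψ p + ((α : ℂ) - 1 / 4) * kernelInt k ψ p := by
  have hm := h.memLp_kernelInt hk h0
  have hv : ∀ᵐ p : ℝ ∂halfLine, (u + ((α : ℂ) - 1 / 4) • hm.toLp _ : L2Half) p =
      (p : ℂ) ^ 2 * ψ p + ((α : ℂ) - 1 / 4) * kernelInt k ψ p := by
    rw [IsSqMul] at h
    filter_upwards [h, hm.coeFn_toLp, Lp.coeFn_add u (((α : ℂ) - 1 / 4) • hm.toLp _),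
      Lp.coeFn_smul ((α : ℂ) - 1 / 4) (hm.toLp _)] with p h1 h2 h3 h4
    rw [h3, Pi.add_apply, h4, Pi.smul_apply, h2, h1, smul_eq_mul]
  refine ⟨_, (mem_graph_iff hU ht hk hα).2
    ⟨((α : ℂ) - 1 / 4) * ∫ q, (β q : ℂ) * ψ q ∂halfLine, ?_⟩, hv⟩
  filter_upwards [hv, ae_restrict_mem measurableSet_Ioi] with p h1 h2
  rw [h1, h.kernelInt_eq_lower hk h2]
  ring

/-- Beyond `Λ₀` the terms `p² ψ = e` and `(α-1/4)(κ p^j - ∫₀^p (p-q) ψ(q) dq) = -e` cancel exactly.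
The image therefore has bounded support and lies in `L²`, although neither term needs to. -/
theorem IsTail.exists_mem_graph (hU : IsTrigTransform t U) (ht : IsTrigKernel j t t')
    (hk : IsParityKernel j β k) (hα : α ≠ 1 / 4) {e b : ℝ → ℂ} {ψ : L2Half} {κ : ℂ}
    (h : IsTail α j β e b ψ κ) :
    ∃ v, (ψ, v) ∈ (conjugateBy U (besselMax α)).graph ∧
      ∀ᵐ p : ℝ ∂halfLine, v p = (p : ℂ) ^ 2 * ψ p +
        ((α : ℂ) - 1 / 4) * (κ * (p : ℂ) ^ j - originPrimitive ψ p) := by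
  obtain ⟨Λ₀, h0, h1, h2, h3⟩ := h
  obtain ⟨n, hn⟩ := exists_nat_gt Λ₀
  have hm := memLp_indicator_defect α ψ 0 ht.index_le (-(((α : ℂ) - 1 / 4) * κ)) n
  have hv : ∀ᵐ p : ℝ ∂halfLine, hm.toLp _ p = (p : ℂ) ^ 2 * ψ p +
        ((α : ℂ) - 1 / 4) * (κ * (p : ℂ) ^ j - originPrimitive ψ p) := by
    filter_upwards [hm.coeFn_toLp, h1, coeFn_zero_half] with p h4 h5 h6
    rw [h4]
    by_cases hp : p < n
    · rw [indicator_of_mem (by exact hp), defect, h6]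
      ring
    · have hp' : Λ₀ < p := hn.trans_le (not_lt.1 hp)
      rw [indicator_of_notMem (by exact hp), h5 hp', h3 p hp', add_neg_cancel]
  refine ⟨_, (mem_graph_iff hU ht hk hα).2 ⟨((α : ℂ) - 1 / 4) * κ, ?_⟩, hv⟩
  filter_upwards [hv] with p h1
  rw [h1]
  ring

/-- An element of the domain with square integrable `p² ψ` has a vanishing moment. -/
theorem integral_eq_zero_of_mem_graph (hU : IsTrigTransform t U) (ht : IsTrigKernel j t t')
    (hk : IsParityKernel j β k) (hα : α ≠ 1 / 4) {ψ u v : L2Half} (h : IsSqMul ψ u)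
    (hv : (ψ, v) ∈ (conjugateBy U (besselMax α)).graph) :
    ∫ p, ψ p * (p : ℂ) ^ j ∂halfLine = 0 := by
  obtain ⟨χ, υ, hχ, hχ0, hχ1⟩ := exists_unit_moment j
  obtain ⟨μ, hμ⟩ : ∃ μ, μ = ∫ p, ψ p * (p : ℂ) ^ j ∂halfLine := ⟨_, rfl⟩
  have h1 := (mem_weightedSpace hk.index_le).1 (sub_smul_mem_weightedSpace hk.index_le h hχ hχ1)
  rw [← hμ] at h1 ⊢
  obtain ⟨w, hw, -⟩ := exists_mem_graph_of_isSqMul hU ht hk hα h1.1 h1.2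
  -- If the moment were nonzero, subtracting an element of the minimal domain would put `χ` itself
  -- in the maximal domain. Beyond its support its image is affine, with a coefficient `±(α-1/4)`
  -- that nothing cancels, hence not in `L²`.
  by_contra hμ0
  have h2 := Submodule.smul_mem _ μ⁻¹ (Submodule.sub_mem _ hv hw)
  have e : μ⁻¹ • ((ψ, v) - (((ψ, u) - μ • (χ, υ)).1, w)) = (χ, μ⁻¹ • (v - w)) := by
    refine Prod.ext ?_ rfl
    simp [smul_smul, inv_mul_cancel₀ hμ0]
  rw [e] at h2
  obtain ⟨c, hc⟩ := (mem_graph_iff hU ht hk hα).1 h2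
  obtain ⟨I0, hI0⟩ : ∃ I, I = ∫ p, χ p ∂halfLine := ⟨_, rfl⟩
  obtain ⟨I1, hI1⟩ : ∃ I, I = ∫ p : ℝ, (p : ℂ) * χ p ∂halfLine := ⟨_, rfl⟩
  have hP : ∀ p : ℝ, 1 < p → originPrimitive χ p = p * I0 - I1 := by
    intro p hp
    have hp0 : 0 < p := by linarith
    have key : ∀ g : ℝ → ℂ, ∫ q in (0 : ℝ)..p, g q * χ q = ∫ q, g q * χ q ∂halfLine := by
      intro g
      rw [intervalIntegral.integral_of_le hp0.le]
      refine (setIntegral_eq_of_subset_of_ae_sdiff_eq_zero measurableSet_Ioi.nullMeasurableSet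
        (fun x hx => hx.1) ?_).symm
      filter_upwards [(ae_restrict_iff' measurableSet_Ioi).1 hχ0] with q hq hq'
      rw [hq hq'.1, mul_zero]
      by_contra hlt
      exact hq'.2 ⟨hq'.1, by linarith⟩
    rw [originPrimitive_eq_sub χ hp0.le, key, hI0, hI1]
    have := key fun _ => 1
    simp only [one_mul] at this
    rw [this]
  have hα0 := sub_quarter_ne_zero hα
  have hL : ∀ d₁ d₂ : ℂ, (∀ᵐ p : ℝ ∂halfLine, 1 < p → (μ⁻¹ • (v - w) : L2Half) p = d₁ + d₂ * p) →
      d₁ = 0 ∧ d₂ = 0 := by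
    intro d₁ d₂ hd
    -- For `m = 1/2` the Euler solutions are `1` and `p`.
    refine eq_zero_of_memLp_euler (m := 1 / 2) (Λ := 1) (by norm_num) one_pos ?_
    have hm : MemLp (μ⁻¹ • (v - w) : L2Half) 2 (volume.restrict (Ioi 1)) :=
      (Lp.memLp _).mono_measure (Measure.restrict_mono (Ioi_subset_Ioi zero_le_one) le_rfl)
    refine hm.ae_eq ?_
    rw [EventuallyEq, ae_restrict_iff' measurableSet_Ioi]
    rw [ae_restrict_iff' measurableSet_Ioi] at hd
    filter_upwards [hd] with p h3 h4
    have h5 : (1 : ℝ) < p := h4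
    rw [h3 (show 0 < p by linarith) h5, eulerFst, eulerSnd, if_neg (by norm_num)]
    norm_num
  have hae : ∀ᵐ p : ℝ ∂halfLine, 1 < p → (μ⁻¹ • (v - w) : L2Half) p =
      ((α : ℂ) - 1 / 4) * I1 + (-(((α : ℂ) - 1 / 4) * I0)) * p + c * (p : ℂ) ^ j := by
    filter_upwards [hc, hχ0] with p h3 h4 h5
    rw [h3, h4 h5.le, hP p h5]
    ring
  rcases Nat.le_one_iff_eq_zero_or_eq_one.1 ht.index_le with hj | hj
  · rw [hj] at hae hχ1
    simp only [pow_zero, mul_one] at hae hχ1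
    have := (hL (((α : ℂ) - 1 / 4) * I1 + c) (-(((α : ℂ) - 1 / 4) * I0))
      (hae.mono fun p h3 h4 => by rw [h3 h4]; ring)).2
    rw [hI0, hχ1, mul_one, neg_eq_zero] at this
    exact hα0 this
  · rw [hj] at hae hχ1
    simp only [pow_one] at hae hχ1
    have := (hL (((α : ℂ) - 1 / 4) * I1) (-(((α : ℂ) - 1 / 4) * I0) + c)
      (hae.mono fun p h3 h4 => by rw [h3 h4]; ring)).1
    rw [hI1] at this
    simp only [mul_comm (Complex.ofReal _) (χ _)] at this
    rw [hχ1, mul_one] at this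
    exact hα0 this

end MomentumMax

/-! ### Asymptotic coefficients, regularized integrals and uniqueness -/

section Domain

variable {j : ℕ} {β : ℝ → ℝ} {k : ℝ → ℝ → ℝ} {t t' : ℝ → ℝ} {U : L2Half →ₗ[ℂ] L2Half} {α : ℝ}
  {m : ℂ} {b₁ b₂ : ℝ → ℂ} {ψ₁ ψ₂ : L2Half} {κ₁ κ₂ : ℂ}

theorem coeFn_sub_smul_smul (ψ ψ₁ ψ₂ : L2Half) (c₁ c₂ : ℂ) :
    ∀ᵐ p ∂halfLine, (ψ - c₁ • ψ₁ - c₂ • ψ₂) p = ψ p - c₁ * ψ₁ p - c₂ * ψ₂ p := by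
  filter_upwards [Lp.coeFn_sub (ψ - c₁ • ψ₁) (c₂ • ψ₂), Lp.coeFn_sub ψ (c₁ • ψ₁),
    Lp.coeFn_smul c₁ ψ₁, Lp.coeFn_smul c₂ ψ₂] with p h1 h2 h3 h4
  rw [h1, Pi.sub_apply, h2, Pi.sub_apply, h3, h4, Pi.smul_apply, Pi.smul_apply, smul_eq_mul,
    smul_eq_mul]

theorem exists_isSqMul_of_tail {ψ ρ : L2Half} {Λ : ℝ}
    (h : ∀ᵐ p : ℝ ∂halfLine, Λ < p → (p : ℂ) ^ 2 * ψ p = ρ p) : ∃ u, IsSqMul ψ u := by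
  have hm : MemLp (fun p : ℝ => (p : ℂ) ^ 2 * ψ p) 2 halfLine := by
    refine (((Lp.memLp ψ).norm.const_mul (Λ ^ 2)).add (Lp.memLp ρ).norm).mono' ?_ ?_
    · exact AEStronglyMeasurable.mul (by fun_prop) (Lp.aestronglyMeasurable ψ)
    · filter_upwards [h, ae_restrict_mem measurableSet_Ioi] with p hp hp0
      have hp0' : 0 < p := hp0
      simp only [Pi.add_apply]
      by_cases hpΛ : Λ < p
      · rw [hp hpΛ]
        have : 0 ≤ Λ ^ 2 * ‖ψ p‖ := by positivity
        linarith
      · rw [norm_mul, norm_pow, Complex.norm_real, Real.norm_of_nonneg hp0'.le]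
        have : p ^ 2 * ‖ψ p‖ ≤ Λ ^ 2 * ‖ψ p‖ := by
          gcongr
          exact not_lt.1 hpΛ
        have := norm_nonneg (ρ p)
        linarith
  exact ⟨hm.toLp _, hm.coeFn_toLp⟩

theorem eq_zero_of_isSqMul_tail (hm1 : |m.re| < 1) (h₁ : IsTail α j β (eulerFst m) b₁ ψ₁ κ₁)
    (h₂ : IsTail α j β (eulerSnd m) b₂ ψ₂ κ₂) {c₁ c₂ : ℂ} {u : L2Half}
    (h : IsSqMul (c₁ • ψ₁ + c₂ • ψ₂) u) : c₁ = 0 ∧ c₂ = 0 := by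
  obtain ⟨Λ₁, hΛ₁, e₁, -, -⟩ := h₁
  obtain ⟨Λ₂, hΛ₂, e₂, -, -⟩ := h₂
  have hΛ : 0 < max Λ₁ Λ₂ := lt_max_of_lt_left hΛ₁
  refine eq_zero_of_memLp_euler hm1 hΛ ?_
  have hm : MemLp u 2 (volume.restrict (Ioi (max Λ₁ Λ₂))) :=
    (Lp.memLp u).mono_measure (Measure.restrict_mono (Ioi_subset_Ioi hΛ.le) le_rfl)
  refine hm.ae_eq ?_
  have hae : ∀ᵐ p : ℝ ∂halfLine, max Λ₁ Λ₂ < p → u p = c₁ * eulerFst m p + c₂ * eulerSnd m p := by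
    rw [IsSqMul] at h
    filter_upwards [h, e₁, e₂, Lp.coeFn_add (c₁ • ψ₁) (c₂ • ψ₂), Lp.coeFn_smul c₁ ψ₁,
      Lp.coeFn_smul c₂ ψ₂] with p a1 a2 a3 a4 a5 a6 hp
    rw [a1, a4, Pi.add_apply, a5, a6, Pi.smul_apply, Pi.smul_apply, smul_eq_mul, smul_eq_mul,
      ← a2 ((le_max_left _ _).trans_lt hp), ← a3 ((le_max_right _ _).trans_lt hp)]
    ring
  rw [EventuallyEq, ae_restrict_iff' measurableSet_Ioi]
  rw [ae_restrict_iff' measurableSet_Ioi] at hae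
  filter_upwards [hae] with p h3 h4
  exact h3 (hΛ.trans h4) h4

/-- The asymptotics at infinity of the elements of the domain of the maximal operator. -/
theorem exists_coeff (hU : IsTrigTransform t U) (ht : IsTrigKernel j t t')
    (hk : IsParityKernel j β k) (hα : α ≠ 1 / 4) (hm : m ^ 2 = (α : ℂ)) (hm1 : |m.re| < 1)
    (h₁ : IsTail α j β (eulerFst m) b₁ ψ₁ κ₁) (h₂ : IsTail α j β (eulerSnd m) b₂ ψ₂ κ₂)
    {φ γ : L2Half} (h : (φ, γ) ∈ (conjugateBy U (besselMax α)).graph) :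
    ∃ c₁ c₂ : ℂ, (∃ u, IsSqMul (φ - c₁ • ψ₁ - c₂ • ψ₂) u) ∧
      ∫ p, (φ - c₁ • ψ₁ - c₂ • ψ₂ : L2Half) p * (p : ℂ) ^ j ∂halfLine = 0 := by
  have hα0 := sub_quarter_ne_zero hα
  obtain ⟨ν, hν⟩ : ∃ ν : ℂ, ν = (α : ℂ) - 1 / 4 := ⟨_, rfl⟩
  obtain ⟨v₁, hv₁, -⟩ := h₁.exists_mem_graph hU ht hk hα
  obtain ⟨v₂, hv₂, -⟩ := h₂.exists_mem_graph hU ht hk hα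
  obtain ⟨c, hc⟩ := (mem_graph_iff hU ht hk hα).1 h
  rw [← hν] at hc hα0
  obtain ⟨_, -, hE⟩ := exists_euler_bound hm1
  -- The affine correction `-(c/ν) p^j` removes the free term of the graph condition, which then
  -- becomes the Euler equation with right-hand side `γ`.
  obtain ⟨d₁, d₂, ρ, -, hρ⟩ := hE φ γ _ _
    ((isSecondPrimitive_originPrimitive φ).add_mul_pow hk.index_le (-(c / ν))) (by
      filter_upwards [hc] with p hp
      rw [hp, hm, show (1 / 4 - (α : ℂ)) = -ν by rw [hν]; ring]
      field_simp
      ring)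
  obtain ⟨Λ₁, hΛ₁, e₁, -, -⟩ := id h₁
  obtain ⟨Λ₂, hΛ₂, e₂, -, -⟩ := id h₂
  -- Since `p² φ = γ + ν Φ`, the coefficients of the tails are `ν` times those of the Euler
  -- solutions.
  have htail : ∀ᵐ p : ℝ ∂halfLine, max Λ₁ Λ₂ < p →
      (p : ℂ) ^ 2 * (φ - (ν * d₁) • ψ₁ - (ν * d₂) • ψ₂ : L2Half) p = (γ + ν • ρ : L2Half) p := by
    filter_upwards [hc, hρ, e₁, e₂, coeFn_sub_smul_smul φ ψ₁ ψ₂ (ν * d₁) (ν * d₂),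
      Lp.coeFn_add γ (ν • ρ), Lp.coeFn_smul ν ρ] with p a1 a2 a3 a4 a5 a6 a7 hp
    have b1 := a3 ((le_max_left _ _).trans_lt hp)
    have b2 := a4 ((le_max_right _ _).trans_lt hp)
    rw [a5, a6, Pi.add_apply, a7, Pi.smul_apply, smul_eq_mul, a1]
    have b3 : ν * (c / ν) = c := by field_simp
    linear_combination ν * a2 - (ν * d₁) * b1 - (ν * d₂) * b2 + (p : ℂ) ^ j * b3
  obtain ⟨u, hu⟩ := exists_isSqMul_of_tail htail
  refine ⟨_, _, ⟨u, hu⟩, integral_eq_zero_of_mem_graph hU ht hk hα hu (Submodule.sub_mem _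
    (Submodule.sub_mem _ h (Submodule.smul_mem _ (ν * d₁) hv₁)) (Submodule.smul_mem _ (ν * d₂) hv₂))⟩

theorem IsParityKernel.intervalIntegral_eq (hk : IsParityKernel j β k) (ψ : L2Half) {p Λ : ℝ}
    (hp : 0 ≤ p) (hΛ : p ≤ Λ) : ∫ q in (0 : ℝ)..Λ, (k p q : ℂ) * ψ q =
      (∫ q in (0 : ℝ)..Λ, (β q : ℂ) * ψ q) * (p : ℂ) ^ j - originPrimitive ψ p := by
  have hc := hk.continuous
  have hi := intervalIntegrable_of_L2 ψ le_rfl (hp.trans hΛ)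
  have h1 : IntervalIntegrable (fun q => (β q : ℂ) * ψ q) volume 0 Λ :=
    hi.continuousOn_mul (by fun_prop)
  have h2 : IntervalIntegrable (fun q => ((max (p - q) 0 : ℝ) : ℂ) * ψ q) volume 0 Λ :=
    hi.continuousOn_mul (by fun_prop)
  have e1 : ∫ q in (0 : ℝ)..Λ, (k p q : ℂ) * ψ q =
      ∫ q in (0 : ℝ)..Λ, ((β q : ℂ) * ψ q * (p : ℂ) ^ j - ((max (p - q) 0 : ℝ) : ℂ) * ψ q) := by
    congr 1 with q
    rw [hk.eq_lower]
    push_cast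
    ring
  rw [e1, intervalIntegral.integral_sub (h1.mul_const _) h2, intervalIntegral.integral_mul_const]
  congr 1
  have hz : ∫ q in p..Λ, ((max (p - q) 0 : ℝ) : ℂ) * ψ q = 0 := by
    refine (intervalIntegral.integral_congr (g := fun _ => 0) fun q hq => ?_).trans (by simp)
    rw [uIcc_of_le hΛ] at hq
    simp only
    rw [max_eq_right (by linarith [hq.1]), Complex.ofReal_zero, zero_mul]
  have hs1 : IntervalIntegrable (fun q => ((max (p - q) 0 : ℝ) : ℂ) * ψ q) volume 0 p :=
    (intervalIntegrable_of_L2 ψ le_rfl hp).continuousOn_mul (by fun_prop)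
  have hs2 : IntervalIntegrable (fun q => ((max (p - q) 0 : ℝ) : ℂ) * ψ q) volume p Λ :=
    (intervalIntegrable_of_L2 ψ hp (hp.trans hΛ)).continuousOn_mul (by fun_prop)
  rw [← intervalIntegral.integral_add_adjacent_intervals hs1 hs2, hz, add_zero, originPrimitive]
  refine intervalIntegral.integral_congr fun q hq => ?_
  rw [uIcc_of_le hp] at hq
  rw [max_eq_left (by linarith [hq.2])]
  push_cast
  ring

/-- The regularized integral does not depend on `Λ` once `Λ ≥ max p Λ₀`. -/
theorem IsTail.tendsto (hk : IsParityKernel j β k) {e b : ℝ → ℂ} {ψ : L2Half} {κ : ℂ}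
    (h : IsTail α j β e b ψ κ) {p : ℝ} (hp : 0 < p) :
    Tendsto (fun Λ : ℝ => (∫ q in (0 : ℝ)..Λ, (k p q : ℂ) * ψ q) - (p : ℂ) ^ j * b Λ) atTop
      (𝓝 (κ * (p : ℂ) ^ j - originPrimitive ψ p)) := by
  obtain ⟨Λ₀, h0, -, h2, -⟩ := h
  refine tendsto_const_nhds.congr' ?_
  filter_upwards [eventually_ge_atTop (max p Λ₀)] with Λ hΛ
  rw [hk.intervalIntegral_eq ψ hp.le ((le_max_left _ _).trans hΛ), h2 Λ ((le_max_right _ _).trans hΛ)]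
  ring

theorem tendsto_kernelInt (hk : IsParityKernel j β k) {ψ u : L2Half} (h : IsSqMul ψ u) (p : ℝ) :
    Tendsto (fun Λ : ℝ => ∫ q in (0 : ℝ)..Λ, (k p q : ℂ) * ψ q) atTop (𝓝 (kernelInt k ψ p)) :=
  intervalIntegral_tendsto_integral_Ioi 0 (h.integrable_kernel hk.eq_or_eq p) tendsto_id

/-- The counterterm is minus the combination of the divergent parts `b₁`, `b₂`. By linearity the
limit splits into a convergent kernel integral for the minimal part and the two regularized tails,
and this is how the conjugated operator acts. -/
theorem isMomentumMax_conjugateBy (hU : IsTrigTransform t U) (ht : IsTrigKernel j t t')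
    (hk : IsParityKernel j β k) (hα : α ≠ 1 / 4) (hm : m ^ 2 = (α : ℂ)) (hm1 : |m.re| < 1)
    (h₁ : IsTail α j β (eulerFst m) b₁ ψ₁ κ₁) (h₂ : IsTail α j β (eulerSnd m) b₂ ψ₂ κ₂)
    {ct : ℂ → ℂ → ℝ → ℝ → ℂ}
    (hct : ∀ c₁ c₂ Λ p, 0 < Λ → ct c₁ c₂ Λ p = -((p : ℂ) ^ j * (c₁ * b₁ Λ + c₂ * b₂ Λ))) :
    IsMomentumMax α (coreGraph α j k hk.eq_or_eq).toLinearPMap.closure k ct ψ₁ ψ₂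
      (conjugateBy U (besselMax α)) := by
  obtain ⟨v₁, hv₁, hv₁'⟩ := h₁.exists_mem_graph hU ht hk hα
  obtain ⟨v₂, hv₂, hv₂'⟩ := h₂.exists_mem_graph hU ht hk hα
  refine ⟨le_antisymm ?_ ?_, fun ψ hψ => ?_, fun ψ c₁ c₂ h => ?_⟩
  · intro ψ hψ
    obtain ⟨γ, hγ⟩ := LinearPMap.mem_domain_iff.1 hψ
    obtain ⟨c₁, c₂, hc⟩ := exists_coeff hU ht hk hα hm hm1 h₁ h₂ hγ
    rw [← mem_domain_closure_coreGraph hm hm1 hk] at hc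
    refine Submodule.mem_sup.2 ⟨_, hc, c₁ • ψ₁ + c₂ • ψ₂,
      Submodule.mem_span_pair.2 ⟨c₁, c₂, rfl⟩, by abel⟩
  · refine sup_le (fun ψ hψ => ?_) (Submodule.span_le.2 ?_)
    · obtain ⟨⟨u, hu⟩, h0⟩ := (mem_domain_closure_coreGraph hm hm1 hk).1 hψ
      obtain ⟨v, hv, -⟩ := exists_mem_graph_of_isSqMul hU ht hk hα hu h0
      exact LinearPMap.mem_domain_iff.2 ⟨v, hv⟩
    · rintro ψ (rfl | rfl)
      · exact LinearPMap.mem_domain_iff.2 ⟨v₁, hv₁⟩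
      · exact LinearPMap.mem_domain_iff.2 ⟨v₂, hv₂⟩
  · obtain ⟨γ, hγ⟩ := LinearPMap.mem_domain_iff.1 hψ
    obtain ⟨c₁, c₂, hc⟩ := exists_coeff hU ht hk hα hm hm1 h₁ h₂ hγ
    refine ⟨(c₁, c₂), (mem_domain_closure_coreGraph hm hm1 hk).2 hc, ?_⟩
    rintro ⟨c₁', c₂'⟩ hc'
    have hd := Submodule.sub_mem _ ((mem_domain_closure_coreGraph hm hm1 hk).2 hc) hc'
    have e : (ψ - c₁ • ψ₁ - c₂ • ψ₂) - (ψ - c₁' • ψ₁ - c₂' • ψ₂) =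
        (c₁' - c₁) • ψ₁ + (c₂' - c₂) • ψ₂ := by
      rw [sub_smul, sub_smul]
      abel
    simp only at hd
    rw [e] at hd
    obtain ⟨⟨u, hu⟩, -⟩ := (mem_domain_closure_coreGraph hm hm1 hk).1 hd
    obtain ⟨z1, z2⟩ := eq_zero_of_isSqMul_tail hm1 h₁ h₂ hu
    exact Prod.ext (sub_eq_zero.1 z1) (sub_eq_zero.1 z2)
  · obtain ⟨⟨u, hu⟩, h0⟩ := (mem_domain_closure_coreGraph hm hm1 hk).1 h
    obtain ⟨χ, hχ⟩ : ∃ χ : L2Half, χ = (ψ : L2Half) - c₁ • ψ₁ - c₂ • ψ₂ := ⟨_, rfl⟩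
    rw [← hχ] at hu h0
    obtain ⟨v, hv, hv'⟩ := exists_mem_graph_of_isSqMul hU ht hk hα hu h0
    have hψ : (ψ : L2Half) = χ + c₁ • ψ₁ + c₂ • ψ₂ := by
      rw [hχ]
      abel
    have hψ' : ∀ᵐ p ∂halfLine, (ψ : L2Half) p = χ p + c₁ * ψ₁ p + c₂ * ψ₂ p := by
      filter_upwards [coeFn_sub_smul_smul (ψ : L2Half) ψ₁ ψ₂ c₁ c₂] with p hp
      rw [← hχ] at hp
      rw [hp]
      ring
    have hg : ((ψ : L2Half), v + c₁ • v₁ + c₂ • v₂) ∈ (conjugateBy U (besselMax α)).graph := by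
      rw [hψ]
      exact Submodule.add_mem _ (Submodule.add_mem _ hv (Submodule.smul_mem _ c₁ hv₁))
        (Submodule.smul_mem _ c₂ hv₂)
    have hT : conjugateBy U (besselMax α) ψ = v + c₁ • v₁ + c₂ • v₂ := by
      obtain ⟨y, hy, hy'⟩ := (LinearPMap.mem_graph_iff _).1 hg
      exact (congrArg (conjugateBy U (besselMax α)) (Subtype.ext hy.symm)).trans hy'
    refine ⟨fun p => kernelInt k χ p + c₁ * (κ₁ * (p : ℂ) ^ j - originPrimitive ψ₁ p) +
      c₂ * (κ₂ * (p : ℂ) ^ j - originPrimitive ψ₂ p), fun p hp => ?_, ?_⟩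
    · refine (((tendsto_kernelInt hk hu p).add ((h₁.tendsto hk hp).const_mul c₁)).add
        ((h₂.tendsto hk hp).const_mul c₂)).congr' ?_
      filter_upwards [eventually_gt_atTop 0] with Λ hΛ
      have hint : ∀ f : L2Half, IntervalIntegrable (fun q => (k p q : ℂ) * f q) volume 0 Λ := by
        intro f
        refine (intervalIntegrable_of_L2 f le_rfl hΛ.le).continuousOn_mul ?_
        have hc := hk.continuous
        simp only [hk.eq_lower]
        fun_prop
      have e : ∫ q in (0 : ℝ)..Λ, (k p q : ℂ) * (ψ : L2Half) q =
          ∫ q in (0 : ℝ)..Λ, ((k p q : ℂ) * χ q + c₁ * ((k p q : ℂ) * ψ₁ q) +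
            c₂ * ((k p q : ℂ) * ψ₂ q)) := by
        refine intervalIntegral.integral_congr_ae ?_
        filter_upwards [(ae_restrict_iff' measurableSet_Ioi).1 hψ'] with q hq hq'
        rw [uIoc_of_le hΛ.le] at hq'
        rw [hq hq'.1]
        ring
      rw [e, intervalIntegral.integral_add ((hint χ).add ((hint ψ₁).const_mul _))
        ((hint ψ₂).const_mul _), intervalIntegral.integral_add (hint χ) ((hint ψ₁).const_mul _),
        intervalIntegral.integral_const_mul, intervalIntegral.integral_const_mul, hct _ _ _ _ hΛ]
      ring
    · rw [hT]
      filter_upwards [hψ', hv', hv₁', hv₂', Lp.coeFn_add (v + c₁ • v₁) (c₂ • v₂),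
        Lp.coeFn_add v (c₁ • v₁), Lp.coeFn_smul c₁ v₁, Lp.coeFn_smul c₂ v₂]
        with p a0 a1 a2 a3 a4 a5 a6 a7
      rw [a4, Pi.add_apply, a5, Pi.add_apply, a6, a7, Pi.smul_apply, Pi.smul_apply, smul_eq_mul,
        smul_eq_mul, a0, a1, a2, a3]
      ring

/-- Coefficients exist by `coeff_unique`, and the limit they determine is unique, so the action
leaves no freedom. -/
theorem IsMomentumMax.unique {A : L2Half →ₗ.[ℂ] L2Half} {ct : ℂ → ℂ → ℝ → ℝ → ℂ}
    {S T : L2Half →ₗ.[ℂ] L2Half} (hS : IsMomentumMax α A k ct ψ₁ ψ₂ S)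
    (hT : IsMomentumMax α A k ct ψ₁ ψ₂ T) : S = T := by
  refine LinearPMap.ext (hS.domain_eq.trans hT.domain_eq.symm) fun ψ h1 h2 => ?_
  obtain ⟨⟨c₁, c₂⟩, hc, -⟩ := hS.coeff_unique ψ h1
  obtain ⟨ℓ, hℓ, e⟩ := hS.action ⟨ψ, h1⟩ c₁ c₂ hc
  obtain ⟨ℓ', hℓ', e'⟩ := hT.action ⟨ψ, h2⟩ c₁ c₂ hc
  refine Lp.ext ?_
  filter_upwards [e, e', ae_restrict_mem measurableSet_Ioi] with p a1 a2 hp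
  rw [a1, a2, tendsto_nhds_unique (hℓ p hp) (hℓ' p hp)]

end Domain

/-! ### The power and logarithmic tails -/

/-- `e` solves the Euler equation, `τ = e / p²`, and `E₀`, `E₁` are primitives of `τ`, `p τ`. -/
structure IsTailProfile (α : ℝ) (e τ E₀ E₁ : ℝ → ℂ) : Prop where
  hasDerivAt₀ : ∀ q, 0 < q → HasDerivAt E₀ (τ q) q
  hasDerivAt₁ : ∀ q, 0 < q → HasDerivAt E₁ (q * τ q) q
  continuousOn : ContinuousOn τ (Ioi 0)
  sq_mul : ∀ p : ℝ, 0 < p → (p : ℂ) ^ 2 * τ p = e p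
  euler : ∀ p, 0 < p → ((α : ℂ) - 1 / 4) * (E₁ p - p * E₀ p) = -e p

theorem integral_eq_add_of_tail {g τ E : ℝ → ℂ} {ψ : L2Half} {Λ₀ : ℝ} (h0 : 0 < Λ₀)
    (hg : Continuous g) (hτ : ContinuousOn τ (Ioi 0)) (hE : ∀ q, 0 < q → HasDerivAt E (g q * τ q) q)
    (h : ∀ᵐ p ∂halfLine, Λ₀ < p → ψ p = τ p) {Λ : ℝ} (hΛ : Λ₀ ≤ Λ) :
    ∫ q in (0 : ℝ)..Λ, g q * ψ q = (∫ q in (0 : ℝ)..Λ₀, g q * ψ q) + E Λ - E Λ₀ := by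
  have hi : ∀ {a b : ℝ}, 0 ≤ a → 0 ≤ b → IntervalIntegrable (fun q => g q * ψ q) volume a b :=
    fun ha hb => (intervalIntegrable_of_L2 ψ ha hb).continuousOn_mul hg.continuousOn
  have hsub : uIcc Λ₀ Λ ⊆ Ioi 0 := by
    rw [uIcc_of_le hΛ]
    exact fun x hx => h0.trans_le hx.1
  have e : ∫ q in Λ₀..Λ, g q * ψ q = ∫ q in Λ₀..Λ, g q * τ q := by
    refine intervalIntegral.integral_congr_ae ?_
    filter_upwards [(ae_restrict_iff' measurableSet_Ioi).1 h] with q hq hq'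
    rw [uIoc_of_le hΛ] at hq'
    rw [hq (h0.trans hq'.1) hq'.1]
  rw [← intervalIntegral.integral_add_adjacent_intervals (hi le_rfl h0.le)
    (hi h0.le (h0.le.trans hΛ)), e, intervalIntegral.integral_eq_sub_of_hasDerivAt
    (fun q hq => hE q (hsub hq)) ((hg.continuousOn.mul (hτ.mono hsub)).intervalIntegrable)]
  ring

theorem IsTailProfile.integral_eq {α : ℝ} {e τ E₀ E₁ : ℝ → ℂ} (h : IsTailProfile α e τ E₀ E₁)
    {ψ : L2Half} {Λ₀ : ℝ} (h0 : 0 < Λ₀) (hψ : ∀ᵐ p ∂halfLine, Λ₀ < p → ψ p = τ p) {Λ : ℝ}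
    (hΛ : Λ₀ ≤ Λ) : (∫ q in (0 : ℝ)..Λ, ψ q = (∫ q in (0 : ℝ)..Λ₀, ψ q) + E₀ Λ - E₀ Λ₀) ∧
      ∫ q in (0 : ℝ)..Λ, (q : ℂ) * ψ q = (∫ q in (0 : ℝ)..Λ₀, (q : ℂ) * ψ q) + E₁ Λ - E₁ Λ₀ := by
  constructor
  · have := integral_eq_add_of_tail (g := fun _ => 1) (E := E₀) h0 continuous_const h.continuousOn
      (fun q hq => by simpa using h.hasDerivAt₀ q hq) hψ hΛ
    simpa only [one_mul] using this
  · exact integral_eq_add_of_tail (g := fun q => (q : ℂ)) (E := E₁) h0 (by fun_prop) h.continuousOn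
      h.hasDerivAt₁ hψ hΛ

/-- The prescribed value of `∫₀^Λ₀ q ψ` makes `∫₀^p q ψ` equal to `E₁(p)` without an additive
constant. The constant in `∫₀^p ψ` is harmless, as it multiplies `p` and is absorbed in `κ`. -/
theorem IsTailProfile.isTail_one {α : ℝ} {e τ E₀ E₁ : ℝ → ℂ} (h : IsTailProfile α e τ E₀ E₁)
    {ψ : L2Half} (hψ : ∃ Λ₀ : ℝ, 0 < Λ₀ ∧ (∀ᵐ p ∂halfLine, Λ₀ < p → ψ p = τ p) ∧
      ∫ q in (0 : ℝ)..Λ₀, ψ q * q = E₁ Λ₀) :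
    ∃ κ, IsTail α 1 (fun _ => 1) e E₀ ψ κ := by
  obtain ⟨Λ₀, h0, h1, h2⟩ := hψ
  refine ⟨(∫ q in (0 : ℝ)..Λ₀, ψ q) - E₀ Λ₀, Λ₀, h0, ?_, fun Λ hΛ => ?_, fun p hp => ?_⟩
  · filter_upwards [h1, ae_restrict_mem measurableSet_Ioi] with p h3 h4 h5
    rw [h3 h5, h.sq_mul p h4]
  · simp only [Complex.ofReal_one, one_mul]
    rw [(h.integral_eq h0 h1 hΛ).1]
    ring
  · have hp0 := h0.trans hp
    have h3 : ∫ q in (0 : ℝ)..Λ₀, (q : ℂ) * ψ q = E₁ Λ₀ := by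
      rw [← h2]
      simp only [mul_comm]
    rw [originPrimitive_eq_sub ψ hp0.le, (h.integral_eq h0 h1 hp.le).1,
      (h.integral_eq h0 h1 hp.le).2, h3, ← h.euler p hp0]
    ring

/-- The roles are exchanged: `∫₀^p ψ` must equal `E₀(p)` exactly, while the constant in `∫₀^p q ψ`
multiplies `p^0` and is absorbed in `κ`. -/
theorem IsTailProfile.isTail_zero {α : ℝ} {e τ E₀ E₁ : ℝ → ℂ} (h : IsTailProfile α e τ E₀ E₁)
    {ψ : L2Half} (hψ : ∃ Λ₀ : ℝ, 0 < Λ₀ ∧ (∀ᵐ p ∂halfLine, Λ₀ < p → ψ p = τ p) ∧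
      ∫ q in (0 : ℝ)..Λ₀, ψ q = E₀ Λ₀) :
    ∃ κ, IsTail α 0 (fun p => -p) e (fun Λ => -E₁ Λ) ψ κ := by
  obtain ⟨Λ₀, h0, h1, h2⟩ := hψ
  refine ⟨-((∫ q in (0 : ℝ)..Λ₀, (q : ℂ) * ψ q) - E₁ Λ₀), Λ₀, h0, ?_, fun Λ hΛ => ?_,
    fun p hp => ?_⟩
  · filter_upwards [h1, ae_restrict_mem measurableSet_Ioi] with p h3 h4 h5
    rw [h3 h5, h.sq_mul p h4]
  · simp only [Complex.ofReal_neg, neg_mul]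
    rw [intervalIntegral.integral_neg, (h.integral_eq h0 h1 hΛ).2]
    ring
  · have hp0 := h0.trans hp
    rw [originPrimitive_eq_sub ψ hp0.le, (h.integral_eq h0 h1 hp.le).1,
      (h.integral_eq h0 h1 hp.le).2, h2, ← h.euler p hp0]
    ring

theorem isTailProfile_cpow {α : ℝ} (hα : α ≠ 1 / 4) {μ : ℂ} (hμ : μ ^ 2 = (α : ℂ)) :
    IsTailProfile α (fun p => (p : ℂ) ^ (1 / 2 - μ)) (fun p => (p : ℂ) ^ (-3 / 2 - μ))
      (fun p => (p : ℂ) ^ (-1 / 2 - μ) / (-1 / 2 - μ)) (fun p => (p : ℂ) ^ (1 / 2 - μ) / (1 / 2 - μ)) := by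
  -- This product is `α - 1/4`, so the excluded value is the one at which a primitive would be
  -- logarithmic.
  have hne : (1 / 2 - μ) * (-1 / 2 - μ) ≠ 0 := by
    intro h
    refine hα ?_
    have : ((α : ℝ) : ℂ) = ((1 / 4 : ℝ) : ℂ) := by
      push_cast
      linear_combination h - hμ
    exact_mod_cast this
  have h1 := left_ne_zero_of_mul hne
  have h0 := right_ne_zero_of_mul hne
  have hp1 : ∀ {p : ℝ} (a : ℂ), 0 < p → (p : ℂ) * (p : ℂ) ^ (a - 1) = (p : ℂ) ^ a := by
    intro p a hp
    have hp0 : (p : ℂ) ≠ 0 := by exact_mod_cast hp.ne'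
    rw [Complex.cpow_sub _ _ hp0, Complex.cpow_one, mul_div_cancel₀ _ hp0]
  have e1 : (-3 / 2 - μ) = (-1 / 2 - μ) - 1 := by ring
  have e2 : (-1 / 2 - μ) = (1 / 2 - μ) - 1 := by ring
  refine ⟨fun q hq => ?_, fun q hq => ?_, continuousOn_ofReal_cpow _, fun p hp => ?_, fun p hp => ?_⟩
  · refine ((hasDerivAt_ofReal_cpow (a := -1 / 2 - μ) hq).div_const _).congr_deriv ?_
    rw [e1, mul_div_cancel_left₀ _ h0]
  · refine ((hasDerivAt_ofReal_cpow (a := 1 / 2 - μ) hq).div_const _).congr_deriv ?_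
    rw [e1, hp1 _ hq, e2, mul_div_cancel_left₀ _ h1]
  · rw [e1, sq, mul_assoc, hp1 _ hp, e2, hp1 _ hp]
  · have e3 := hp1 (1 / 2 - μ) hp
    rw [← e2] at e3
    rw [← hμ, mul_div_assoc', e3, div_sub_div _ _ h1 h0, mul_div_assoc', div_eq_iff hne]
    ring

theorem hasDerivAt_rpow_mul_log {a q : ℝ} (hq : 0 < q) :
    HasDerivAt (fun q : ℝ => q ^ a * Real.log q) (q ^ (a - 1) * (a * Real.log q + 1)) q := by
  refine ((Real.hasDerivAt_rpow_const (Or.inl hq.ne')).fun_mul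
    (Real.hasDerivAt_log hq.ne')).congr_deriv ?_
  have : q ^ a = q ^ (a - 1) * q := by
    rw [← Real.rpow_add_one hq.ne']
    ring_nf
  rw [this]
  field_simp

theorem isTailProfile_log : IsTailProfile 0 (eulerFst 0)
    (fun p => ((p ^ (-3 / 2 : ℝ) * Real.log p : ℝ) : ℂ))
    (fun p => ((-4 * p ^ (-1 / 2 : ℝ) - 2 * p ^ (-1 / 2 : ℝ) * Real.log p : ℝ) : ℂ))
    (fun p => ((-4 * p ^ (1 / 2 : ℝ) + 2 * p ^ (1 / 2 : ℝ) * Real.log p : ℝ) : ℂ)) := by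
  have hp1 : ∀ {p : ℝ} (a b : ℝ), 0 < p → b = a - 1 → p * p ^ b = p ^ a := by
    intro p a b hp hab
    rw [hab, Real.rpow_sub_one hp.ne', mul_div_cancel₀ _ hp.ne']
  refine ⟨fun q hq => ?_, fun q hq => ?_, ?_, fun p hp => ?_, fun p hp => ?_⟩
  · refine HasDerivAt.ofReal_comp (f := fun p => -4 * p ^ (-1 / 2 : ℝ) -
      2 * p ^ (-1 / 2 : ℝ) * Real.log p) ?_
    have h := ((Real.hasDerivAt_rpow_const (p := -1 / 2) (Or.inl hq.ne')).const_mul (-4)).fun_sub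
      ((hasDerivAt_rpow_mul_log (a := -1 / 2) hq).const_mul 2)
    simp only [← mul_assoc] at h
    refine h.congr_deriv ?_
    rw [show (-1 / 2 - 1 : ℝ) = -3 / 2 by norm_num]
    ring
  · rw [← Complex.ofReal_mul]
    refine HasDerivAt.ofReal_comp (f := fun p => -4 * p ^ (1 / 2 : ℝ) +
      2 * p ^ (1 / 2 : ℝ) * Real.log p) ?_
    have h := ((Real.hasDerivAt_rpow_const (p := 1 / 2) (Or.inl hq.ne')).const_mul (-4)).fun_add
      ((hasDerivAt_rpow_mul_log (a := 1 / 2) hq).const_mul 2)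
    simp only [← mul_assoc] at h
    refine h.congr_deriv ?_
    rw [show (1 / 2 - 1 : ℝ) = -1 / 2 by norm_num, ← mul_assoc, hp1 (-1 / 2) (-3 / 2) hq (by norm_num)]
    ring
  · refine Complex.continuous_ofReal.comp_continuousOn (ContinuousOn.mul ?_ ?_)
    · exact continuousOn_id.rpow_const fun x hx => Or.inl (ne_of_gt hx)
    · exact Real.continuousOn_log.mono fun x hx => ne_of_gt hx
  · rw [eulerFst, if_pos rfl]
    have : p ^ 2 * p ^ (-3 / 2 : ℝ) = p ^ (1 / 2 : ℝ) := by
      rw [sq, mul_assoc, hp1 (-1 / 2) (-3 / 2) hp (by norm_num), hp1 (1 / 2) _ hp (by norm_num)]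
    have e : (p : ℂ) ^ (1 / 2 : ℂ) = ((p ^ (1 / 2 : ℝ) : ℝ) : ℂ) := by
      rw [Complex.ofReal_cpow hp.le]
      norm_num
    rw [e, ← this]
    push_cast
    ring
  · rw [eulerFst, if_pos rfl]
    have e : (p : ℂ) ^ (1 / 2 : ℂ) = ((p ^ (1 / 2 : ℝ) : ℝ) : ℂ) := by
      rw [Complex.ofReal_cpow hp.le]
      norm_num
    rw [e, ← hp1 (1 / 2) (-1 / 2) hp (by norm_num)]
    push_cast
    ring

/-! ### Existence of admissible tails -/

theorem memLp_cpow_tail {μ : ℂ} (hμ : -1 < μ.re) :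
    MemLp ((Ioi (1 : ℝ)).indicator fun p : ℝ => (p : ℂ) ^ (-3 / 2 - μ)) 2 halfLine := by
  have hr : (-3 / 2 - μ).re = -3 / 2 - μ.re := by
    simp [Complex.sub_re]
  refine MemLp.restrict _ ((memLp_indicator_iff_restrict measurableSet_Ioi).2 ?_)
  have hm : AEStronglyMeasurable (fun p : ℝ => (p : ℂ) ^ (-3 / 2 - μ)) (volume.restrict (Ioi 1)) :=
    ((continuousOn_ofReal_cpow _).mono (Ioi_subset_Ioi zero_le_one)).aestronglyMeasurable
      measurableSet_Ioi
  rw [memLp_two_iff_integrable_sq_norm hm]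
  refine (integrableOn_Ioi_rpow_of_lt (a := 2 * (-3 / 2 - μ.re)) (by linarith) one_pos).congr_fun
    (fun p hp => ?_) measurableSet_Ioi
  have hp0 : (0 : ℝ) < p := one_pos.trans hp
  simp only
  rw [Complex.norm_cpow_eq_rpow_re_of_pos hp0, hr, mul_comm, Real.rpow_mul hp0.le, Real.rpow_two]

theorem memLp_log_tail : MemLp ((Ioi (1 : ℝ)).indicator fun p : ℝ =>
    ((p ^ (-3 / 2 : ℝ) * Real.log p : ℝ) : ℂ)) 2 halfLine := by
  -- From `log p ≤ 4 p^(1/4)`, the logarithmic tail is at most `4 p^(-5/4)` beyond `1`; the exponent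
  -- `-5/4` corresponds to `μ = -1/4`.
  have h := (memLp_cpow_tail (μ := -1 / 4) (by norm_num [Complex.div_re])).const_mul 4
  refine h.mono ?_ (Eventually.of_forall fun p => ?_)
  · refine (Measurable.indicator ?_ measurableSet_Ioi).aestronglyMeasurable
    fun_prop
  · by_cases hp : p ∈ Ioi (1 : ℝ)
    · have hp1 : 1 < p := hp
      have hp0 : (0 : ℝ) < p := one_pos.trans hp
      rw [indicator_of_mem hp, indicator_of_mem hp, norm_mul,
        Complex.norm_cpow_eq_rpow_re_of_pos hp0, Complex.norm_real, norm_mul,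
        Real.norm_of_nonneg (Real.rpow_nonneg hp0.le _),
        Real.norm_of_nonneg (Real.log_nonneg hp1.le)]
      have e : (-3 / 2 - -1 / 4 : ℂ).re = -3 / 2 + 1 / 4 := by
        norm_num [Complex.div_re]
      rw [e, Real.rpow_add hp0]
      have hl := Real.log_le_rpow_div hp0.le (ε := 1 / 4) (by norm_num)
      have : 0 ≤ p ^ (-3 / 2 : ℝ) := Real.rpow_nonneg hp0.le _
      calc p ^ (-3 / 2 : ℝ) * Real.log p ≤ p ^ (-3 / 2 : ℝ) * (p ^ (1 / 4 : ℝ) / (1 / 4)) := by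
            gcongr
        _ = 4 * (p ^ (-3 / 2 : ℝ) * p ^ (1 / 4 : ℝ)) := by ring
        _ = _ := by norm_num
    · simp [indicator_of_notMem hp]

/-- A multiple of `χ`, supported below `1`, adjusts the integral without changing the tail. -/
theorem exists_tail (j : ℕ) {τ : ℝ → ℂ} (hτ : MemLp ((Ioi (1 : ℝ)).indicator τ) 2 halfLine) (z : ℂ) :
    ∃ ψ : L2Half, (∀ᵐ p ∂halfLine, 1 < p → ψ p = τ p) ∧
      ∫ q in (0 : ℝ)..1, ψ q * (q : ℂ) ^ j = z := by
  obtain ⟨χ, -, -, hχ0, hχ1⟩ := exists_unit_moment j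
  have hae : ∀ᵐ p ∂halfLine, (hτ.toLp _ + z • χ : L2Half) p =
      (Ioi (1 : ℝ)).indicator τ p + z * χ p := by
    filter_upwards [hτ.coeFn_toLp, Lp.coeFn_add (hτ.toLp _) (z • χ), Lp.coeFn_smul z χ]
      with p h1 h2 h3
    rw [h2, Pi.add_apply, h1, h3, Pi.smul_apply, smul_eq_mul]
  refine ⟨hτ.toLp _ + z • χ, ?_, ?_⟩
  · filter_upwards [hae, hχ0] with p h1 h2 hp
    rw [h1, h2 hp.le, indicator_of_mem (by exact hp), mul_zero, add_zero]
  · have e : ∫ q, χ q * (q : ℂ) ^ j ∂halfLine = ∫ q in Ioc 0 1, χ q * (q : ℂ) ^ j := by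
      refine setIntegral_eq_of_subset_of_ae_sdiff_eq_zero measurableSet_Ioi.nullMeasurableSet
        (fun x hx => hx.1) ?_
      filter_upwards [(ae_restrict_iff' measurableSet_Ioi).1 hχ0] with q hq hq'
      rw [hq hq'.1, zero_mul]
      by_contra hlt
      exact hq'.2 ⟨hq'.1, by linarith⟩
    calc ∫ q in (0 : ℝ)..1, (hτ.toLp _ + z • χ : L2Half) q * (q : ℂ) ^ j
        = ∫ q in (0 : ℝ)..1, z * (χ q * (q : ℂ) ^ j) := by
          refine intervalIntegral.integral_congr_ae ?_
          filter_upwards [(ae_restrict_iff' measurableSet_Ioi).1 hae] with q hq hq'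
          rw [uIoc_of_le zero_le_one] at hq'
          rw [hq hq'.1, indicator_of_notMem (show q ∉ Ioi 1 from not_lt.2 hq'.2), zero_add, mul_assoc]
      _ = z := by
          rw [intervalIntegral.integral_const_mul, intervalIntegral.integral_of_le zero_le_one, ← e,
            hχ1, mul_one]

/-! ### The two representations -/

/-- Since `m²` is real, `m` is real or purely imaginary; in the real case `m² = α < 1`. -/
theorem abs_re_lt_one {α : ℝ} (hα : α < 1) {m : ℂ} (hm : m ^ 2 = (α : ℂ)) : |m.re| < 1 := by
  have h1 := congrArg Complex.re hm
  have h2 := congrArg Complex.im hm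
  rw [sq, Complex.mul_re, Complex.ofReal_re] at h1
  rw [sq, Complex.mul_im, Complex.ofReal_im] at h2
  rw [← sq_lt_one_iff_abs_lt_one]
  rcases mul_eq_zero.1 (show m.re * m.im = 0 by linarith) with h | h
  · rw [h]
    norm_num
  · rw [h] at h1
    nlinarith

theorem IsTrigTransform.isUnitaryInvolution {t : ℝ → ℝ} {U : L2Half →ₗ[ℂ] L2Half}
    (h : IsTrigTransform t U) : IsUnitaryInvolution U :=
  ⟨h.norm_map, h.involutive⟩

/-- The divergent part of `∫₀^Λ ψ` for the first tail. -/
noncomputable def tailFst (m : ℂ) (Λ : ℝ) : ℂ :=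
  open Classical in
  if m = 0 then ((-4 * Λ ^ (-1 / 2 : ℝ) - 2 * Λ ^ (-1 / 2 : ℝ) * Real.log Λ : ℝ) : ℂ)
  else (Λ : ℂ) ^ (-1 / 2 - m) / (-1 / 2 - m)

/-- The divergent part of `∫₀^Λ q ψ(q) dq` for the first tail. -/
noncomputable def tailFst' (m : ℂ) (Λ : ℝ) : ℂ :=
  open Classical in
  if m = 0 then ((-4 * Λ ^ (1 / 2 : ℝ) + 2 * Λ ^ (1 / 2 : ℝ) * Real.log Λ : ℝ) : ℂ)
  else (Λ : ℂ) ^ (1 / 2 - m) / (1 / 2 - m)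

theorem eulerSnd_eq (m : ℂ) : eulerSnd m = fun p : ℝ => (p : ℂ) ^ (1 / 2 - -m) := by
  funext p
  rw [eulerSnd, sub_neg_eq_add]

theorem isTailPairD_isTail {α : ℝ} (hα : α ≠ 1 / 4) {m : ℂ} (hm : m ^ 2 = (α : ℂ))
    {ψ₁ ψ₂ : L2Half} (h : IsTailPairD m ψ₁ ψ₂) :
    (∃ κ, IsTail α 1 (fun _ => 1) (eulerFst m) (tailFst m) ψ₁ κ) ∧
      ∃ κ, IsTail α 1 (fun _ => 1) (eulerSnd m)
        (fun Λ => (Λ : ℂ) ^ (-1 / 2 - -m) / (-1 / 2 - -m)) ψ₂ κ := by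
  rcases h with ⟨h0, h1, h2⟩ | ⟨rfl, h1, h2⟩
  · have e1 : eulerFst m = fun p : ℝ => (p : ℂ) ^ (1 / 2 - m) := by
      funext p
      rw [eulerFst, if_neg h0]
    have e2 : tailFst m = fun Λ : ℝ => (Λ : ℂ) ^ (-1 / 2 - m) / (-1 / 2 - m) := by
      funext p
      rw [tailFst, if_neg h0]
    rw [e1, e2, eulerSnd_eq]
    exact ⟨(isTailProfile_cpow hα hm).isTail_one h1,
      (isTailProfile_cpow hα (by rw [neg_sq, hm])).isTail_one h2⟩
  · have hα0 : α = 0 := by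
      rw [zero_pow two_ne_zero] at hm
      exact_mod_cast hm.symm
    subst hα0
    have e2 : tailFst 0 = fun Λ : ℝ =>
        ((-4 * Λ ^ (-1 / 2 : ℝ) - 2 * Λ ^ (-1 / 2 : ℝ) * Real.log Λ : ℝ) : ℂ) := by
      funext p
      rw [tailFst, if_pos rfl]
    rw [e2, eulerSnd_eq, neg_zero]
    exact ⟨isTailProfile_log.isTail_one h1, (isTailProfile_cpow hα hm).isTail_one h2⟩

theorem isTailPairN_isTail {α : ℝ} (hα : α ≠ 1 / 4) {m : ℂ} (hm : m ^ 2 = (α : ℂ))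
    {ψ₁ ψ₂ : L2Half} (h : IsTailPairN m ψ₁ ψ₂) :
    (∃ κ, IsTail α 0 (fun p => -p) (eulerFst m) (fun Λ => -tailFst' m Λ) ψ₁ κ) ∧
      ∃ κ, IsTail α 0 (fun p => -p) (eulerSnd m)
        (fun Λ => -((Λ : ℂ) ^ (1 / 2 - -m) / (1 / 2 - -m))) ψ₂ κ := by
  rcases h with ⟨h0, h1, h2⟩ | ⟨rfl, h1, h2⟩
  · have e1 : eulerFst m = fun p : ℝ => (p : ℂ) ^ (1 / 2 - m) := by
      funext p
      rw [eulerFst, if_neg h0]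
    have e2 : tailFst' m = fun Λ : ℝ => (Λ : ℂ) ^ (1 / 2 - m) / (1 / 2 - m) := by
      funext p
      rw [tailFst', if_neg h0]
    rw [e1, e2, eulerSnd_eq]
    exact ⟨(isTailProfile_cpow hα hm).isTail_zero h1,
      (isTailProfile_cpow hα (by rw [neg_sq, hm])).isTail_zero h2⟩
  · have hα0 : α = 0 := by
      rw [zero_pow two_ne_zero] at hm
      exact_mod_cast hm.symm
    subst hα0
    have e2 : tailFst' 0 = fun Λ : ℝ =>
        ((-4 * Λ ^ (1 / 2 : ℝ) + 2 * Λ ^ (1 / 2 : ℝ) * Real.log Λ : ℝ) : ℂ) := by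
      funext p
      rw [tailFst', if_pos rfl]
    rw [e2, eulerSnd_eq, neg_zero]
    exact ⟨isTailProfile_log.isTail_zero h1, (isTailProfile_cpow hα hm).isTail_zero h2⟩

theorem exists_isTailPairD {m : ℂ} (hm : |m.re| < 1) : ∃ ψ₁ ψ₂ : L2Half, IsTailPairD m ψ₁ ψ₂ := by
  have hm' := abs_lt.1 hm
  have hp : ∀ μ : ℂ, -1 < μ.re → ∃ ψ, IsPowerTailD μ ψ := fun μ hμ => by
    obtain ⟨ψ, h1, h2⟩ := exists_tail 1 (memLp_cpow_tail hμ)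
      (((1 : ℝ) : ℂ) ^ (1 / 2 - μ) / (1 / 2 - μ))
    simp only [pow_one] at h2
    exact ⟨ψ, 1, one_pos, h1, h2⟩
  by_cases h0 : m = 0
  · obtain ⟨ψ, h1, h2⟩ := exists_tail 1 memLp_log_tail
      ((-4 * 1 ^ (1 / 2 : ℝ) + 2 * 1 ^ (1 / 2 : ℝ) * Real.log 1 : ℝ) : ℂ)
    simp only [pow_one] at h2
    obtain ⟨ψ₂, h⟩ := hp 0 (by simp)
    exact ⟨ψ, ψ₂, Or.inr ⟨h0, ⟨1, one_pos, h1, h2⟩, h⟩⟩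
  · obtain ⟨ψ₁, h1⟩ := hp m hm'.1
    obtain ⟨ψ₂, h2⟩ := hp (-m) (by rw [Complex.neg_re]; linarith)
    exact ⟨ψ₁, ψ₂, Or.inl ⟨h0, h1, h2⟩⟩

theorem exists_isTailPairN {m : ℂ} (hm : |m.re| < 1) : ∃ ψ₁ ψ₂ : L2Half, IsTailPairN m ψ₁ ψ₂ := by
  have hm' := abs_lt.1 hm
  have hp : ∀ μ : ℂ, -1 < μ.re → ∃ ψ, IsPowerTailN μ ψ := fun μ hμ => by
    obtain ⟨ψ, h1, h2⟩ := exists_tail 0 (memLp_cpow_tail hμ)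
      (((1 : ℝ) : ℂ) ^ (-1 / 2 - μ) / (-1 / 2 - μ))
    simp only [pow_zero, mul_one] at h2
    exact ⟨ψ, 1, one_pos, h1, h2⟩
  by_cases h0 : m = 0
  · obtain ⟨ψ, h1, h2⟩ := exists_tail 0 memLp_log_tail
      ((-4 * 1 ^ (-1 / 2 : ℝ) - 2 * 1 ^ (-1 / 2 : ℝ) * Real.log 1 : ℝ) : ℂ)
    simp only [pow_zero, mul_one] at h2
    obtain ⟨ψ₂, h⟩ := hp 0 (by simp)
    exact ⟨ψ, ψ₂, Or.inr ⟨h0, ⟨1, one_pos, h1, by simpa using h2⟩, h⟩⟩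
  · obtain ⟨ψ₁, h1⟩ := hp m hm'.1
    obtain ⟨ψ₂, h2⟩ := hp (-m) (by rw [Complex.neg_re]; linarith)
    exact ⟨ψ₁, ψ₂, Or.inl ⟨h0, h1, h2⟩⟩

theorem countertermD_eq (m c₁ c₂ : ℂ) {Λ : ℝ} (p : ℝ) (hΛ : 0 < Λ) : countertermD m c₁ c₂ Λ p =
    -((p : ℂ) ^ 1 * (c₁ * tailFst m Λ + c₂ * ((Λ : ℂ) ^ (-1 / 2 - -m) / (-1 / 2 - -m)))) := by
  rw [countertermD, tailFst]
  split_ifs with h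
  · have e : (Λ : ℂ) ^ (-1 / 2 : ℂ) = ((Λ ^ (-1 / 2 : ℝ) : ℝ) : ℂ) := by
      rw [Complex.ofReal_cpow hΛ.le]
      norm_num
    rw [h, neg_zero, sub_zero, e]
    push_cast
    ring
  · rw [show (-1 / 2 - m : ℂ) = -(1 / 2 + m) by ring, show (-1 / 2 - -m : ℂ) = -(1 / 2 - m) by ring,
      show (-1 / 2 + m : ℂ) = -(1 / 2 - m) by ring, div_neg, div_neg]
    ring

theorem neg_countertermN_eq (m c₁ c₂ : ℂ) {Λ : ℝ} (p : ℝ) (hΛ : 0 < Λ) :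
    -countertermN m c₁ c₂ Λ =
    -((p : ℂ) ^ 0 * (c₁ * -tailFst' m Λ + c₂ * -((Λ : ℂ) ^ (1 / 2 - -m) / (1 / 2 - -m)))) := by
  rw [countertermN, tailFst']
  split_ifs with h
  · have e : (Λ : ℂ) ^ (1 / 2 : ℂ) = ((Λ ^ (1 / 2 : ℝ) : ℝ) : ℂ) := by
      rw [Complex.ofReal_cpow hΛ.le]
      norm_num
    rw [h, neg_zero, sub_zero, e]
    push_cast
    ring
  · rw [sub_neg_eq_add]
    ring

/-! ### The theorem -/

theorem theorem2 (α : ℝ) (hα : α < 1) (hα' : α ≠ 1 / 4) (m : ℂ) (hm : m ^ 2 = (α : ℂ)) :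
    (IsUnitaryInvolution sineTransform ∧
      (∃ ψ₁ ψ₂ : L2Half, IsTailPairD m ψ₁ ψ₂) ∧
      ∃ T : L2Half →ₗ.[ℂ] L2Half,
        (∀ ψ₁ ψ₂ : L2Half, IsTailPairD m ψ₁ ψ₂ →
          ∀ S : L2Half →ₗ.[ℂ] L2Half, IsMomentumMaxD α m ψ₁ ψ₂ S ↔ S = T) ∧
        T.IsClosed ∧
        T = conjugateBy sineTransform (besselMax α)) ∧
    (IsUnitaryInvolution cosineTransform ∧
      (∃ ψ₁ ψ₂ : L2Half, IsTailPairN m ψ₁ ψ₂) ∧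
      ∃ T : L2Half →ₗ.[ℂ] L2Half,
        (∀ ψ₁ ψ₂ : L2Half, IsTailPairN m ψ₁ ψ₂ →
          ∀ S : L2Half →ₗ.[ℂ] L2Half, IsMomentumMaxN α m ψ₁ ψ₂ S ↔ S = T) ∧
        T.IsClosed ∧
        T = conjugateBy cosineTransform (besselMax α)) := by
  have hm1 := abs_re_lt_one hα hm
  -- The conjugated operator itself is the witness `T`. It does not involve `ψ₁, ψ₂`, so
  -- independence of their choice is built in, and it remains to see that `T` alone has the defining
  -- properties.
  refine ⟨⟨isTrigTransform_sine.isUnitaryInvolution, exists_isTailPairD hm1, _,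
    fun ψ₁ ψ₂ h S => ?_, isClosed_conjugateBy_besselMax isTrigTransform_sine isTrigKernel_sin
      isParityKernel_kernelD hα', rfl⟩,
    ⟨isTrigTransform_cosine.isUnitaryInvolution, exists_isTailPairN hm1, _,
    fun ψ₁ ψ₂ h S => ?_, isClosed_conjugateBy_besselMax isTrigTransform_cosine isTrigKernel_cos
      isParityKernel_kernelN hα', rfl⟩⟩
  · obtain ⟨⟨κ₁, h₁⟩, κ₂, h₂⟩ := isTailPairD_isTail hα' hm h
    have hT : IsMomentumMaxD α m ψ₁ ψ₂ (conjugateBy sineTransform (besselMax α)) :=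
      isMomentumMax_conjugateBy isTrigTransform_sine isTrigKernel_sin isParityKernel_kernelD hα' hm
        hm1 h₁ h₂ fun c₁ c₂ Λ p hΛ => countertermD_eq m c₁ c₂ p hΛ
    exact ⟨fun hS => IsMomentumMax.unique hS hT, fun hS => hS ▸ hT⟩
  · obtain ⟨⟨κ₁, h₁⟩, κ₂, h₂⟩ := isTailPairN_isTail hα' hm h
    have hT : IsMomentumMaxN α m ψ₁ ψ₂ (conjugateBy cosineTransform (besselMax α)) :=
      isMomentumMax_conjugateBy isTrigTransform_cosine isTrigKernel_cos isParityKernel_kernelN hα' hm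
        hm1 h₁ h₂ fun c₁ c₂ Λ p hΛ => neg_countertermN_eq m c₁ c₂ p hΛ
    exact ⟨fun hS => IsMomentumMax.unique hS hT, fun hS => hS ▸ hT⟩
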